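/- Fix $n\ge 2$. **Setting.** Let $\dot\Delta_n(\mathbb Z)$ be the set of $t\in\mathbb Z_{\ge 0}^4$ with $\sum t_i=n$ other than the four vertices $ne_i$; the *subsimplices* are the $s\in\mathbb Z_{\ge0}^4$ with $\sum s_i=n-2$; $S_4$ acts by $\sigma(e_i)=e_{\sigma(i)}$. Let $N\subset \mathrm{SL}(n,\mathbb C)$ be the upper unitriangular group, $B$ and $H$ the images in $\mathrm{PGL}(n,\mathbb C)$ of the upper triangular and of the diagonal matrices, $q_1$ the counter-diagonal matrix of $1$'s. A concrete triangulation $\mathcal T$ of a compact oriented $3$-manifold $M$ (boundary components collapsed to points) consists of finitely many ordered $3$-simplices whose faces are glued in pairs; $\sigma\in S_4$ denotes a face pairing permutation, $\epsilon_\Delta=\pm1$ compares the orientation of $\Delta$ given by its vertex ordering with that of $M$. *Ptolemy assignments.* On a simplex: $c\colon\dot\Delta_n(\mathbb Z)\to\mathbb C\setminus\{0\}$ with $c_{s+1001}c_{s+0110}+c_{s+1100}c_{s+0011}=c_{s+1010}c_{s+0101}$ for all subsimplices $s$. On $\mathcal T$: one for each simplex, with $\sigma^*c_{\Delta_1}=c_{\Delta_0}$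 on each face of $\Delta_0$ paired with one of $\Delta_1$ via $\sigma$, where $(\sigma^*c)_t=\det(I_{\sigma,\sigma(t)})\,c_{\sigma(t)}$; here $I_{\sigma,t}=[I_{\sigma(0)}|\dots|I_{\sigma(3)}]$ if the identity matrix is cut into blocks $[I_0|I_1|I_2|I_3]$ of widths $t_0,\dots,t_3$. Put $c_{ne_i}=1$. *Shape assignments.* Numbers $z_s^e\in\mathbb C\setminus\{0,1\}$, $s$ a subsimplex, $e\in\dot\Delta_2(\mathbb Z)$, with $z_s^{0011}=z_s^{1100}=\frac1{1-z_s^{0101}}$, $z_s^{0110}=z_s^{1001}=\frac1{1-z_s^{0011}}$, $z_s^{0101}=z_s^{1010}=\frac1{1-z_s^{0110}}$; on $\mathcal T$: one for each simplex, with $\prod_{(t,\Delta)\in p}\prod_{s+e=t}(z_{s,\Delta}^e)^{\epsilon_\Delta}=1$ for every non-vertex integral point $p$ of $\mathcal T$. Shape assignments on a single simplex are required to satisfy $\prod_{s+e=t}z^e_s=1$ for all $t$ with all $t_i>0$. Pullback: $(\sigma^*z)_s^e=(z_{\sigma(s)}^{\sigma(e)})^{\mathrm{sgn}\,\sigma}$.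 *Decorations.* A $G/K$-decoration of a simplex is a tuple $(g_0K,\dots,g_3K)$ up to left multiplication by $G$; it is generic if $\det(\{g_0\}_{t_0}\cup\dots\cup\{g_3\}_{t_3})\ne0$ for all $t\in\mathbb Z^4_{\ge0}$ with $\sum t_i=n$, where $\{g\}_i$ denotes the first $i$ columns of (a lift of) $g$. A decoration of $\mathcal T$ is a decoration of each simplex such that the decorations of paired faces differ by left multiplication by a unique element of $G$ and these elements define a representation of $\pi_1(M)$, i.e. multiply to $1$ around each edge of $\mathcal T$. It is generic if it is generic on each simplex. Pullback: $\sigma^*(g_iK)_i=(g_{\sigma(i)}K)_i$. *Cocycles.* Vertices of the doubly truncated simplex are the triples $v_0v_1v_2$ of distinct vertices. A $G$-cocycle labels its oriented edges by $G$, inversely under reversal and with product $1$ around each $2$-cell; $\alpha^{v_0v_1v_2},\beta^{v_0v_1v_2},\gamma^{v_0v_1v_2}$ are the labels of the long, middle and short edges to $v_1v_0v_2$, $v_0v_2v_1$, $v_0v_1v_3$. In a $(G,K,L)$-cocycle middle labels lie in $K$ and short ones in $L$; a $(G,K)$-cocycle (on the truncated simplex) is a $(G,K,1)$-cocycle. The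 natural $(\mathrm{SL}(n,\mathbb C),N)$-cocycle of a generic decoration $(g_iN)$ is the coboundary ($\langle v,w\rangle\mapsto(\tau^{v})^{-1}\tau^{w}$) of the unique $0$-cochain on the truncated simplex with $(g_{v_0}N,g_{v_1}N)=\tau^{v_0v_1}(N,qN)$, $q$ counter-diagonal. The natural $(\mathrm{PGL}(n,\mathbb C),B,H)$-cocycle of a generic decoration $(g_iB)$ is the coboundary of the unique $0$-cochain with $(g_{v_0}B,g_{v_1}B,g_{v_2}B)=\tau^{v_0v_1v_2}(B,q_1B,n_-B)$, $n_-$ lower unitriangular with first column of $1$'s. A natural cocycle on $\mathcal T$ is a cocycle on the decomposition of $M$ into doubly truncated simplices and prisms (so labels on identified edges agree, and the product of the short edges around each polygonal face of a prism is $1$) that is the natural cocycle of some generic decoration on each simplex. The pullback under $\sigma$ labels an edge by the label of its image under $\sigma$. *Maps.* $\mathcal C(g_iN)_t=\det(\{g_0\}_{t_0}\cup\dots\cup\{g_3\}_{t_3})$; $\mu(c)$ is given by $z_s^{1100}=z_s^{0011}=\frac{c_{s+1001}c_{s+0110}}{c_{s+1010}c_{s+0101}}$, $z_s^{0110}=z_s^{1001}=\frac{c_{s+0101}c_{s+1010}}{c_{s+1100}c_{s+0011}}$,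 $z_s^{1010}=z_s^{0101}=-\frac{c_{s+1100}c_{s+0011}}{c_{s+1001}c_{s+0110}}$; $\mathcal Z(\bar g_iB)=\mu(\det(\{g_0\}_{t_0}\cup\dots\cup\{g_3\}_{t_3})_t)$; $\pi$ is induced by $\mathrm{SL}(n,\mathbb C)\to\mathrm{PGL}(n,\mathbb C)$; $\mathcal L_{\alpha\beta}$, $\mathcal L_{\alpha\beta\gamma}$ send a generic decoration to its natural cocycle. Put $d^{v_0v_1v_2}_a=-\varepsilon\frac{c_{a+2v_0}c_{a+v_1+v_2}}{c_{a+v_0+v_1}c_{a+v_0+v_2}}$, with $\varepsilon$ the sign of the permutation sorting $v_0,v_1,v_2$, $d_{k,i}=d^{v_0v_1v_2}_{(i-1)v_0+(n-i-k)v_1+(k-1)v_2}$, $x_i(t)=I+tE_{i,i+1}$, and $H_i(x)=\mathrm{diag}(x,\dots,x,1,\dots,1)$ with $i$ entries $x$. The map $\tau$ sends $\sigma=\mathcal L_{\alpha\beta}(D)$ to the cocycle $\langle v,w\rangle\mapsto(\tau^v)^{-1}\sigma(\langle v,w\rangle)\tau^w$ with values in $\mathrm{PGL}(n,\mathbb C)$,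 where $\tau^{v_0v_1v_2}=\prod_{i=1}^{n-1}H_i(d_{1,i})$ for $c=\mathcal C(D)$. On $\mathcal T$ all maps are applied simplex by simplex. **Theorem.** All these maps are well defined, both for a single simplex $\Delta^3_n$ and for every concrete triangulation $\mathcal T$, and form a commutative diagram $$\begin{array}{ccccc}\{\text{Ptolemy assignments}\}&\xleftarrow{\ \mathcal C\ }&\{\text{generic }\mathrm{SL}(n,\mathbb C)/N\text{-decorations}\}&\xrightarrow{\mathcal L_{\alpha\beta}}&\{\text{natural }(\mathrm{SL}(n,\mathbb C),N)\text{-cocycles}\}\\ \downarrow\mu&&\downarrow\pi&&\downarrow\tau\\ \{\text{shape assignments}\}&\xleftarrow{\ \mathcal Z\ }&\{\text{generic }\mathrm{PGL}(n,\mathbb C)/B\text{-decorations}\}&\xrightarrow{\mathcal L_{\alpha\beta\gamma}}&\{\text{natural }(\mathrm{PGL}(n,\mathbb C),B,H)\text{-cocycles}\}\end{array}$$ in which the horizontal maps are bijections, with the following explicit inverses. 1. The inverses of $\mathcal L_{\alpha\beta}$ and $\mathcal L_{\alpha\beta\gamma}$ send a cocycle to the decoration $(K,\ \alpha^{012}K,\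 \beta^{012}\alpha^{021}K,\ \gamma^{012}\beta^{013}\alpha^{031}K)$, with $K=N$, respectively $K=B$. 2. $\mathcal L_{\alpha\beta}\mathcal C^{-1}(c)$ is the unique cocycle with $\gamma^{v_0v_1v_2}=1$, $\beta^{v_0v_1v_2}=\prod_{k=1}^{n-1}\prod_{i=1}^{n-k}x_i(d_{k,i})$, and, for $v_0<v_1$, $\alpha^{v_0v_1v_2}$ the counter-diagonal matrix whose entry in column $l+1$ ($0\le l\le n-1$) is $(-1)^l\,c_{(n-1-l)v_0+(l+1)v_1}/c_{(n-l)v_0+lv_1}$. 3. $\mathcal L_{\alpha\beta\gamma}\mathcal Z^{-1}(z)$ is the unique cocycle with $\alpha^{v_0v_1v_2}=q_1$, $$\beta^{v_0v_1v_2}=\prod_{k=1}^{n-1}\Big(\prod_{i=1}^{n-k}x_i(1)\prod_{i=1}^{n-k-1}H_i\big(X_{kv_2+iv_0+(n-k-i)v_1}^{\varepsilon_\circlearrowleft}\big)\Big)\,\mathrm{diag}\big((-1)^{n-k}\big)_{k=1}^n,\qquad \gamma^{v_0v_1v_2}=\prod_{i=1}^{n-1}H_i\Big(\big(z^{v_0+v_1}_{(i-1)v_0+(n-1-i)v_1}\big)^{-\varepsilon_\circlearrowleft}\Big),$$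 where $X_t=-\prod_{s+e=t}z_s^e$ and $\varepsilon_\circlearrowleft=\pm1$ is the sign of the permutation $v_0v_1v_2v_3$ of $0123$. Composing 2 and 3 with 1 gives $\mathcal C^{-1}$ and $\mathcal Z^{-1}$. All maps respect the symmetries of a simplex: the pullbacks under $\sigma\in S_4$ preserve each of the six sets for a simplex and commute with all maps, and, if $\mathcal T'$ is obtained from $\mathcal T$ by reordering each simplex $\Delta$ by a permutation $\sigma_\Delta$, the pullbacks under the $\sigma_\Delta$ take each of the six sets for $\mathcal T$ to the corresponding set for $\mathcal T'$. -/

import Mathlib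

open Equiv Matrix
open scoped BigOperators

namespace PtolemyShape

/-! ## Integral points of the simplex -/

/-- Non-vertex integral points of `Δ³_n`: points `t ∈ ℕ⁴` with `t₀ + t₁ + t₂ + t₃ = n`
which are not one of the four vertices `n e_i`. -/
def IntPt (n : ℕ) : Type := {t : Fin 4 → ℕ // ∑ i, t i = n ∧ ∀ i, t i ≠ n}

/-- The subsimplices of `Δ³_n`, indexed by the integral points of `Δ³_{n-2}`. -/
def Sub (n : ℕ) : Type := {s : Fin 4 → ℕ // ∑ i, s i + 2 = n}

theorem finite_of_bound (n : ℕ) (P : (Fin 4 → ℕ) → Prop) (h : ∀ t, P t → ∑ i, t i ≤ n) :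
    Finite {t : Fin 4 → ℕ // P t} := by
  refine Finite.of_injective
    (fun t : {t : Fin 4 → ℕ // P t} => fun i : Fin 4 =>
      (⟨t.1 i, Nat.lt_succ_of_le ((Finset.single_le_sum (f := t.1)
        (fun _ _ => Nat.zero_le _) (Finset.mem_univ i)).trans (h _ t.2))⟩ : Fin (n + 1))) ?_
  intro a b hab
  apply Subtype.ext
  funext i
  have := congrFun hab i
  simpa using this

instance (n : ℕ) : Finite (IntPt n) := finite_of_bound n _ fun _ h => h.1.le

instance (n : ℕ) : Finite (Sub n) := finite_of_bound n _ fun _ h => by omega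

noncomputable instance (n : ℕ) : Fintype (IntPt n) := Fintype.ofFinite _

noncomputable instance (n : ℕ) : Fintype (Sub n) := Fintype.ofFinite _

/-- The symmetry `σ ∈ S₄` acts by `σ(x)_i = x_{σ⁻¹(i)}`, so that `σ(e_i) = e_{σ(i)}`. -/
def permPt (σ : Perm (Fin 4)) (t : Fin 4 → ℕ) : Fin 4 → ℕ := fun i => t (σ.symm i)

def IntPt.act {n : ℕ} (σ : Perm (Fin 4)) (t : IntPt n) : IntPt n :=
  ⟨permPt σ t.1, by
    exact ⟨(Equiv.sum_comp σ.symm t.1).trans t.2.1, fun i => t.2.2 _⟩⟩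

def Sub.act {n : ℕ} (σ : Perm (Fin 4)) (s : Sub n) : Sub n :=
  ⟨permPt σ s.1, by
    have h : ∑ i, permPt σ s.1 i = ∑ i, s.1 i := Equiv.sum_comp σ.symm s.1
    rw [h]
    exact s.2⟩

/-- The integral point `a v₀ + b v₁ + c v₂`, where a vertex stands for its basis vector. -/
def comb (v₀ v₁ v₂ : Fin 4) (a b c : ℕ) : Fin 4 → ℕ :=
  Pi.single v₀ a + Pi.single v₁ b + Pi.single v₂ c

/-! ## Concatenations of columns -/

/-- The block (`0`, `1`, `2` or `3`) containing the column `j`, when the columns are cut into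
consecutive blocks of sizes `t 0, t 1, t 2, t 3`. -/
def blk (t : Fin 4 → ℕ) (j : ℕ) : Fin 4 :=
  if j < t 0 then 0 else if j < t 0 + t 1 then 1 else if j < t 0 + t 1 + t 2 then 2 else 3

/-- The number of columns in front of block `b`. -/
def start (t : Fin 4 → ℕ) (b : Fin 4) : ℕ := ∑ i ∈ Finset.univ.filter (· < b), t i

/-- The concatenation `{g₀}_{t₀} ∪ {g₁}_{t₁} ∪ {g₂}_{t₂} ∪ {g₃}_{t₃}` of the first `t_i` columns
of the matrices `g_i`. -/
def concat {n : ℕ} (g : Fin 4 → Matrix (Fin n) (Fin n) ℂ) (t : Fin 4 → ℕ) :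
    Matrix (Fin n) (Fin n) ℂ :=
  Matrix.of fun r j =>
    g (blk t j) r ⟨(j : ℕ) - start t (blk t j), lt_of_le_of_lt (Nat.sub_le _ _) j.2⟩

/-- The matrix `I_{σ,t} = [I^t_{σ(0)} | I^t_{σ(1)} | I^t_{σ(2)} | I^t_{σ(3)}]`, where
`I = [I^t_0 | I^t_1 | I^t_2 | I^t_3]` is the identity matrix, with `I^t_i` of size `n × t_i`. -/
def shuffle (n : ℕ) (σ : Perm (Fin 4)) (t : Fin 4 → ℕ) : Matrix (Fin n) (Fin n) ℂ :=
  Matrix.of fun r j =>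
    if (r : ℕ) = start t (σ (blk (t ∘ σ) j)) + ((j : ℕ) - start (t ∘ σ) (blk (t ∘ σ) j))
    then 1 else 0

/-! ## Ptolemy assignments and shape assignments on a simplex -/

/-- A complex number for each non-vertex integral point. -/
abbrev PtolemyFun (n : ℕ) : Type := IntPt n → ℂ

/-- A complex number for each edge of each subsimplex; the edges are indexed by
the non-vertex integral points of `Δ³_2`. -/
abbrev ShapeFun (n : ℕ) : Type := Sub n → IntPt 2 → ℂ

open Classical in
/-- The value of a Ptolemy assignment, extended by `1` (in particular to the vertex points). -/
noncomputable def PtolemyFun.val {n : ℕ} (c : PtolemyFun n) (t : Fin 4 → ℕ) : ℂ :=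
  if h : ∑ i, t i = n ∧ ∀ i, t i ≠ n then c ⟨t, h⟩ else 1

open Classical in
/-- The shape parameter `z_s^e` (with the value `1` if `s` or `e` is not a legitimate index). -/
noncomputable def ShapeFun.val {n : ℕ} (z : ShapeFun n) (s e : Fin 4 → ℕ) : ℂ :=
  if h : (∑ i, s i + 2 = n) ∧ (∑ i, e i = 2 ∧ ∀ i, e i ≠ 2) then z ⟨s, h.1⟩ ⟨e, h.2⟩ else 1

/-- Ptolemy assignments on `Δ³_n`. -/
def ptolemySet (n : ℕ) : Set (PtolemyFun n) :=
  {c | (∀ t, c t ≠ 0) ∧ ∀ s : Sub n,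
    c.val (s.1 + ![1, 0, 0, 1]) * c.val (s.1 + ![0, 1, 1, 0]) +
      c.val (s.1 + ![1, 1, 0, 0]) * c.val (s.1 + ![0, 0, 1, 1]) =
    c.val (s.1 + ![1, 0, 1, 0]) * c.val (s.1 + ![0, 1, 0, 1])}

/-- Non-degenerate shape parameters satisfying the shape parameter relations. -/
def IsShapeAssignment {n : ℕ} (z : ShapeFun n) : Prop :=
  (∀ s e, z s e ≠ 0 ∧ z s e ≠ 1) ∧ ∀ s : Sub n,
    (z.val s.1 ![0, 0, 1, 1] = z.val s.1 ![1, 1, 0, 0] ∧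
      z.val s.1 ![1, 1, 0, 0] = 1 / (1 - z.val s.1 ![0, 1, 0, 1])) ∧
    (z.val s.1 ![0, 1, 1, 0] = z.val s.1 ![1, 0, 0, 1] ∧
      z.val s.1 ![1, 0, 0, 1] = 1 / (1 - z.val s.1 ![0, 0, 1, 1])) ∧
    (z.val s.1 ![0, 1, 0, 1] = z.val s.1 ![1, 0, 1, 0] ∧
      z.val s.1 ![1, 0, 1, 0] = 1 / (1 - z.val s.1 ![0, 1, 1, 0]))

open Classical in
/-- The product of the `z_s^e` over all `(s, e)` with `s + e = t`. -/
noncomputable def shapeProd {n : ℕ} (z : ShapeFun n) (t : Fin 4 → ℕ) : ℂ :=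
  ∏ p ∈ (Finset.univ : Finset (Sub n × IntPt 2)).filter (fun p => p.1.1 + p.2.1 = t), z p.1 p.2

/-- Shape assignments on the simplex `Δ³_n` which satisfy the gluing equations at
the interior integral points. -/
def shapeSet (n : ℕ) : Set (ShapeFun n) :=
  {z | IsShapeAssignment z ∧ ∀ t : IntPt n, (∀ i, t.1 i ≠ 0) → shapeProd z t.1 = 1}

/-- `(σ^* c)_t = det(I_{σ,σ(t)}) c_{σ(t)}`. -/
noncomputable def PtolemyFun.pullback {n : ℕ} (σ : Perm (Fin 4)) (c : PtolemyFun n) :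
    PtolemyFun n :=
  fun t => (shuffle n σ (permPt σ t.1)).det * c (t.act σ)

/-- `(σ^* z)_s^e = (z_{σ(s)}^{σ(e)})^{sgn σ}`. -/
noncomputable def ShapeFun.pullback {n : ℕ} (σ : Perm (Fin 4)) (z : ShapeFun n) : ShapeFun n :=
  fun s e => z (s.act σ) (e.act σ) ^ ((Perm.sign σ : ℤˣ) : ℤ)

/-- The monomial map `μ`. -/
noncomputable def mu {n : ℕ} (c : PtolemyFun n) : ShapeFun n := fun s e =>
  if e.1 = ![1, 1, 0, 0] ∨ e.1 = ![0, 0, 1, 1] then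
    (c.val (s.1 + ![1, 0, 0, 1]) * c.val (s.1 + ![0, 1, 1, 0])) /
      (c.val (s.1 + ![1, 0, 1, 0]) * c.val (s.1 + ![0, 1, 0, 1]))
  else if e.1 = ![0, 1, 1, 0] ∨ e.1 = ![1, 0, 0, 1] then
    (c.val (s.1 + ![0, 1, 0, 1]) * c.val (s.1 + ![1, 0, 1, 0])) /
      (c.val (s.1 + ![1, 1, 0, 0]) * c.val (s.1 + ![0, 0, 1, 1]))
  else
    -((c.val (s.1 + ![1, 1, 0, 0]) * c.val (s.1 + ![0, 0, 1, 1])) /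
      (c.val (s.1 + ![1, 0, 0, 1]) * c.val (s.1 + ![0, 1, 1, 0])))

/-! ## Groups -/

abbrev SLn (n : ℕ) : Type := Matrix.SpecialLinearGroup (Fin n) ℂ

abbrev GLn (n : ℕ) : Type := Matrix.GeneralLinearGroup (Fin n) ℂ

abbrev PGLn (n : ℕ) : Type := Matrix.ProjGenLinGroup (Fin n) ℂ

/-- The class of an invertible matrix in `PGL(n, ℂ)`. -/
def pcl {n : ℕ} : GLn n →* PGLn n := Matrix.ProjGenLinGroup.mk

/-- `x ∈ PGL(n, ℂ)` is represented by the (invertible) matrix `M`. -/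
def IsClassOf {n : ℕ} (x : PGLn n) (M : Matrix (Fin n) (Fin n) ℂ) : Prop :=
  ∃ g : GLn n, (g : Matrix (Fin n) (Fin n) ℂ) = M ∧ pcl g = x

theorem inv_upper {n : ℕ} {A A' : Matrix (Fin n) (Fin n) ℂ} (h : A * A' = 1)
    (hA : A.BlockTriangular id) : A'.BlockTriangular id := by
  let _ : Invertible A := ⟨A', mul_eq_one_comm.1 h, h⟩
  have h' : A' = A⁻¹ := (Matrix.inv_eq_right_inv h).symm
  rw [h']
  exact Matrix.blockTriangular_inv_of_blockTriangular hA

theorem diag_mul_upper {n : ℕ} {A A' : Matrix (Fin n) (Fin n) ℂ}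
    (hA : A.BlockTriangular id) (hA' : A'.BlockTriangular id) (i : Fin n) :
    (A * A') i i = A i i * A' i i := by
  rw [Matrix.mul_apply]
  refine Finset.sum_eq_single i (fun k _ hk => ?_) (fun h => absurd (Finset.mem_univ i) h)
  rcases lt_or_gt_of_ne hk with hk | hk
  · rw [hA hk, zero_mul]
  · rw [hA' hk, mul_zero]

/-- `N ⊂ SL(n, ℂ)`: upper triangular matrices with `1`s on the diagonal. -/
def N (n : ℕ) : Subgroup (SLn n) where
  carrier := {g | g.1.BlockTriangular id ∧ ∀ i, g.1 i i = 1}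
  mul_mem' := by
    intro a b ha hb
    refine ⟨?_, fun i => ?_⟩
    · rw [Matrix.SpecialLinearGroup.coe_mul]
      exact ha.1.mul hb.1
    · rw [Matrix.SpecialLinearGroup.coe_mul, diag_mul_upper ha.1 hb.1, ha.2, hb.2, one_mul]
  one_mem' := ⟨Matrix.blockTriangular_one, fun i => by simp⟩
  inv_mem' := by
    intro a ha
    have h : a.1 * (a⁻¹).1 = 1 := by
      rw [← Matrix.SpecialLinearGroup.coe_mul, mul_inv_cancel, Matrix.SpecialLinearGroup.coe_one]
    have hu := inv_upper h ha.1
    refine ⟨hu, fun i => ?_⟩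
    have h1 := diag_mul_upper ha.1 hu i
    rw [h, ha.2, one_mul, Matrix.one_apply_eq] at h1
    exact h1.symm

/-- Upper triangular invertible matrices. -/
def upperGL (n : ℕ) : Subgroup (GLn n) where
  carrier := {g | (g : Matrix (Fin n) (Fin n) ℂ).BlockTriangular id}
  mul_mem' := by
    intro a b ha hb
    have : ((a * b : GLn n) : Matrix (Fin n) (Fin n) ℂ) = a.1 * b.1 := Units.val_mul a b
    change ((a * b : GLn n) : Matrix (Fin n) (Fin n) ℂ).BlockTriangular id
    rw [this]
    exact Matrix.BlockTriangular.mul ha hb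
  one_mem' := Matrix.blockTriangular_one
  inv_mem' := by
    intro a ha
    exact inv_upper (A := a.1) (Units.mul_inv a) ha

/-- The Borel subgroup `B ⊂ PGL(n, ℂ)` of upper triangular matrices. -/
def B (n : ℕ) : Subgroup (PGLn n) := (upperGL n).map pcl

/-- The subgroup `H ⊂ PGL(n, ℂ)` of diagonal matrices. -/
def H (n : ℕ) : Subgroup (PGLn n) :=
  ((Units.map (Matrix.diagonalRingHom (Fin n) ℂ : (Fin n → ℂ) →* Matrix (Fin n) (Fin n) ℂ)).range :
    Subgroup (GLn n)).map pcl

/-- The counter-diagonal matrix `q₁` whose non-zero entries are all `1`. -/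
def q₁ (n : ℕ) : GLn n :=
  have h : (Matrix.of fun i j : Fin n => if j = i.rev then (1 : ℂ) else 0) *
      (Matrix.of fun i j : Fin n => if j = i.rev then (1 : ℂ) else 0) = 1 := by
    ext i j
    rw [Matrix.mul_apply, Finset.sum_eq_single i.rev (fun k _ hk => by simp [hk])
      (fun h => absurd (Finset.mem_univ _) h)]
    simp [Matrix.one_apply, eq_comm]
  ⟨Matrix.of fun i j => if j = i.rev then 1 else 0,
    Matrix.of fun i j => if j = i.rev then 1 else 0, h, h⟩

def IsCounterDiagonal {n : ℕ} (q : Matrix (Fin n) (Fin n) ℂ) : Prop :=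
  ∀ i j, j ≠ i.rev → q i j = 0

/-- Lower triangular with `1`s on the diagonal, and with first column consisting of `1`s. -/
def IsNormalizedLower {n : ℕ} (m : Matrix (Fin n) (Fin n) ℂ) : Prop :=
  (∀ i j, i < j → m i j = 0) ∧ (∀ i, m i i = 1) ∧ ∀ i j : Fin n, (j : ℕ) = 0 → m i j = 1

/-- The canonical map `SL(n, ℂ) → PGL(n, ℂ)`. -/
def slToPGL {n : ℕ} : SLn n →* PGLn n := Matrix.SpecialLinearGroup.toPGL

/-! ## Decorations of a simplex -/

/-- `G/H`-decorations of a 3-simplex: a left `H`-coset for each vertex, up to the action of `G`. -/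
def Decoration {G : Type} [Group G] (H : Subgroup G) : Type :=
  MulAction.orbitRel.Quotient G (Fin 4 → G ⧸ H)

/-- The decoration represented by a tuple of cosets. -/
def decMk {G : Type} [Group G] {H : Subgroup G} (g : Fin 4 → G ⧸ H) : Decoration H :=
  Quotient.mk (MulAction.orbitRel G (Fin 4 → G ⧸ H)) g

/-- The decoration `(g₀H, g₁H, g₂H, g₃H)`. -/
def dec {G : Type} [Group G] (H : Subgroup G) (g : Fin 4 → G) : Decoration H :=
  decMk fun i => (g i : G ⧸ H)

/-- `σ^*(g₀H, g₁H, g₂H, g₃H) = (g_{σ(0)}H, g_{σ(1)}H, g_{σ(2)}H, g_{σ(3)}H)`. -/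
def Decoration.pullback {G : Type} [Group G] {H : Subgroup G} (σ : Perm (Fin 4)) :
    Decoration H → Decoration H :=
  Quotient.map (fun (g : Fin 4 → G ⧸ H) i => g (σ i)) (by
    rintro a b ⟨x, hx⟩
    exact ⟨x, by rw [← hx]; rfl⟩)

def IsGenericTuple {n : ℕ} (g : Fin 4 → Matrix (Fin n) (Fin n) ℂ) : Prop :=
  ∀ t : Fin 4 → ℕ, ∑ i, t i = n → (concat g t).det ≠ 0

/-- Generic `SL(n, ℂ)/N`-decorations of `Δ³_n`. -/
def genericSL (n : ℕ) : Set (Decoration (N n)) :=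
  {D | ∃ g : Fin 4 → SLn n, IsGenericTuple (fun i => (g i).1) ∧ dec (N n) g = D}

/-- Generic `PGL(n, ℂ)/B`-decorations of `Δ³_n`. -/
def genericPGL (n : ℕ) : Set (Decoration (B n)) :=
  {D | ∃ g : Fin 4 → GLn n, IsGenericTuple (fun i => (g i).1) ∧ dec (B n) (fun i => pcl (g i)) = D}

/-- `t ↦ det({g₀}_{t₀} ∪ {g₁}_{t₁} ∪ {g₂}_{t₂} ∪ {g₃}_{t₃})`. -/
noncomputable def detCoords {n : ℕ} (g : Fin 4 → Matrix (Fin n) (Fin n) ℂ) : PtolemyFun n :=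
  fun t => (concat g t.1).det

/-! ## Cocycles on the doubly truncated simplex

The vertices of the doubly truncated simplex are the ordered triples `v₀v₁v₂` of distinct vertices
of the simplex; such a triple is the same as a permutation `π`, with `v_i = π i`.
Starting at the vertex `π` there is a long edge `v₀v₁v₂ → v₁v₀v₂`, a middle edge
`v₀v₁v₂ → v₀v₂v₁`, and a short edge `v₀v₁v₂ → v₀v₁v₃`. -/

def sL : Perm (Fin 4) := swap 0 1

def sM : Perm (Fin 4) := swap 1 2

def sS : Perm (Fin 4) := swap 2 3

/-- A `G`-cocycle on the doubly truncated simplex: the labels `α` (long edges), `β` (middle edges)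
and `γ` (short edges) of the oriented edges, indexed by the initial vertex of the edge.
Its 2-cells are hexagons near the faces of the simplex (long and middle edges), hexagons near the
vertices (middle and short edges), and rectangles near the edges (long and short edges). -/
@[ext]
structure Cocycle (G : Type) [Group G] where
  α : Perm (Fin 4) → G
  β : Perm (Fin 4) → G
  γ : Perm (Fin 4) → G
  α_rev : ∀ π, α (π * sL) = (α π)⁻¹
  β_rev : ∀ π, β (π * sM) = (β π)⁻¹
  γ_rev : ∀ π, γ (π * sS) = (γ π)⁻¹
  face_hexagon : ∀ π, α π * β (π * sL) * α (π * sL * sM) * β (π * sL * sM * sL) *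
    α (π * sL * sM * sL * sM) * β (π * sL * sM * sL * sM * sL) = 1
  vertex_hexagon : ∀ π, β π * γ (π * sM) * β (π * sM * sS) * γ (π * sM * sS * sM) *
    β (π * sM * sS * sM * sS) * γ (π * sM * sS * sM * sS * sM) = 1
  rectangle : ∀ π, α π * γ (π * sL) * α (π * sL * sS) * γ (π * sL * sS * sL) = 1

theorem sL_sL : sL * sL = 1 := by decide

theorem sM_sM : sM * sM = 1 := by decide

theorem sS_sS : sS * sS = 1 := by decide

theorem sL_sM : sL * (sM * (sL * (sM * (sL * sM)))) = 1 := by decide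

theorem sM_sS : sM * (sS * (sM * (sS * (sM * sS)))) = 1 := by decide

theorem sL_sS : sL * (sS * (sL * sS)) = 1 := by decide

section

variable {G G' : Type} [Group G] [Group G']

/-- The coboundary action of a 0-cochain `τ`: the label of the edge from `v` to `w` is
multiplied by `(τ^v)⁻¹` from the left and by `τ^w` from the right. -/
def Cocycle.act (τ : Perm (Fin 4) → G) (σ : Cocycle G) : Cocycle G where
  α π := (τ π)⁻¹ * σ.α π * τ (π * sL)
  β π := (τ π)⁻¹ * σ.β π * τ (π * sM)
  γ π := (τ π)⁻¹ * σ.γ π * τ (π * sS)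
  α_rev π := by
    rw [σ.α_rev, mul_assoc π, sL_sL, mul_one]; group
  β_rev π := by
    rw [σ.β_rev, mul_assoc π, sM_sM, mul_one]; group
  γ_rev π := by
    rw [σ.γ_rev, mul_assoc π, sS_sS, mul_one]; group
  face_hexagon π := by
    have h := σ.face_hexagon π
    have hp : π * sL * sM * sL * sM * sL * sM = π := by
      simp only [mul_assoc, sL_sM, mul_one]
    rw [hp]
    calc _ = (τ π)⁻¹ * (σ.α π * σ.β (π * sL) * σ.α (π * sL * sM) * σ.β (π * sL * sM * sL) *
          σ.α (π * sL * sM * sL * sM) * σ.β (π * sL * sM * sL * sM * sL)) * τ π := by group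
      _ = 1 := by rw [h]; group
  vertex_hexagon π := by
    have h := σ.vertex_hexagon π
    have hp : π * sM * sS * sM * sS * sM * sS = π := by
      simp only [mul_assoc, sM_sS, mul_one]
    rw [hp]
    calc _ = (τ π)⁻¹ * (σ.β π * σ.γ (π * sM) * σ.β (π * sM * sS) * σ.γ (π * sM * sS * sM) *
          σ.β (π * sM * sS * sM * sS) * σ.γ (π * sM * sS * sM * sS * sM)) * τ π := by group
      _ = 1 := by rw [h]; group
  rectangle π := by
    have h := σ.rectangle π
    have hp : π * sL * sS * sL * sS = π := by
      simp only [mul_assoc, sL_sS, mul_one]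
    rw [hp]
    calc _ = (τ π)⁻¹ * (σ.α π * σ.γ (π * sL) * σ.α (π * sL * sS) * σ.γ (π * sL * sS * sL)) *
          τ π := by group
      _ = 1 := by rw [h]; group

/-- The cocycle all of whose labels are `1`. -/
def Cocycle.triv (G : Type) [Group G] : Cocycle G where
  α _ := 1
  β _ := 1
  γ _ := 1
  α_rev := by simp
  β_rev := by simp
  γ_rev := by simp
  face_hexagon := by simp
  vertex_hexagon := by simp
  rectangle := by simp

/-- The coboundary of `τ`, which labels the edge from `v` to `w` by `(τ^v)⁻¹ τ^w`. -/
def coboundary (τ : Perm (Fin 4) → G) : Cocycle G := (Cocycle.triv G).act τ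

/-- Application of a group homomorphism to all labels. -/
def Cocycle.map (f : G →* G') (σ : Cocycle G) : Cocycle G' where
  α π := f (σ.α π)
  β π := f (σ.β π)
  γ π := f (σ.γ π)
  α_rev π := by rw [σ.α_rev, map_inv]
  β_rev π := by rw [σ.β_rev, map_inv]
  γ_rev π := by rw [σ.γ_rev, map_inv]
  face_hexagon π := by simp only [← map_mul, σ.face_hexagon, map_one]
  vertex_hexagon π := by simp only [← map_mul, σ.vertex_hexagon, map_one]
  rectangle π := by simp only [← map_mul, σ.rectangle, map_one]

/-- The pullback of a cocycle under a symmetry `ρ` of the simplex: the label of an edge is the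
label of its image under `ρ`. -/
def Cocycle.pullback (ρ : Perm (Fin 4)) (σ : Cocycle G) : Cocycle G where
  α π := σ.α (ρ * π)
  β π := σ.β (ρ * π)
  γ π := σ.γ (ρ * π)
  α_rev π := by rw [← mul_assoc, σ.α_rev]
  β_rev π := by rw [← mul_assoc, σ.β_rev]
  γ_rev π := by rw [← mul_assoc, σ.γ_rev]
  face_hexagon π := by simpa only [← mul_assoc] using σ.face_hexagon (ρ * π)
  vertex_hexagon π := by simpa only [← mul_assoc] using σ.vertex_hexagon (ρ * π)
  rectangle π := by simpa only [← mul_assoc] using σ.rectangle (ρ * π)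

/-- `(G, H, K)`-cocycles: middle edges are labeled in `H`, short edges in `K`. The
`(G, H)`-cocycles on the truncated simplex are the `(G, H, {1})`-cocycles on the doubly truncated
simplex: collapsing the short edges of the latter gives the former. -/
def Cocycle.IsRel (H K : Subgroup G) (σ : Cocycle G) : Prop :=
  ∀ π, σ.β π ∈ H ∧ σ.γ π ∈ K

/-- The decoration `(H, α^{012}H, β^{012}α^{021}H, γ^{012}β^{013}α^{031}H)` determined by
a cocycle. -/
def Cocycle.toDec (H : Subgroup G) (σ : Cocycle G) : Decoration H :=
  dec H ![1, σ.α 1, σ.β 1 * σ.α sM, σ.γ 1 * σ.β sS * σ.α (sS * sM)]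

end

/-! ## Natural cocycles on a simplex -/

/-- `τ` is a 0-cochain on the truncated simplex (the value at `v₀v₁v₂` only depends on `v₀v₁`)
with `(g_{v₀}N, g_{v₁}N) = τ^{v₀v₁}(N, qN)` where `q` is counter-diagonal. -/
def IsNaturalSLCochain {n : ℕ} (g : Fin 4 → SLn n) (τ : Perm (Fin 4) → SLn n) : Prop :=
  ∀ π, τ (π * sS) = τ π ∧ (g (π 0) : SLn n ⧸ N n) = (τ π : SLn n ⧸ N n) ∧
    ∃ q : SLn n, IsCounterDiagonal q.1 ∧
      (g (π 1) : SLn n ⧸ N n) = ((τ π * q : SLn n) : SLn n ⧸ N n)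

/-- `τ` is a 0-cochain on the doubly truncated simplex with
`(g_{v₀}B, g_{v₁}B, g_{v₂}B) = τ^{v₀v₁v₂}(B, q₁B, n₋B)` where `n₋` is normalized. -/
def IsNaturalPGLCochain {n : ℕ} (g : Fin 4 → PGLn n) (τ : Perm (Fin 4) → PGLn n) : Prop :=
  ∀ π, (g (π 0) : PGLn n ⧸ B n) = (τ π : PGLn n ⧸ B n) ∧
    (g (π 1) : PGLn n ⧸ B n) = ((τ π * pcl (q₁ n) : PGLn n) : PGLn n ⧸ B n) ∧
    ∃ m : GLn n, IsNormalizedLower (m : Matrix (Fin n) (Fin n) ℂ) ∧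
      (g (π 2) : PGLn n ⧸ B n) = ((τ π * pcl m : PGLn n) : PGLn n ⧸ B n)

/-- Natural `(SL(n, ℂ), N)`-cocycles on a simplex. -/
def naturalSL (n : ℕ) : Set (Cocycle (SLn n)) :=
  {σ | σ.IsRel (N n) ⊥ ∧ ∃ (g : Fin 4 → SLn n) (τ : Perm (Fin 4) → SLn n),
    IsGenericTuple (fun i => (g i).1) ∧ IsNaturalSLCochain g τ ∧ σ = coboundary τ}

/-- Natural `(PGL(n, ℂ), B, H)`-cocycles on a simplex. -/
def naturalPGL (n : ℕ) : Set (Cocycle (PGLn n)) :=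
  {σ | σ.IsRel (B n) (H n) ∧ ∃ (g : Fin 4 → GLn n) (τ : Perm (Fin 4) → PGLn n),
    IsGenericTuple (fun i => (g i).1) ∧ IsNaturalPGLCochain (fun i => pcl (g i)) τ ∧
      σ = coboundary τ}

/-! ## Explicit formulas -/

/-- `x_i(t) = I + t E_{i,i+1}`, with rows and columns numbered from `1` to `n`. -/
def xMat (n i : ℕ) (t : ℂ) : Matrix (Fin n) (Fin n) ℂ :=
  1 + Matrix.of fun (r s : Fin n) => if (r : ℕ) + 1 = i ∧ (s : ℕ) + 1 = i + 1 then t else 0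

/-- `H_i(x)`: diagonal with `i` entries `x` followed by `n - i` entries `1`. -/
def hMat (n i : ℕ) (x : ℂ) : Matrix (Fin n) (Fin n) ℂ :=
  Matrix.diagonal fun r => if (r : ℕ) < i then x else 1

/-- The diagonal matrix with entries `(-1)^{n-k}`, `k = 1, …, n`. -/
def dSign (n : ℕ) : Matrix (Fin n) (Fin n) ℂ :=
  Matrix.diagonal fun r => (-1) ^ (n - ((r : ℕ) + 1))

/-- The sign of the permutation bringing `v₀, v₁, v₂` into increasing order. -/
def orderSign (v₀ v₁ v₂ : Fin 4) : ℂ :=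
  (if v₁ < v₀ then -1 else 1) * (if v₂ < v₀ then -1 else 1) * (if v₂ < v₁ then -1 else 1)

/-- The diamond coordinate `d^{v₀v₁v₂}_a` of a Ptolemy assignment. -/
noncomputable def diamond {n : ℕ} (c : PtolemyFun n) (v₀ v₁ v₂ : Fin 4) (a : Fin 4 → ℕ) : ℂ :=
  -orderSign v₀ v₁ v₂ *
    ((c.val (a + comb v₀ v₁ v₂ 2 0 0) * c.val (a + comb v₀ v₁ v₂ 0 1 1)) /
      (c.val (a + comb v₀ v₁ v₂ 1 1 0) * c.val (a + comb v₀ v₁ v₂ 1 0 1)))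

/-- `d_{k,i} = d^{v₀v₁v₂}_{(i-1)v₀ + (n-i-k)v₁ + (k-1)v₂}`, where `v_j = π j`. -/
noncomputable def diamondAt {n : ℕ} (c : PtolemyFun n) (π : Perm (Fin 4)) (k i : ℕ) : ℂ :=
  diamond c (π 0) (π 1) (π 2) (comb (π 0) (π 1) (π 2) (i - 1) (n - i - k) (k - 1))

/-- `q(e_{(n-1)v₀}, e_{(n-2)v₀+v₁}, …, e_{(n-1)v₁})`, the counter-diagonal matrix of ratio
coordinates `e_{kv₀+lv₁} = (-1)^l c_{kv₀+(l+1)v₁} / c_{(k+1)v₀+lv₁}`; the entry in the first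
column is `e_{(n-1)v₀}`. -/
noncomputable def longMat {n : ℕ} (c : PtolemyFun n) (π : Perm (Fin 4)) :
    Matrix (Fin n) (Fin n) ℂ :=
  Matrix.of fun r l => if r = l.rev then
    (-1) ^ (l : ℕ) * (c.val (comb (π 0) (π 1) (π 2) (n - 1 - l) (l + 1) 0) /
      c.val (comb (π 0) (π 1) (π 2) (n - 1 - l + 1) l 0)) else 0

/-- `∏_{k=1}^{n-1} ∏_{i=1}^{n-k} x_i(d_{k,i})`. -/
noncomputable def middleMat {n : ℕ} (c : PtolemyFun n) (π : Perm (Fin 4)) :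
    Matrix (Fin n) (Fin n) ℂ :=
  ((List.range' 1 (n - 1)).map fun k =>
    ((List.range' 1 (n - k)).map fun i => xMat n i (diamondAt c π k i)).prod).prod

/-- `σ` is given by the Ptolemy assignment `c` through ratio and diamond coordinates. The
formula for a long edge is for the direction given by the ordering of the vertices. -/
def IsPtolemyFormula {n : ℕ} (c : PtolemyFun n) (σ : Cocycle (SLn n)) : Prop :=
  ∀ π, (π 0 < π 1 → (σ.α π).1 = longMat c π) ∧ (σ.β π).1 = middleMat c π ∧ σ.γ π = 1

/-- The `X`-coordinate of a shape assignment at a face point. -/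
noncomputable def xCoord {n : ℕ} (z : ShapeFun n) (t : Fin 4 → ℕ) : ℂ := -shapeProd z t

/-- `∏_{k=1}^{n-1} (∏_{i=1}^{n-k} x_i(1) ∏_{i=1}^{n-k-1} H_i(X_{k,i}^ε)) d_{±1}`, where
`X_{k,i} = X_{kv₂ + iv₀ + (n-k-i)v₁}` and `ε` is the orientation sign of `v₀v₁v₂`. -/
noncomputable def middleShapeMat {n : ℕ} (z : ShapeFun n) (π : Perm (Fin 4)) :
    Matrix (Fin n) (Fin n) ℂ :=
  ((List.range' 1 (n - 1)).map fun k =>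
    ((List.range' 1 (n - k)).map fun i => xMat n i 1).prod *
    ((List.range' 1 (n - k - 1)).map fun i => hMat n i
      (xCoord z (comb (π 0) (π 1) (π 2) i (n - k - i) k) ^
        ((Perm.sign π : ℤˣ) : ℤ))).prod).prod * dSign n

/-- `∏_{i=1}^{n-1} H_i(z_i^{-ε})`, where `z_i = z_{(i-1)v₀ + (n-1-i)v₁}^{v₀+v₁}`. -/
noncomputable def shortShapeMat {n : ℕ} (z : ShapeFun n) (π : Perm (Fin 4)) :
    Matrix (Fin n) (Fin n) ℂ :=
  ((List.range' 1 (n - 1)).map fun i => hMat n i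
    (z.val (comb (π 0) (π 1) (π 2) (i - 1) (n - 1 - i) 0) (comb (π 0) (π 1) (π 2) 1 1 0) ^
      (-((Perm.sign π : ℤˣ) : ℤ)))).prod

/-- `σ` is given by the shape assignment `z`. -/
def IsShapeFormula {n : ℕ} (z : ShapeFun n) (σ : Cocycle (PGLn n)) : Prop :=
  ∀ π, σ.α π = pcl (q₁ n) ∧ IsClassOf (σ.β π) (middleShapeMat z π) ∧
    IsClassOf (σ.γ π) (shortShapeMat z π)

/-- The diagonal matrix `∏_{i=1}^{n-1} H_i(d^{v₀v₁v₂}_{1,i})`. -/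
noncomputable def tauMat {n : ℕ} (c : PtolemyFun n) (π : Perm (Fin 4)) :
    Matrix (Fin n) (Fin n) ℂ :=
  ((List.range' 1 (n - 1)).map fun i => hMat n i (diamondAt c π 1 i)).prod

/-- `σ'` arises from `σ` by the coboundary action of the 0-cochain of diagonal matrices given by
the diamond coordinates of `c`. -/
def IsTauOf {n : ℕ} (c : PtolemyFun n) (σ : Cocycle (SLn n)) (σ' : Cocycle (PGLn n)) : Prop :=
  ∃ τ : Perm (Fin 4) → PGLn n, (∀ π, IsClassOf (τ π) (tauMat c π)) ∧
    σ' = (σ.map slToPGL).act τ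

/-! ## Triangulations -/

/-- A concrete triangulation of a compact oriented 3-manifold `M` (with boundary components
collapsed to points): a finite collection of ordered simplices with all faces glued in pairs.
The face of `Δ` opposite to the vertex `i` is glued to a face of `nbr Δ i`, and
`perm Δ i` is the face pairing permutation: the gluing takes the vertex `v ≠ i` of `Δ` to the vertex
`perm Δ i v` of `nbr Δ i`, so that the other face is opposite to `perm Δ i i`.
The sign `orient Δ` tells whether the vertex ordering of `Δ` induces the orientation
of `M`; the gluing of two simplices is compatible with the orientations if and only if
`orient_nbr` holds. -/
structure Triangulation where
  Simplex : Type
  [fintype : Fintype Simplex]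
  nbr : Simplex → Fin 4 → Simplex
  perm : Simplex → Fin 4 → Perm (Fin 4)
  orient : Simplex → ℤˣ
  nbr_nbr : ∀ Δ i, nbr (nbr Δ i) (perm Δ i i) = Δ
  perm_nbr : ∀ Δ i, perm (nbr Δ i) (perm Δ i i) = (perm Δ i)⁻¹
  ne_self : ∀ Δ i, ¬(nbr Δ i = Δ ∧ perm Δ i i = i)
  orient_nbr : ∀ Δ i, orient (nbr Δ i) = -(Perm.sign (perm Δ i) * orient Δ)

attribute [instance] Triangulation.fintype

namespace Triangulation

variable (T : Triangulation)

/-- The triangulation obtained by reordering each simplex, so that the new `i`-th vertex of `Δ` is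
the old `ρ Δ i`-th vertex. -/
def reorder (ρ : T.Simplex → Perm (Fin 4)) : Triangulation where
  Simplex := T.Simplex
  nbr Δ i := T.nbr Δ (ρ Δ i)
  perm Δ i := (ρ (T.nbr Δ (ρ Δ i)))⁻¹ * T.perm Δ (ρ Δ i) * ρ Δ
  orient Δ := Perm.sign (ρ Δ) * T.orient Δ
  nbr_nbr Δ i := by simp [T.nbr_nbr]
  perm_nbr Δ i := by simp [T.nbr_nbr, T.perm_nbr, mul_assoc]
  ne_self Δ i := by
    rintro ⟨h1, h2⟩
    refine T.ne_self Δ (ρ Δ i) ⟨h1, ?_⟩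
    simp only [h1, Perm.mul_apply] at h2
    exact (Perm.inv_eq_iff_eq.1 h2)
  orient_nbr Δ i := by
    simp only [T.orient_nbr, Perm.sign_mul, Perm.sign_inv]
    rcases Int.units_eq_one_or (Perm.sign (ρ Δ)) with h | h <;> simp [h, mul_assoc]

/-- Identification of the non-vertex integral points on glued faces. -/
def Glued (n : ℕ) (x y : T.Simplex × IntPt n) : Prop :=
  ∃ i, x.2.1 i = 0 ∧ y = (T.nbr x.1 i, x.2.act (T.perm x.1 i))

/-- Ptolemy assignments on `T`. -/
def ptolemySet (n : ℕ) : Set (T.Simplex → PtolemyFun n) :=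
  {c | (∀ Δ, c Δ ∈ PtolemyShape.ptolemySet n) ∧
    ∀ Δ i (t : IntPt n), t.1 i = 0 → (c (T.nbr Δ i)).pullback (T.perm Δ i) t = c Δ t}

open Classical in
/-- Shape assignments on `T`: shape assignments on each simplex satisfying the generalized
gluing equation at each non-vertex integral point of `T`. -/
def shapeSet (n : ℕ) : Set (T.Simplex → ShapeFun n) :=
  {z | (∀ Δ, IsShapeAssignment (z Δ)) ∧ ∀ p : T.Simplex × IntPt n,
    ∏ x ∈ Finset.univ.filter (fun x => Relation.EqvGen (T.Glued n) p x),
      shapeProd (z x.1) x.2.1 ^ ((T.orient x.1 : ℤˣ) : ℤ) = 1}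

/-- A flag is a simplex with an ordering `v₀v₁v₂v₃` of its vertices, i.e. a vertex of a doubly
truncated simplex. `turn` goes along the short edge from `v₀v₁v₂` to `v₀v₁v₃`, and then through the
face `v₀v₁v₃` into the next simplex around the edge `v₀v₁`. -/
def turn (f : T.Simplex × Perm (Fin 4)) : T.Simplex × Perm (Fin 4) :=
  (T.nbr f.1 (f.2 2), T.perm f.1 (f.2 2) * (f.2 * sS))

/-- The flags met when going once around an edge of `T`. -/
noncomputable def cycle (f : T.Simplex × Perm (Fin 4)) : List (T.Simplex × Perm (Fin 4)) :=
  (List.range (Function.minimalPeriod T.turn f)).map fun j => T.turn^[j] f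

/-- Decorations of `T`: decorations of the simplices such that for each face pairing the
decorations of the two faces differ by left multiplication by a unique element `x Δ i`
of `G`, and such that these elements define a representation of the fundamental group, i.e.
their product is `1` around each edge of `T`. -/
def IsDecoration {G : Type} [Group G] {H : Subgroup G} (D : T.Simplex → Decoration H) : Prop :=
  ∃ (g : T.Simplex → Fin 4 → G ⧸ H) (x : T.Simplex → Fin 4 → G),
    (∀ Δ, decMk (g Δ) = D Δ) ∧
    (∀ Δ i, (∀ v, v ≠ i → x Δ i • g Δ v = g (T.nbr Δ i) (T.perm Δ i v)) ∧
      ∀ y : G, (∀ v, v ≠ i → y • g Δ v = g (T.nbr Δ i) (T.perm Δ i v)) → y = x Δ i) ∧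
    ∀ f, (((T.cycle f).map fun f' => x f'.1 (f'.2 2)).reverse).prod = 1

def genericSL (n : ℕ) : Set (T.Simplex → Decoration (N n)) :=
  {D | T.IsDecoration D ∧ ∀ Δ, D Δ ∈ PtolemyShape.genericSL n}

def genericPGL (n : ℕ) : Set (T.Simplex → Decoration (B n)) :=
  {D | T.IsDecoration D ∧ ∀ Δ, D Δ ∈ PtolemyShape.genericPGL n}

/-- Cocycles on the decomposition of `M` into doubly truncated simplices and prisms: cocycles on the
doubly truncated simplices, which agree on the long and middle edges that are identified by
the face pairings, and such that the product of the labels of the short edges is `1` around each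
polygonal face of a prism. -/
def IsCocycle {G : Type} [Group G] (σ : T.Simplex → Cocycle G) : Prop :=
  (∀ Δ π, (σ Δ).α π = (σ (T.nbr Δ (π 3))).α (T.perm Δ (π 3) * π) ∧
    (σ Δ).β π = (σ (T.nbr Δ (π 3))).β (T.perm Δ (π 3) * π)) ∧
  ∀ f, ((T.cycle f).map fun f' => (σ f'.1).γ f'.2).prod = 1

def naturalSL (n : ℕ) : Set (T.Simplex → Cocycle (SLn n)) :=
  {σ | T.IsCocycle σ ∧ ∀ Δ, σ Δ ∈ PtolemyShape.naturalSL n}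

def naturalPGL (n : ℕ) : Set (T.Simplex → Cocycle (PGLn n)) :=
  {σ | T.IsCocycle σ ∧ ∀ Δ, σ Δ ∈ PtolemyShape.naturalPGL n}

end Triangulation

end PtolemyShape

open PtolemyShape

/-!
Everything rests on determinants of columns. For matrices `g₀, …, g₃` the Ptolemy coordinate `c_t` is
the determinant of the first `t_i` columns of the `g_i`, and the Ptolemy relations are three-term
Plücker relations (`cdet_ptolemy`).

*The upper row.* Over the edge `01` of a face `012` there are `n` linear functionals: the `r`-th one
vanishes on the first `r` columns of `g₀` and the first `n - 1 - r` columns of `g₁`, and is `1` on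
the next column of `g₀`. They are the rows of `edgeMat g`, which is the inverse of the natural
cochain at the corresponding vertex of the truncated simplex. Hence the labels of the natural
cocycle are changes of basis between such rows of functionals. Along a long edge both bases consist
of the same functionals in opposite order, up to scalars (`edgeMat_eq_long`). Along a middle edge one
passes from the edge `01` to the edge `02` by moving a snake across the face, one small triangle at
a time. The functionals at the corners of a small triangle satisfy a three-term relation whose
coefficient is a diamond coordinate `d_{k,i}` (`flagFun_sub`), so each triangle contributes one
factor `x_i(d_{k,i})` (`edgeMat_eq_middle`). So the cocycle is an explicit function of the Ptolemy
coordinates. Since a natural cocycle determines its decoration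
(`IsNaturality.toDec_natCocycle`), `𝒞` is injective. It is surjective because the columns of the
matrices can be chosen one at a time with prescribed determinants on the edge `01` and on the
faces `012`, `013`, by solving triangular systems (`exists_flag`), and because the Ptolemy relations
determine a non-vanishing assignment from its values on these two faces (`ptolemy_ext`).

*The lower row.* A generic decoration by flags lifts to one by affine flags, as every class in
`PGL(n, ℂ)` has a representative of determinant `1`. Its natural cochain is the natural cochain of
the lift followed by the diagonal matrix of the diamond coordinates `d_{1,i}`, which normalizes the
first column of the third flag (`isStdTriple_of_edgeMat`). Conjugating the labels of the upper
row by these matrices gives the formulas of the lower row: the factors `x_i(d_{k,i})` become `x_i(1)`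
and leave ratios of neighbouring diamond coordinates behind (`prod_xMat_factor`), which are the
`X`-coordinates (`xCoord_mu`). Hence `𝒵` is injective. It is surjective because `𝒞` and `μ` are:
a Ptolemy assignment with given shapes is built in layers `t₂ + t₃ = const`, and the equations at
interior points are exactly what makes the shapes come out right away from the faces (`exists_mu_eq`).

*Symmetries.* Natural cochains are unique, hence equivariant under reordering. For Ptolemy
coordinates reordering is a permutation of columns, whose sign is counted by inversions between
blocks (`det_shuffle`). For `μ` it suffices to treat adjacent transpositions (`mu_pullback`).

*Triangulations.* A natural cochain at a flag depends only on the three vertices of one face. A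
gluing element of two faces therefore relates the natural cochains of the two simplices, and
conversely it can be read off from them when the labels on the face agree. So decorations of the
simplices fit together exactly when their natural cocycles do (`isDecoration_iff_isCocycle`).
For affine flags the labels on a face are functions of the Ptolemy coordinates on it, and short edges
have trivial labels. For flags, the gluing equations split by the number of zero coordinates:
at an interior point they concern one simplex; at a point of a face they say that the two
`X`-coordinates, hence the middle edges, agree; at the points of an edge they say that the product of
the short edges around it is trivial (`gluing_iff`, `isDecoration_iff_gluing`). In the last
case each simplex contributes as often as it is met going around the edge, which requires that no
edge is met again in the opposite direction (`halfTurn_ne_iterate`).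
-/

namespace PtolemyShape

/-! ### Determinants of lists of vectors -/

/-- The determinant of the first `n` vectors of a list, missing ones being replaced by `0`. -/
noncomputable def ldet {n : ℕ} (L : List (Fin n → ℂ)) : ℂ :=
  Matrix.detRowAlternating fun j : Fin n => L.getD j 0

theorem getD_middle {n : ℕ} (A B : List (Fin n → ℂ)) (h : A.length < n) (v : Fin n → ℂ) :
    (fun j : Fin n => (A ++ v :: B).getD j 0) =
      Function.update (fun j : Fin n => (A ++ 0 :: B).getD j 0) ⟨A.length, h⟩ v := by
  funext j
  by_cases hj : j = ⟨A.length, h⟩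
  · subst hj
    simp
  · rw [Function.update_of_ne hj]
    have hj' : (j : ℕ) ≠ A.length := fun h' => hj (Fin.ext h')
    simp only [List.getD_eq_getElem?_getD]
    rcases lt_or_gt_of_ne hj' with h1 | h1
    · rw [List.getElem?_append_left h1, List.getElem?_append_left h1]
    · rw [List.getElem?_append_right h1.le, List.getElem?_append_right h1.le]
      obtain ⟨k, hk⟩ : ∃ k, (j : ℕ) - A.length = k + 1 := ⟨(j : ℕ) - A.length - 1, by omega⟩
      rw [hk]
      simp

/-- `ldet` as a linear function of one of the vectors. -/
noncomputable def slot {n : ℕ} (A B : List (Fin n → ℂ)) (h : A.length < n) :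
    (Fin n → ℂ) →ₗ[ℂ] ℂ :=
  (Matrix.detRowAlternating (R := ℂ) (n := Fin n)).toMultilinearMap.toLinearMap
    (fun j : Fin n => (A ++ 0 :: B).getD j 0) ⟨A.length, h⟩

theorem ldet_slot {n : ℕ} (A B : List (Fin n → ℂ)) (h : A.length < n) (v : Fin n → ℂ) :
    ldet (A ++ v :: B) = slot A B h v := by
  rw [ldet, getD_middle A B h v]
  rfl

theorem ldet_eq_zero {n : ℕ} (L : List (Fin n → ℂ)) (hl : L.length ≤ n) (h : ¬ L.Nodup) :
    ldet L = 0 := by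
  rw [List.nodup_iff_injective_get, Function.Injective] at h
  push Not at h
  obtain ⟨i, j, hij, hne⟩ := h
  refine Matrix.detRowAlternating.map_eq_zero_of_eq (i := ⟨i, by omega⟩) (j := ⟨j, by omega⟩)
    _ ?_ ?_
  · simpa using hij
  · intro h'
    apply hne
    ext
    simpa using h'

theorem ldet_swap {n : ℕ} (A C : List (Fin n → ℂ)) (u v : Fin n → ℂ) (h : A.length + 1 < n) :
    ldet (A ++ u :: v :: C) = -ldet (A ++ v :: u :: C) := by
  have hne : (⟨A.length, by omega⟩ : Fin n) ≠ ⟨A.length + 1, h⟩ := by simp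
  have hs := (Matrix.detRowAlternating (R := ℂ) (n := Fin n)).map_swap
    (fun j : Fin n => (A ++ v :: u :: C).getD j 0) hne
  rw [ldet, ldet, ← hs]
  congr 1
  funext j
  simp only [Function.comp]
  by_cases h1 : j = ⟨A.length, by omega⟩
  · subst h1
    rw [Equiv.swap_apply_left]
    simp
  by_cases h2 : j = ⟨A.length + 1, h⟩
  · subst h2
    rw [Equiv.swap_apply_right]
    simp
  rw [Equiv.swap_apply_of_ne_of_ne h1 h2]
  have h1' : (j : ℕ) ≠ A.length := fun h' => h1 (Fin.ext h')
  have h2' : (j : ℕ) ≠ A.length + 1 := fun h' => h2 (Fin.ext h')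
  simp only [List.getD_eq_getElem?_getD]
  rcases lt_or_gt_of_ne h1' with h3 | h3
  · rw [List.getElem?_append_left h3, List.getElem?_append_left h3]
  · rw [List.getElem?_append_right h3.le, List.getElem?_append_right h3.le]
    obtain ⟨k, hk⟩ : ∃ k, (j : ℕ) - A.length = k + 2 := ⟨(j : ℕ) - A.length - 2, by omega⟩
    rw [hk]
    simp

theorem ldet_move {n : ℕ} (A B C : List (Fin n → ℂ)) (v : Fin n → ℂ)
    (h : A.length + B.length < n) :
    ldet (A ++ (B ++ v :: C)) = (-1) ^ B.length * ldet (A ++ v :: (B ++ C)) := by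
  induction B generalizing A with
  | nil => simp
  | cons b B ih =>
    have h1 := ih (A ++ [b]) (by simp at h ⊢; omega)
    simp only [List.append_assoc, List.cons_append, List.nil_append] at h1 ⊢
    rw [h1, ldet_swap A (B ++ C) b v (by simp at h; omega), List.length_cons, pow_succ]
    ring

/-- Two vectors inserted into a list are moved to its front. -/
theorem ldet_move_two {n : ℕ} (A B C : List (Fin n → ℂ)) (x y : Fin n → ℂ)
    (h : A.length + B.length + 1 < n) :
    ldet (A ++ x :: (B ++ y :: C)) = (-1) ^ B.length * ldet (x :: y :: (A ++ (B ++ C))) := by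
  have h1 := ldet_move (A ++ [x]) B C y (by simp; omega)
  have h2 := ldet_move [] A (y :: (B ++ C)) x (by simp; omega)
  have h3 := ldet_move [x] A (B ++ C) y (by simp; omega)
  simp only [List.append_assoc, List.cons_append, List.nil_append] at h1 h2 h3
  rw [h1, h2, h3]
  have : ((-1 : ℂ) ^ A.length) * (-1) ^ A.length = 1 := by
    rw [← mul_pow]; simp
  linear_combination ((-1) ^ B.length * ldet (x :: y :: (A ++ (B ++ C)))) * this

theorem ldet_cramer {n : ℕ} (L : List (Fin n → ℂ)) (z : Fin n → ℂ) :
    ldet L • z = ∑ j : Fin n,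
      Matrix.detRowAlternating (Function.update (fun j : Fin n => L.getD j 0) j z) •
        L.getD j 0 := by
  have h := Matrix.mulVec_cramer (Matrix.of fun r j : Fin n => L.getD j 0 r) z
  have hd : (Matrix.of fun r j : Fin n => L.getD j 0 r).det = ldet L := by
    rw [← Matrix.det_transpose]; rfl
  rw [hd] at h
  rw [← h]
  funext r
  simp only [Matrix.mulVec, dotProduct, Finset.sum_apply, Pi.smul_apply, smul_eq_mul,
    Matrix.of_apply]
  refine Finset.sum_congr rfl fun j _ => ?_
  rw [mul_comm]
  congr 1
  rw [Matrix.cramer_apply, ← Matrix.det_transpose, ← Matrix.updateRow_transpose]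
  rfl

/-- The three-term Plücker relation, obtained by expanding `z` by Cramer's rule in the basis
`x, y, K` and pairing with `w, K`. -/
theorem ldet_plucker {n : ℕ} (K : List (Fin n → ℂ)) (hK : K.length + 2 = n)
    (x y z w : Fin n → ℂ) :
    ldet (x :: y :: K) * ldet (z :: w :: K) - ldet (x :: z :: K) * ldet (y :: w :: K) +
      ldet (x :: w :: K) * ldet (y :: z :: K) = 0 := by
  obtain ⟨m, rfl⟩ : ∃ m, n = m + 2 := ⟨K.length, hK.symm⟩
  have hK' : K.length = m := by omega
  have hc := ldet_cramer (x :: y :: K) z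
  have hφ := fun v => ldet_slot [] (w :: K) (by simp) v
  simp only [List.nil_append] at hφ
  have h2 := congrArg (slot [] (w :: K) (by simp)) hc
  rw [map_sum] at h2
  simp only [map_smul, smul_eq_mul] at h2
  simp only [← hφ] at h2
  rw [Fin.sum_univ_succ, Fin.sum_univ_succ, Finset.sum_eq_zero] at h2
  · have e0 : (Function.update (fun j : Fin (m + 2) => (x :: y :: K).getD j 0) 0 z) =
        fun j : Fin (m + 2) => (z :: y :: K).getD j 0 := by
      funext j
      refine Fin.cases ?_ (fun j => ?_) j
      · simp
      · rw [Function.update_of_ne (Fin.succ_ne_zero j)]; simp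
    have e1 : (Function.update (fun j : Fin (m + 2) => (x :: y :: K).getD j 0) (Fin.succ 0) z) =
        fun j : Fin (m + 2) => (x :: z :: K).getD j 0 := by
      funext j
      refine Fin.cases ?_ (fun j => ?_) j
      · rw [Function.update_of_ne (Fin.succ_ne_zero 0).symm]; simp
      · refine Fin.cases ?_ (fun j => ?_) j
        · simp
        · rw [Function.update_of_ne (by simp [Fin.ext_iff])]
          simp
    have e2 := ldet_swap [] K z y (by simp)
    have e3 : ldet (y :: z :: K) = - ldet (z :: y :: K) := ldet_swap [] K y z (by simp)
    rw [e0, e1] at h2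
    change _ = ldet (z :: y :: K) * ldet (x :: w :: K) +
      (ldet (x :: z :: K) * ldet (y :: w :: K) + 0) at h2
    rw [e3]
    linear_combination h2
  · intro j _
    refine mul_eq_zero_of_right _ (ldet_eq_zero _ (by simp [hK']) ?_)
    simp [List.nodup_cons, hK']

theorem ldet_map {n : ℕ} (M : Matrix (Fin n) (Fin n) ℂ) (L : List (Fin n → ℂ)) :
    ldet (L.map M.mulVec) = M.det * ldet L := by
  have h : (Matrix.of fun j r : Fin n => (L.map M.mulVec).getD j 0 r) =
      (Matrix.of fun j r : Fin n => L.getD j 0 r) * Mᵀ := by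
    ext j r
    have : (L.map M.mulVec).getD j 0 = M.mulVec (L.getD j 0) := by
      conv_lhs => rw [← Matrix.mulVec_zero M]
      rw [List.getD_map]
    rw [Matrix.of_apply, this, Matrix.mul_apply]
    simp [Matrix.mulVec, dotProduct, mul_comm]
  have h2 := congrArg Matrix.det h
  rw [Matrix.det_mul, Matrix.det_transpose, mul_comm] at h2
  exact h2

/-! ### Columns of flags -/

/-- The `j`-th column of a matrix, counted from `0`; it is `0` if there is no such column. -/
def colv {n : ℕ} (g : Matrix (Fin n) (Fin n) ℂ) (j : ℕ) : Fin n → ℂ := fun r =>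
  if h : j < n then g r ⟨j, h⟩ else 0

/-- The list of the first `k` columns of a matrix. -/
def cols {n : ℕ} (g : Matrix (Fin n) (Fin n) ℂ) (k : ℕ) : List (Fin n → ℂ) :=
  (List.range k).map (colv g)

@[simp] theorem length_cols {n : ℕ} (g : Matrix (Fin n) (Fin n) ℂ) (k : ℕ) :
    (cols g k).length = k := by simp [cols]

@[simp] theorem cols_zero {n : ℕ} (g : Matrix (Fin n) (Fin n) ℂ) : cols g 0 = [] := rfl

theorem cols_succ {n : ℕ} (g : Matrix (Fin n) (Fin n) ℂ) (k : ℕ) :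
    cols g (k + 1) = cols g k ++ [colv g k] := by simp [cols, List.range_succ]

theorem colv_mem_cols {n : ℕ} (g : Matrix (Fin n) (Fin n) ℂ) {j k : ℕ} (h : j < k) :
    colv g j ∈ cols g k := List.mem_map.2 ⟨j, List.mem_range.2 h, rfl⟩

theorem colv_mul {n : ℕ} (x g : Matrix (Fin n) (Fin n) ℂ) (j : ℕ) :
    colv (x * g) j = x.mulVec (colv g j) := by
  funext r
  by_cases h : j < n
  · simp [colv, h, Matrix.mul_apply, Matrix.mulVec, dotProduct]
  · simp [colv, h, Matrix.mulVec, dotProduct]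

theorem cols_mul {n : ℕ} (x g : Matrix (Fin n) (Fin n) ℂ) (k : ℕ) :
    cols (x * g) k = (cols g k).map x.mulVec := by
  simp [cols, colv_mul, Function.comp_def]

theorem getD_cols {n : ℕ} (g : Matrix (Fin n) (Fin n) ℂ) {j k : ℕ} (h : j < k) :
    (cols g k).getD j 0 = colv g j := by
  simp [cols, List.getD_eq_getElem?_getD, h]

/-- The columns of the four flags, `t i` from the `i`-th one. -/
def colList {n : ℕ} (g : Fin 4 → Matrix (Fin n) (Fin n) ℂ) (t : Fin 4 → ℕ) :
    List (Fin n → ℂ) :=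
  cols (g 0) (t 0) ++ (cols (g 1) (t 1) ++ (cols (g 2) (t 2) ++ cols (g 3) (t 3)))

theorem start_zero (t : Fin 4 → ℕ) : start t 0 = 0 := by
  simp [start]

theorem start_one (t : Fin 4 → ℕ) : start t 1 = t 0 := by
  have : (Finset.univ.filter (· < (1 : Fin 4))) = {0} := by decide
  rw [start, this, Finset.sum_singleton]

theorem start_two (t : Fin 4 → ℕ) : start t 2 = t 0 + t 1 := by
  have : (Finset.univ.filter (· < (2 : Fin 4))) = {0, 1} := by decide
  rw [start, this, Finset.sum_pair (by decide)]

theorem start_three (t : Fin 4 → ℕ) : start t 3 = t 0 + t 1 + t 2 := by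
  have : (Finset.univ.filter (· < (3 : Fin 4))) = {0, 1, 2} := by decide
  rw [start, this, Finset.sum_insert (by decide), Finset.sum_pair (by decide), add_assoc]

theorem det_concat {n : ℕ} (g : Fin 4 → Matrix (Fin n) (Fin n) ℂ) (t : Fin 4 → ℕ)
    (ht : ∑ i, t i = n) : (concat g t).det = ldet (colList g t) := by
  rw [← Matrix.det_transpose]
  change Matrix.detRowAlternating _ = _
  rw [ldet]
  congr 1
  funext j
  have hj := j.2
  rw [Fin.sum_univ_four] at ht
  simp only [colList, List.getD_eq_getElem?_getD]
  have hcol : ∀ b : Fin 4, ∀ k : ℕ, k < t b → k < n →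
      (cols (g b) (t b))[k]?.getD 0 = fun r => if h : k < n then g b r ⟨k, h⟩ else 0 := by
    intro b k hk _
    rw [← List.getD_eq_getElem?_getD, getD_cols _ hk]
    rfl
  by_cases h0 : (j : ℕ) < t 0
  · rw [List.getElem?_append_left (by simpa using h0), hcol 0 _ h0 hj]
    funext r
    simp [concat, blk, h0, start_zero]
  rw [List.getElem?_append_right (by simpa using h0), length_cols]
  by_cases h1 : (j : ℕ) < t 0 + t 1
  · rw [List.getElem?_append_left (by simp; omega), hcol 1 _ (by omega) (by omega)]
    funext r
    simp [concat, blk, h0, h1, start_one, show (j : ℕ) - t 0 < n by omega]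
  rw [List.getElem?_append_right (by simp; omega), length_cols]
  by_cases h2 : (j : ℕ) < t 0 + t 1 + t 2
  · rw [List.getElem?_append_left (by simp; omega), hcol 2 _ (by omega) (by omega)]
    funext r
    simp [concat, blk, h0, h1, h2, start_two, Nat.sub_sub,
      show (j : ℕ) - (t 0 + t 1) < n by omega]
  rw [List.getElem?_append_right (by simp; omega), length_cols, hcol 3 _ (by omega) (by omega)]
  funext r
  have h3 : blk t j = 3 := by simp [blk, h0, h1, h2]
  have h4 : (j : ℕ) - (t 0 + t 1 + t 2) < n := by omega
  simp [concat, h3, start_three, Nat.sub_sub, h4]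

/-- The diagonal entries of a matrix, counted from `0`. -/
def dg {n : ℕ} (b : Matrix (Fin n) (Fin n) ℂ) (j : ℕ) : ℂ :=
  if h : j < n then b ⟨j, h⟩ ⟨j, h⟩ else 1

/-- Right multiplication by an upper triangular matrix multiplies determinants involving the first
`k` columns by the product of the first `k` diagonal entries. -/
theorem ldet_cols_mul_upper {n : ℕ} (g b : Matrix (Fin n) (Fin n) ℂ) (hb : b.BlockTriangular id)
    (A C : List (Fin n → ℂ)) (k : ℕ) (h : A.length + k + C.length ≤ n) :
    ldet (A ++ (cols (g * b) k ++ C)) =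
      (∏ j ∈ Finset.range k, dg b j) * ldet (A ++ (cols g k ++ C)) := by
  induction k generalizing C with
  | zero => simp
  | succ k ih =>
    have hk : k < n := by omega
    have hA : (A ++ cols g k).length < n := by simp; omega
    have hcol : colv (g * b) k = ∑ j : Fin n, b j ⟨k, hk⟩ • colv g j := by
      funext r
      simp [colv, hk, Matrix.mul_apply, mul_comm]
    have hs : slot (A ++ cols g k) C hA (colv (g * b) k) =
        dg b k * slot (A ++ cols g k) C hA (colv g k) := by
      rw [hcol, map_sum]
      simp only [map_smul, smul_eq_mul]
      rw [Finset.sum_eq_single ⟨k, hk⟩, dg, dif_pos hk]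
      · intro j _ hj
        rcases lt_or_gt_of_ne hj with h2 | h2
        · rw [← ldet_slot, ldet_eq_zero, mul_zero]
          · simp; omega
          · intro hn
            exact List.disjoint_of_nodup_append hn
              (List.mem_append_right _ (colv_mem_cols g h2)) (List.mem_cons_self ..)
        · rw [hb h2, zero_mul]
      · simp
    have h1 := ih (colv (g * b) k :: C) (by simp; omega)
    rw [← List.append_assoc A (cols g k), ldet_slot _ _ hA, hs, ← ldet_slot] at h1
    simp only [cols_succ, Finset.prod_range_succ, List.append_assoc, List.cons_append,
      List.nil_append] at h1 ⊢
    rw [h1, mul_assoc]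

/-! ### Ptolemy coordinates of a tuple of matrices -/

/-- The Ptolemy coordinate of a tuple of matrices at an arbitrary point, as the determinant of a
list of columns. -/
noncomputable def cdet {n : ℕ} (g : Fin 4 → Matrix (Fin n) (Fin n) ℂ) (t : Fin 4 → ℕ) : ℂ :=
  ldet (colList g t)

theorem ldet_cols_self {n : ℕ} (g : Matrix (Fin n) (Fin n) ℂ) : ldet (cols g n) = g.det := by
  rw [← Matrix.det_transpose]
  change Matrix.detRowAlternating _ = Matrix.detRowAlternating _
  congr 1
  funext j
  rw [getD_cols g j.2]
  funext r
  simp [colv]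

theorem eq_single_of_sum {n : ℕ} {t : Fin 4 → ℕ} (ht : ∑ i, t i = n) {i : Fin 4} (hi : t i = n)
    {j : Fin 4} (hj : j ≠ i) : t j = 0 := by
  rw [Fin.sum_univ_four] at ht
  fin_cases i <;> fin_cases j <;> simp at hi hj ⊢ <;> omega

theorem cdet_vertex {n : ℕ} (g : Fin 4 → Matrix (Fin n) (Fin n) ℂ) {t : Fin 4 → ℕ}
    (ht : ∑ i, t i = n) {i : Fin 4} (hi : t i = n) : cdet g t = (g i).det := by
  have h := fun j hj => eq_single_of_sum ht hi (j := j) hj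
  rw [cdet, colList, ← ldet_cols_self]
  fin_cases i
  · simp [h 1 (by simp), h 2 (by simp), h 3 (by simp), show t 0 = n from hi]
  · simp [h 0 (by simp), h 2 (by simp), h 3 (by simp), show t 1 = n from hi]
  · simp [h 0 (by simp), h 1 (by simp), h 3 (by simp), show t 2 = n from hi]
  · simp [h 0 (by simp), h 1 (by simp), h 2 (by simp), show t 3 = n from hi]

theorem val_detCoords {n : ℕ} (g : Fin 4 → Matrix (Fin n) (Fin n) ℂ) {t : Fin 4 → ℕ}
    (ht : ∑ i, t i = n) (h : ∀ i, t i ≠ n) : (detCoords g).val t = cdet g t := by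
  rw [PtolemyFun.val, dif_pos ⟨ht, h⟩]
  exact det_concat g t ht

theorem val_detCoords_of_det {n : ℕ} (g : Fin 4 → Matrix (Fin n) (Fin n) ℂ)
    (hg : ∀ i, (g i).det = 1) {t : Fin 4 → ℕ} (ht : ∑ i, t i = n) :
    (detCoords g).val t = cdet g t := by
  by_cases h : ∀ i, t i ≠ n
  · exact val_detCoords g ht h
  · rw [PtolemyFun.val, dif_neg (fun h' => h h'.2)]
    push Not at h
    obtain ⟨i, hi⟩ := h
    rw [cdet_vertex g ht hi, hg]

theorem isGenericTuple_iff {n : ℕ} (g : Fin 4 → Matrix (Fin n) (Fin n) ℂ) :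
    IsGenericTuple g ↔ ∀ t : Fin 4 → ℕ, ∑ i, t i = n → cdet g t ≠ 0 := by
  refine forall₂_congr fun t ht => ?_
  rw [det_concat g t ht, cdet]

/-- The Ptolemy relation: the Plücker relation for the next column of each matrix, after these
columns have been moved to the front. -/
theorem cdet_ptolemy {n : ℕ} (g : Fin 4 → Matrix (Fin n) (Fin n) ℂ) (s : Fin 4 → ℕ)
    (hs : ∑ i, s i + 2 = n) :
    cdet g (s + ![1, 0, 0, 1]) * cdet g (s + ![0, 1, 1, 0]) +
      cdet g (s + ![1, 1, 0, 0]) * cdet g (s + ![0, 0, 1, 1]) =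
    cdet g (s + ![1, 0, 1, 0]) * cdet g (s + ![0, 1, 0, 1]) := by
  rw [Fin.sum_univ_four] at hs
  have hP := ldet_plucker (colList g s) (by simp [colList]; omega)
    (colv (g 0) (s 0)) (colv (g 1) (s 1)) (colv (g 2) (s 2)) (colv (g 3) (s 3))
  have e01 := ldet_move_two (cols (g 0) (s 0)) (cols (g 1) (s 1))
    (cols (g 2) (s 2) ++ cols (g 3) (s 3)) (colv (g 0) (s 0)) (colv (g 1) (s 1))
    (by simp; omega)
  have e02 := ldet_move_two (cols (g 0) (s 0)) (cols (g 1) (s 1) ++ cols (g 2) (s 2))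
    (cols (g 3) (s 3)) (colv (g 0) (s 0)) (colv (g 2) (s 2)) (by simp; omega)
  have e03 := ldet_move_two (cols (g 0) (s 0)) (cols (g 1) (s 1) ++ (cols (g 2) (s 2) ++
    cols (g 3) (s 3))) [] (colv (g 0) (s 0)) (colv (g 3) (s 3)) (by simp; omega)
  have e12 := ldet_move_two (cols (g 0) (s 0) ++ cols (g 1) (s 1)) (cols (g 2) (s 2))
    (cols (g 3) (s 3)) (colv (g 1) (s 1)) (colv (g 2) (s 2)) (by simp; omega)
  have e13 := ldet_move_two (cols (g 0) (s 0) ++ cols (g 1) (s 1)) (cols (g 2) (s 2) ++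
    cols (g 3) (s 3)) [] (colv (g 1) (s 1)) (colv (g 3) (s 3)) (by simp; omega)
  have e23 := ldet_move_two (cols (g 0) (s 0) ++ (cols (g 1) (s 1) ++ cols (g 2) (s 2)))
    (cols (g 3) (s 3)) [] (colv (g 2) (s 2)) (colv (g 3) (s 3)) (by simp; omega)
  simp only [List.append_assoc, List.append_nil, List.length_append, length_cols, pow_add]
    at e01 e02 e03 e12 e13 e23
  simp only [colList] at hP
  simp only [cdet, colList, Pi.add_apply, Matrix.cons_val, cols_succ,
    add_zero, List.append_assoc, List.cons_append, List.nil_append, e01, e02, e03, e12, e13, e23]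
  have h2 : ((-1 : ℂ) ^ s 2) * (-1) ^ s 2 = 1 := by rw [← mul_pow]; simp
  linear_combination ((-1) ^ s 1 * (-1) ^ s 3 : ℂ) * hP + ((-1) ^ s 1 * (-1) ^ s 3 : ℂ) *
    (ldet (colv (g 0) (s 0) :: colv (g 3) (s 3) :: (cols (g 0) (s 0) ++ (cols (g 1) (s 1) ++
      (cols (g 2) (s 2) ++ cols (g 3) (s 3))))) *
    ldet (colv (g 1) (s 1) :: colv (g 2) (s 2) :: (cols (g 0) (s 0) ++ (cols (g 1) (s 1) ++
      (cols (g 2) (s 2) ++ cols (g 3) (s 3))))) -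
    ldet (colv (g 0) (s 0) :: colv (g 2) (s 2) :: (cols (g 0) (s 0) ++ (cols (g 1) (s 1) ++
      (cols (g 2) (s 2) ++ cols (g 3) (s 3))))) *
    ldet (colv (g 1) (s 1) :: colv (g 3) (s 3) :: (cols (g 0) (s 0) ++ (cols (g 1) (s 1) ++
      (cols (g 2) (s 2) ++ cols (g 3) (s 3)))))) * h2

/-! ### Reordering blocks of columns -/

theorem blk_spec (t : Fin 4 → ℕ) (j : ℕ) (hj : j < ∑ i, t i) :
    start t (blk t j) ≤ j ∧ j < start t (blk t j) + t (blk t j) := by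
  rw [Fin.sum_univ_four] at hj
  unfold blk
  split_ifs
  · rw [start_zero]; omega
  · rw [start_one]; omega
  · rw [start_two]; omega
  · rw [start_three]; omega

theorem blk_eq (t : Fin 4 → ℕ) (j : ℕ) (b : Fin 4) (h1 : start t b ≤ j)
    (h2 : j < start t b + t b) : blk t j = b := by
  fin_cases b
  · simp only [Fin.zero_eta, start_zero] at h1 h2
    unfold blk; split_ifs <;> first | rfl | omega
  · simp only [Fin.mk_one, start_one] at h1 h2
    unfold blk; split_ifs <;> first | rfl | omega
  · simp only [Fin.reduceFinMk, start_two] at h1 h2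
    unfold blk; split_ifs <;> first | rfl | omega
  · simp only [Fin.reduceFinMk, start_three] at h1 h2
    unfold blk; split_ifs <;> first | rfl | omega

theorem start_add_le (t : Fin 4 → ℕ) {b b' : Fin 4} (h : b < b') :
    start t b + t b ≤ start t b' := by
  fin_cases b <;> fin_cases b' <;>
    simp [start_zero, start_one, start_two, start_three] at h ⊢ <;> omega

theorem start_add_le_sum (t : Fin 4 → ℕ) (b : Fin 4) : start t b + t b ≤ ∑ i, t i := by
  rw [Fin.sum_univ_four]
  fin_cases b <;> simp [start_zero, start_one, start_two, start_three] <;> omega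

theorem lt_of_blk_lt {t : Fin 4 → ℕ} {i j : ℕ} (hi : i < ∑ i, t i) (hj : j < ∑ i, t i)
    (h : blk t i < blk t j) : i < j := by
  have := blk_spec t i hi
  have := blk_spec t j hj
  have := start_add_le t h
  omega

theorem card_blk {n : ℕ} (t : Fin 4 → ℕ) (ht : ∑ i, t i = n) (b : Fin 4) :
    (Finset.univ.filter fun j : Fin n => blk t j = b).card = t b := by
  have h : (Finset.univ.filter fun j : Fin n => blk t j = b).map Fin.valEmbedding =
      Finset.Ico (start t b) (start t b + t b) := by
    ext k
    simp only [Finset.mem_map, Finset.mem_filter, Finset.mem_univ, true_and,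
      Fin.valEmbedding_apply, Finset.mem_Ico]
    constructor
    · rintro ⟨j, rfl, rfl⟩
      exact blk_spec t j (ht ▸ j.2)
    · rintro ⟨h1, h2⟩
      exact ⟨⟨k, by have := start_add_le_sum t b; omega⟩, blk_eq t k b h1 h2, rfl⟩
  have := congrArg Finset.card h
  simpa using this

/-- The position, after sorting the blocks, of the column `j` of a concatenation whose `b`-th block
is the block number `σ b`. -/
def sortIdx (σ : Perm (Fin 4)) (t : Fin 4 → ℕ) (j : ℕ) : ℕ :=
  start t (σ (blk (t ∘ σ) j)) + (j - start (t ∘ σ) (blk (t ∘ σ) j))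

theorem sum_comp_perm (σ : Perm (Fin 4)) (t : Fin 4 → ℕ) : ∑ i, (t ∘ σ) i = ∑ i, t i :=
  Equiv.sum_comp σ t

theorem sortIdx_spec (σ : Perm (Fin 4)) (t : Fin 4 → ℕ) (j : ℕ) (hj : j < ∑ i, t i) :
    start t (σ (blk (t ∘ σ) j)) ≤ sortIdx σ t j ∧
      sortIdx σ t j < start t (σ (blk (t ∘ σ) j)) + t (σ (blk (t ∘ σ) j)) := by
  have := blk_spec (t ∘ σ) j (by rwa [sum_comp_perm])
  simp only [sortIdx, Function.comp_apply] at this ⊢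
  omega

theorem blk_sortIdx (σ : Perm (Fin 4)) (t : Fin 4 → ℕ) (j : ℕ) (hj : j < ∑ i, t i) :
    blk t (sortIdx σ t j) = σ (blk (t ∘ σ) j) :=
  blk_eq _ _ _ (sortIdx_spec σ t j hj).1 (sortIdx_spec σ t j hj).2

theorem sortIdx_lt (σ : Perm (Fin 4)) (t : Fin 4 → ℕ) (j : ℕ) (hj : j < ∑ i, t i) :
    sortIdx σ t j < ∑ i, t i :=
  (sortIdx_spec σ t j hj).2.trans_le (start_add_le_sum _ _)

/-- Sorting the blocks reverses two columns exactly if their blocks are inverted by `σ`. -/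
theorem sortIdx_lt_iff (σ : Perm (Fin 4)) (t : Fin 4 → ℕ) (i j : ℕ) (hij : i < j)
    (hj : j < ∑ i, t i) : sortIdx σ t i < sortIdx σ t j ↔
      ¬(blk (t ∘ σ) i < blk (t ∘ σ) j ∧ σ (blk (t ∘ σ) j) < σ (blk (t ∘ σ) i)) := by
  have hi := hij.trans hj
  have h1 := sortIdx_spec σ t i hi
  have h2 := sortIdx_spec σ t j hj
  have h3 := blk_spec (t ∘ σ) i (by rwa [sum_comp_perm])
  have h4 := blk_spec (t ∘ σ) j (by rwa [sum_comp_perm])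
  have hle : blk (t ∘ σ) i ≤ blk (t ∘ σ) j := by
    by_contra h
    exact absurd (lt_of_blk_lt (by rwa [sum_comp_perm]) (by rwa [sum_comp_perm]) (not_le.1 h))
      (not_lt.2 hij.le)
  rcases hle.lt_or_eq with h | h
  · rcases lt_or_gt_of_ne (fun h' => h.ne (σ.injective h') :
      σ (blk (t ∘ σ) i) ≠ σ (blk (t ∘ σ) j)) with h' | h'
    · have := start_add_le t h'
      simp only [h, h'.not_gt, and_false, not_false_eq_true, iff_true]
      omega
    · have := start_add_le t h'
      simp only [h, h', and_self, not_true_eq_false, iff_false]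
      omega
  · simp only [sortIdx, h, lt_irrefl, and_self, not_false_eq_true, iff_true]
    rw [h] at h3
    omega

/-- The sign `-1` of an inverted pair of blocks. -/
def pairSign (σ : Perm (Fin 4)) (i j : Fin 4) : ℂ := if σ j < σ i then -1 else 1

/-- The sign of the reordering by `σ` of blocks of columns, where the `i`-th new block has `t i`
columns: each inverted pair of blocks contributes the product of their sizes to the
number of inversions. -/
def blockSign (σ : Perm (Fin 4)) (t : Fin 4 → ℕ) : ℂ :=
  pairSign σ 0 1 ^ (t 0 * t 1) * pairSign σ 0 2 ^ (t 0 * t 2) * pairSign σ 0 3 ^ (t 0 * t 3) *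
    pairSign σ 1 2 ^ (t 1 * t 2) * pairSign σ 1 3 ^ (t 1 * t 3) * pairSign σ 2 3 ^ (t 2 * t 3)

theorem pairSign_sq (σ : Perm (Fin 4)) (i j : Fin 4) : pairSign σ i j * pairSign σ i j = 1 := by
  unfold pairSign; split_ifs <;> simp

theorem pairSign_ne_zero (σ : Perm (Fin 4)) (i j : Fin 4) : pairSign σ i j ≠ 0 := by
  unfold pairSign; split_ifs <;> simp

theorem prod_blk {n : ℕ} (t : Fin 4 → ℕ) (ht : ∑ i, t i = n) (f : Fin 4 → ℂ) :
    ∏ j : Fin n, f (blk t j) = ∏ b, f b ^ t b := by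
  rw [← Finset.prod_fiberwise_of_maps_to (s := (Finset.univ : Finset (Fin n)))
    (t := (Finset.univ : Finset (Fin 4))) (g := fun j => blk t j) (fun _ _ => Finset.mem_univ _)]
  refine Finset.prod_congr rfl fun b _ => ?_
  rw [Finset.prod_congr rfl (g := fun _ => f b), Finset.prod_const, card_blk t ht]
  intro j hj
  rw [(Finset.mem_filter.1 hj).2]

/-- The sign of a shuffle of blocks, counted by inversions: two columns are inverted if and only if
their blocks are. -/
theorem det_shuffle {n : ℕ} (σ : Perm (Fin 4)) (t : Fin 4 → ℕ) (ht : ∑ i, t i = n) :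
    (shuffle n σ t).det = blockSign σ (t ∘ σ) := by
  have hlt : ∀ j : Fin n, (j : ℕ) < ∑ i, t i := fun j => j.2.trans_eq ht.symm
  let e₀ : Fin n → Fin n := fun j => ⟨sortIdx σ t j, (sortIdx_lt σ t j (hlt j)).trans_eq ht⟩
  have hinj : Function.Injective e₀ := by
    intro i j hij
    by_contra hne
    have hij' : sortIdx σ t i = sortIdx σ t j := congrArg Fin.val hij
    have hb := congrArg (blk t) hij'
    rw [blk_sortIdx σ t i (hlt i), blk_sortIdx σ t j (hlt j)] at hb
    have hb := σ.injective hb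
    rcases lt_or_gt_of_ne hne with h | h
    · have := (sortIdx_lt_iff σ t i j h (hlt j)).2 (by simp [hb])
      omega
    · have := (sortIdx_lt_iff σ t j i h (hlt i)).2 (by simp [hb])
      omega
  let e : Perm (Fin n) := Equiv.ofBijective e₀ (Finite.injective_iff_bijective.1 hinj)
  have he : ∀ j, ((e j : Fin n) : ℕ) = sortIdx σ t j := fun j => rfl
  have hM : shuffle n σ t = (e.permMatrix ℂ)ᵀ := by
    ext r j
    simp [shuffle, PEquiv.toMatrix_apply, Fin.ext_iff, he, sortIdx, eq_comm]
  rw [hM, Matrix.det_transpose, Matrix.det_permutation, Equiv.Perm.sign_eq_prod_prod_Iio]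
  push_cast
  have hstep : ∀ j : Fin n, (∏ i ∈ Finset.Iio j, (((if e i < e j then 1 else -1 : ℤˣ) : ℤ) : ℂ))
      = ∏ b, (if b < blk (t ∘ σ) j ∧ σ (blk (t ∘ σ) j) < σ b then (-1 : ℂ) else 1) ^ (t ∘ σ) b := by
    intro j
    rw [← prod_blk (t ∘ σ) ((sum_comp_perm σ t).trans ht)
      (fun b => if b < blk (t ∘ σ) j ∧ σ (blk (t ∘ σ) j) < σ b then (-1 : ℂ) else 1)]
    refine Finset.prod_subset_one_on_sdiff (Finset.subset_univ _) (fun i hi => ?_)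
      (fun i hi => ?_)
    · rw [if_neg]
      rintro ⟨h, -⟩
      have := lt_of_blk_lt (by rw [sum_comp_perm, ht]; exact i.2)
        (by rw [sum_comp_perm, ht]; exact j.2) h
      simp at hi
      omega
    · have h := sortIdx_lt_iff σ t i j (by simpa using hi) (hlt j)
      rw [← he, ← he, Fin.val_fin_lt] at h
      by_cases h' : e i < e j
      · rw [if_pos h', if_neg (h.1 h')]; simp
      · rw [if_neg h', if_pos (not_not.1 (fun h'' => h' (h.2 h'')))]; simp
  let f : Fin 4 → Fin 4 → ℂ := fun b b' => if b < b' ∧ σ b' < σ b then -1 else 1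
  have h := prod_blk (t ∘ σ) ((sum_comp_perm σ t).trans ht)
    (fun b' => ∏ b, f b b' ^ (t ∘ σ) b)
  rw [Finset.prod_congr rfl fun j _ => hstep j]
  refine h.trans ?_
  have h1 : ∀ b b', b < b' → f b b' = pairSign σ b b' := fun b b' hb => by
    simp [f, pairSign, hb]
  have h2 : ∀ b b', ¬ b < b' → f b b' = 1 := fun b b' hb => by
    simp only [f, hb, false_and, if_false]
  simp only [Fin.prod_univ_four, h2 0 0 (by decide), h2 1 0 (by decide), h2 2 0 (by decide),
    h2 3 0 (by decide), h2 1 1 (by decide), h2 2 1 (by decide), h2 3 1 (by decide),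
    h2 2 2 (by decide), h2 3 2 (by decide), h2 3 3 (by decide), h1 0 1 (by decide),
    h1 0 2 (by decide), h1 0 3 (by decide), h1 1 2 (by decide), h1 1 3 (by decide),
    h1 2 3 (by decide), blockSign, one_pow, mul_one, one_mul, mul_pow, ← pow_mul]
  ring

theorem permPt_comp (σ : Perm (Fin 4)) (t : Fin 4 → ℕ) : permPt σ t ∘ σ = t := by
  funext i; simp [permPt]

theorem sum_permPt (σ : Perm (Fin 4)) (t : Fin 4 → ℕ) : ∑ i, permPt σ t i = ∑ i, t i :=
  Equiv.sum_comp σ.symm t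

theorem concat_comp {n : ℕ} (g : Fin 4 → Matrix (Fin n) (Fin n) ℂ) (σ : Perm (Fin 4))
    (t : Fin 4 → ℕ) (ht : ∑ i, t i = n) :
    concat (fun i => g (σ i)) (t ∘ σ) = concat g t * shuffle n σ t := by
  ext r j
  have hj : (j : ℕ) < ∑ i, t i := j.2.trans_eq ht.symm
  have hlt : sortIdx σ t j < n := (sortIdx_lt σ t j hj).trans_eq ht
  rw [Matrix.mul_apply, Finset.sum_eq_single ⟨sortIdx σ t j, hlt⟩]
  · have hb := blk_sortIdx σ t j hj
    have h1 : sortIdx σ t j - start t (σ (blk (t ∘ σ) j)) =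
        j - start (t ∘ σ) (blk (t ∘ σ) j) := by simp [sortIdx]
    simp only [concat, shuffle, Matrix.of_apply, hb, h1]
    simp [sortIdx]
  · intro k _ hk
    have : (k : ℕ) ≠ sortIdx σ t j := fun h => hk (Fin.ext h)
    simp only [sortIdx] at this
    simp [shuffle, this]
  · simp

/-- At a vertex both sides are `1`: only one block is non-empty, so no columns are interchanged. -/
theorem val_pullback {n : ℕ} (σ : Perm (Fin 4)) (c : PtolemyFun n) {t : Fin 4 → ℕ}
    (ht : ∑ i, t i = n) : (c.pullback σ).val t = blockSign σ t * c.val (permPt σ t) := by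
  by_cases h : ∀ i, t i ≠ n
  · have h' : ∀ i, permPt σ t i ≠ n := fun i => h _
    rw [PtolemyFun.val, dif_pos ⟨ht, h⟩, PtolemyFun.val, dif_pos ⟨(sum_permPt σ t).trans ht, h'⟩]
    change (shuffle n σ (permPt σ t)).det * _ = _
    rw [det_shuffle σ _ ((sum_permPt σ t).trans ht), permPt_comp]
    rfl
  · have h' : ¬ ∀ i, permPt σ t i ≠ n := fun h' => h fun i => by simpa [permPt] using h' (σ i)
    rw [PtolemyFun.val, dif_neg (fun h'' => h h''.2), PtolemyFun.val,
      dif_neg (fun h'' => h' h''.2)]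
    push Not at h
    obtain ⟨i, hi⟩ := h
    have hz := fun j hj => eq_single_of_sum ht hi (j := j) hj
    have : ∀ b b', b < b' → t b * t b' = 0 := by
      intro b b' hb
      rcases eq_or_ne b i with rfl | hne
      · rw [hz b' hb.ne', mul_zero]
      · rw [hz b hne, zero_mul]
    simp [blockSign, this]

theorem detCoords_comp {n : ℕ} (g : Fin 4 → Matrix (Fin n) (Fin n) ℂ) (σ : Perm (Fin 4)) :
    detCoords (fun i => g (σ i)) = (detCoords g).pullback σ := by
  funext t
  have h := concat_comp g σ (permPt σ t.1) ((sum_permPt σ t.1).trans t.2.1)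
  rw [permPt_comp] at h
  change (concat _ t.1).det = _
  rw [h, Matrix.det_mul, mul_comm]
  rfl

theorem blockSign_ne_zero (σ : Perm (Fin 4)) (t : Fin 4 → ℕ) : blockSign σ t ≠ 0 := by
  simp [blockSign, pairSign_ne_zero]

theorem IsGenericTuple.comp {n : ℕ} {g : Fin 4 → Matrix (Fin n) (Fin n) ℂ} (hg : IsGenericTuple g)
    (σ : Perm (Fin 4)) : IsGenericTuple fun i => g (σ i) := by
  intro t ht
  have h := concat_comp g σ (permPt σ t) ((sum_permPt σ t).trans ht)
  rw [permPt_comp] at h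
  rw [h, Matrix.det_mul, det_shuffle σ _ ((sum_permPt σ t).trans ht)]
  exact mul_ne_zero (hg _ ((sum_permPt σ t).trans ht)) (blockSign_ne_zero _ _)

/-! ### Points on a face -/

theorem comb_add (v₀ v₁ v₂ : Fin 4) (a b c a' b' c' : ℕ) :
    comb v₀ v₁ v₂ a b c + comb v₀ v₁ v₂ a' b' c' = comb v₀ v₁ v₂ (a + a') (b + b') (c + c') := by
  simp only [comb, Pi.single_add]; abel

theorem sum_comb (v₀ v₁ v₂ : Fin 4) (a b c : ℕ) : ∑ i, comb v₀ v₁ v₂ a b c i = a + b + c := by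
  simp [comb, Finset.sum_add_distrib, Finset.sum_pi_single']

theorem comb_std (a b c : ℕ) : comb 0 1 2 a b c = ![a, b, c, 0] := by
  funext i; fin_cases i <;> simp [comb]

theorem permPt_single (σ : Perm (Fin 4)) (v : Fin 4) (a : ℕ) :
    permPt σ (Pi.single v a) = Pi.single (σ v) a := by
  funext i
  simp [permPt, Pi.single_apply, Equiv.symm_apply_eq]

theorem permPt_add (σ : Perm (Fin 4)) (s t : Fin 4 → ℕ) :
    permPt σ (s + t) = permPt σ s + permPt σ t := rfl

theorem permPt_comb (σ : Perm (Fin 4)) (v₀ v₁ v₂ : Fin 4) (a b c : ℕ) :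
    permPt σ (comb v₀ v₁ v₂ a b c) = comb (σ v₀) (σ v₁) (σ v₂) a b c := by
  simp only [comb, permPt_add, permPt_single]

/-- The determinant of `a`, `b` and `c` columns of the first three matrices. -/
noncomputable def faceDet {n : ℕ} (g : Fin 4 → Matrix (Fin n) (Fin n) ℂ) (a b c : ℕ) : ℂ :=
  ldet (cols (g 0) a ++ (cols (g 1) b ++ cols (g 2) c))

theorem cdet_comb {n : ℕ} (g : Fin 4 → Matrix (Fin n) (Fin n) ℂ) (a b c : ℕ) :
    cdet g (comb 0 1 2 a b c) = faceDet g a b c := by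
  simp [cdet, colList, faceDet, comb_std]

theorem val_comb {n : ℕ} {g : Fin 4 → Matrix (Fin n) (Fin n) ℂ} (hg : ∀ i, (g i).det = 1)
    {a b c : ℕ} (h : a + b + c = n) : (detCoords g).val (comb 0 1 2 a b c) = faceDet g a b c := by
  rw [val_detCoords_of_det g hg ((sum_comb ..).trans h), cdet_comb]

theorem IsGenericTuple.faceDet_ne_zero {n : ℕ} {g : Fin 4 → Matrix (Fin n) (Fin n) ℂ}
    (hg : IsGenericTuple g) {a b c : ℕ} (h : a + b + c = n) : faceDet g a b c ≠ 0 := by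
  rw [← cdet_comb]
  exact (isGenericTuple_iff g).1 hg _ ((sum_comb ..).trans h)

/-! ### Functionals vanishing on parts of three flags -/

/-- The value at `v` of the functional which vanishes on the first `a`, `b`, `c` columns of
the three matrices and takes the value `1` at the next column of the first one. -/
noncomputable def flagFun {n : ℕ} (g : Fin 4 → Matrix (Fin n) (Fin n) ℂ) (a b c : ℕ)
    (v : Fin n → ℂ) : ℂ :=
  ldet (cols (g 0) a ++ v :: (cols (g 1) b ++ cols (g 2) c)) / faceDet g (a + 1) b c

theorem flagFun_sum {n : ℕ} (g : Fin 4 → Matrix (Fin n) (Fin n) ℂ) (a b c : ℕ) (ha : a < n)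
    (v : Fin n → ℂ) : flagFun g a b c v = ∑ j, flagFun g a b c (Pi.single j 1) * v j := by
  have hv : v = ∑ j, v j • (Pi.single j 1 : Fin n → ℂ) := by
    funext r; simp [Finset.sum_apply, Pi.single_apply]
  simp only [flagFun, ldet_slot _ _ (show (cols (g 0) a).length < n by simpa)]
  conv_lhs => rw [hv, map_sum]
  rw [Finset.sum_div]
  refine Finset.sum_congr rfl fun j _ => ?_
  rw [map_smul, smul_eq_mul]
  ring

/-- The functionals of the three corners of a small triangle satisfy a three-term relation, with
a diamond coordinate as coefficient. -/
theorem flagFun_sub {n : ℕ} {g : Fin 4 → Matrix (Fin n) (Fin n) ℂ} (hg : IsGenericTuple g)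
    {a b c : ℕ} (h : a + b + c + 2 = n) (v : Fin n → ℂ) :
    flagFun g a (b + 1) c v = flagFun g a b (c + 1) v +
      -((faceDet g (a + 2) b c * faceDet g a (b + 1) (c + 1)) /
        (faceDet g (a + 1) (b + 1) c * faceDet g (a + 1) b (c + 1))) *
        flagFun g (a + 1) b c v := by
  have h1 := hg.faceDet_ne_zero (a := a + 1) (b := b + 1) (c := c) (by omega)
  have h2 := hg.faceDet_ne_zero (a := a + 1) (b := b) (c := c + 1) (by omega)
  have h3 := hg.faceDet_ne_zero (a := a + 2) (b := b) (c := c) (by omega)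
  have key : ldet (cols (g 0) a ++ v :: (cols (g 1) (b + 1) ++ cols (g 2) c)) *
      faceDet g (a + 1) b (c + 1) -
      ldet (cols (g 0) a ++ v :: (cols (g 1) b ++ cols (g 2) (c + 1))) *
      faceDet g (a + 1) (b + 1) c =
      - ldet (cols (g 0) (a + 1) ++ v :: (cols (g 1) b ++ cols (g 2) c)) *
      faceDet g a (b + 1) (c + 1) := by
    set A := cols (g 0) a with hA
    set B := cols (g 1) b with hB
    set C := cols (g 2) c with hC
    set x := colv (g 0) a with hx
    set y := colv (g 1) b with hy
    set z := colv (g 2) c with hz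
    have lA : A.length = a := by simp [A]
    have lB : B.length = b := by simp [B]
    have lC : C.length = c := by simp [C]
    have hP := ldet_plucker (A ++ (B ++ C)) (by simp; omega) x v y z
    have m1 := ldet_move_two A B C v y (by omega)
    have m2 := ldet_move_two A B C x y (by omega)
    have m3 := ldet_move_two A (B ++ C) [] v z (by simp; omega)
    have m4 := ldet_move_two A (B ++ C) [] x z (by simp; omega)
    have m5 := ldet_move_two A [] (B ++ C) x v (by simp; omega)
    have m6 := ldet_move_two (A ++ B) C [] y z (by simp; omega)
    simp only [List.append_assoc, List.append_nil, List.length_append, List.length_nil, pow_add,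
      pow_zero, one_mul, List.nil_append] at m1 m2 m3 m4 m5 m6
    simp only [faceDet, cols_succ, List.append_assoc, List.cons_append, List.nil_append,
      ← hA, ← hB, ← hC, ← hx, ← hy, ← hz, m1, m2, m3, m4, m5, m6]
    have hB2 : ((-1 : ℂ) ^ B.length) * (-1) ^ B.length = 1 := by rw [← mul_pow]; simp
    linear_combination ((-1) ^ C.length : ℂ) * hP + (-1) ^ C.length *
      (ldet (v :: y :: (A ++ (B ++ C))) * ldet (x :: z :: (A ++ (B ++ C))) -
       ldet (v :: z :: (A ++ (B ++ C))) * ldet (x :: y :: (A ++ (B ++ C)))) * hB2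
  simp only [flagFun]
  rw [show a + 1 + 1 = a + 2 from rfl]
  field_simp
  linear_combination key

theorem flagFun_col_lt {n : ℕ} (g : Fin 4 → Matrix (Fin n) (Fin n) ℂ) {a b c j : ℕ}
    (h : a + b + c + 1 = n) (hj : j < a) : flagFun g a b c (colv (g 0) j) = 0 := by
  rw [flagFun, ldet_eq_zero, zero_div]
  · simp; omega
  · intro hn
    exact List.disjoint_of_nodup_append hn (colv_mem_cols _ hj) (List.mem_cons_self ..)

theorem flagFun_col_self {n : ℕ} {g : Fin 4 → Matrix (Fin n) (Fin n) ℂ} (hg : IsGenericTuple g)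
    {a b c : ℕ} (h : a + b + c + 1 = n) : flagFun g a b c (colv (g 0) a) = 1 := by
  have h1 := hg.faceDet_ne_zero (a := a + 1) (b := b) (c := c) (by omega)
  rw [flagFun, div_eq_one_iff_eq h1, faceDet, cols_succ]
  simp

theorem flagFun_col_one {n : ℕ} (g : Fin 4 → Matrix (Fin n) (Fin n) ℂ) {a b c j : ℕ}
    (h : a + b + c + 1 = n) (hj : j < b) : flagFun g a b c (colv (g 1) j) = 0 := by
  rw [flagFun, ldet_eq_zero, zero_div]
  · simp; omega
  · intro hn
    have := (List.nodup_append.1 hn).2.1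
    exact (List.nodup_cons.1 this).1 (List.mem_append_left _ (colv_mem_cols _ hj))

/-- The matrix whose rows are the functionals along the path of a snake which follows the edge
from the first towards the second vertex after it has been moved `k` steps towards the
third vertex. -/
noncomputable def snakeMat {n : ℕ} (g : Fin 4 → Matrix (Fin n) (Fin n) ℂ) (k : ℕ) :
    Matrix (Fin n) (Fin n) ℂ :=
  Matrix.of fun r j => flagFun g r (n - 1 - r - min k (n - 1 - r)) (min k (n - 1 - r))
    (Pi.single j 1)

theorem prod_chain {M : Type*} [Monoid M] (X S : ℕ → M) (m : ℕ)
    (h : ∀ i, 1 ≤ i → i ≤ m → X i * S i = S (i - 1)) :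
    ((List.range' 1 m).map X).prod * S m = S 0 := by
  induction m with
  | zero => simp
  | succ m ih =>
    rw [List.range'_concat, List.map_append, List.prod_append, mul_assoc]
    simp only [List.map_cons, List.map_nil, List.prod_singleton, one_mul]
    rw [add_comm 1 m, h (m + 1) (by omega) le_rfl]
    exact ih fun i h1 h2 => h i h1 (by omega)

theorem xMat_mul {n i : ℕ} (t : ℂ) (hin : i < n) (S : Matrix (Fin n) (Fin n) ℂ)
    (r j : Fin n) :
    (xMat n i t * S) r j = S r j + if (r : ℕ) + 1 = i then t * S ⟨i, hin⟩ j else 0 := by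
  rw [xMat, Matrix.add_mul, Matrix.one_mul, Matrix.add_apply, Matrix.mul_apply]
  congr 1
  rw [Finset.sum_eq_single ⟨i, hin⟩]
  · simp
  · intro s _ hs
    have : (s : ℕ) ≠ i := fun h => hs (Fin.ext h)
    simp [this]
  · simp

theorem diamondAt_std {n : ℕ} {g : Fin 4 → Matrix (Fin n) (Fin n) ℂ} (hd : ∀ i, (g i).det = 1)
    {a b c : ℕ} (h : a + b + c + 2 = n) : diamondAt (detCoords g) 1 (c + 1) (a + 1) =
      -((faceDet g (a + 2) b c * faceDet g a (b + 1) (c + 1)) /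
        (faceDet g (a + 1) (b + 1) c * faceDet g (a + 1) b (c + 1))) := by
  have hb : n - (a + 1) - (c + 1) = b := by omega
  simp only [diamondAt, diamond, Perm.coe_one, id, hb, Nat.add_sub_cancel, comb_add]
  rw [val_comb hd (by omega), val_comb hd (by omega), val_comb hd (by omega),
    val_comb hd (by omega)]
  have : orderSign 0 1 2 = 1 := by simp [orderSign]
  simp [this]

/-- Moving the snake across one row of small triangles. The triangles of the row are crossed one
after another, each changing one row of the matrix by the three-term relation. -/
theorem snakeMat_step {n : ℕ} {g : Fin 4 → Matrix (Fin n) (Fin n) ℂ} (hg : IsGenericTuple g)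
    (hd : ∀ i, (g i).det = 1) {k : ℕ} (hk : 1 ≤ k) (hkn : k ≤ n - 1) :
    ((List.range' 1 (n - k)).map fun i => xMat n i (diamondAt (detCoords g) 1 k i)).prod *
      snakeMat g k = snakeMat g (k - 1) := by
  obtain ⟨c, rfl⟩ : ∃ c, k = c + 1 := ⟨k - 1, by omega⟩
  rw [Nat.add_sub_cancel]
  -- the snake after the first `i` triangles of the row have been crossed
  let S : ℕ → Matrix (Fin n) (Fin n) ℂ := fun i =>
    Matrix.of fun r j => if (r : ℕ) < i then snakeMat g (c + 1) r j else snakeMat g c r j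
  have h0 : S 0 = snakeMat g c := by ext; simp [S]
  have hm : S (n - (c + 1)) = snakeMat g (c + 1) := by
    ext r j
    simp only [S, Matrix.of_apply]
    split_ifs with hr
    · rfl
    · have : min c (n - 1 - (r : ℕ)) = min (c + 1) (n - 1 - r) := by omega
      simp only [snakeMat, Matrix.of_apply, this]
  rw [← hm, ← h0]
  refine prod_chain _ S _ fun i h1 h2 => ?_
  obtain ⟨a, rfl⟩ : ∃ a, i = a + 1 := ⟨i - 1, by omega⟩
  obtain ⟨b, hb⟩ : ∃ b, a + b + c + 2 = n := ⟨n - 2 - a - c, by omega⟩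
  rw [Nat.add_sub_cancel, diamondAt_std hd hb]
  ext r j
  rw [xMat_mul _ (by omega)]
  by_cases hr : (r : ℕ) = a
  · have e1 : min (c + 1) (n - 1 - a) = c + 1 := by omega
    have e2 : min c (n - 1 - a) = c := by omega
    have e3 : min c (n - 1 - (a + 1)) = c := by omega
    have e4 : n - 1 - a - (c + 1) = b := by omega
    have e5 : n - 1 - a - c = b + 1 := by omega
    have e6 : n - 1 - (a + 1) - c = b := by omega
    simp only [S, Matrix.of_apply, hr, snakeMat, lt_irrefl, if_false, if_true,
      Nat.lt_succ_self, e1, e2, e3, e4, e5, e6]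
    exact (flagFun_sub hg hb _).symm
  · have h3 : (r : ℕ) < a + 1 ↔ (r : ℕ) < a := by omega
    simp [S, hr, h3]

/-- The matrix whose rows are the functionals along the edge from the first to the second
vertex. It maps the pair of the first two flags to the standard pair. -/
noncomputable def edgeMat {n : ℕ} (g : Fin 4 → Matrix (Fin n) (Fin n) ℂ) :
    Matrix (Fin n) (Fin n) ℂ :=
  Matrix.of fun r j => flagFun g r (n - 1 - r) 0 (Pi.single j 1)

theorem edgeMat_mul {n : ℕ} (g : Fin 4 → Matrix (Fin n) (Fin n) ℂ)
    (M : Matrix (Fin n) (Fin n) ℂ) (r j : Fin n) : (edgeMat g * M) r j =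
      flagFun g r (n - 1 - r) 0 (colv M j) := by
  rw [flagFun_sum _ _ _ _ r.2, Matrix.mul_apply]
  simp [edgeMat, colv]

/-- The change of basis along a middle edge: `n - 1` rows of triangles are crossed between the edge
to the second vertex and the edge to the third one. -/
theorem edgeMat_eq_middle {n : ℕ} {g : Fin 4 → Matrix (Fin n) (Fin n) ℂ} (hg : IsGenericTuple g)
    (hd : ∀ i, (g i).det = 1) :
    edgeMat g = middleMat (detCoords g) 1 * edgeMat fun i => g (sM i) := by
  have h0 : snakeMat g 0 = edgeMat g := by
    ext r j; simp [snakeMat, edgeMat]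
  have h1 : snakeMat g (n - 1) = edgeMat fun i => g (sM i) := by
    ext r j
    have s0 : sM 0 = 0 := by decide
    have s1 : sM 1 = 2 := by decide
    simp [snakeMat, edgeMat, flagFun, faceDet, s0, s1]
  rw [← h0, ← h1, middleMat]
  exact (prod_chain _ (snakeMat g) (n - 1) fun k hk hkn => snakeMat_step hg hd hk hkn).symm

theorem ldet_swap_blocks {n : ℕ} (A B C : List (Fin n → ℂ)) (h : A.length + B.length ≤ n) :
    ldet (A ++ (B ++ C)) = (-1) ^ (A.length * B.length) * ldet (B ++ (A ++ C)) := by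
  induction B generalizing A with
  | nil => simp
  | cons b B ih =>
    simp only [List.length_cons, List.cons_append] at h ⊢
    have h1 := ldet_move [] A (B ++ C) b (by simp; omega)
    have h2 := ih (b :: A) (by simp; omega)
    have h3 := ldet_move [] B (A ++ C) b (by simp; omega)
    simp only [List.nil_append, List.cons_append] at h1 h2 h3
    rw [h1, h2, h3, List.length_cons, add_mul, one_mul, mul_add, mul_one, pow_add, pow_add]
    have : ((-1 : ℂ) ^ B.length) * (-1) ^ B.length = 1 := by rw [← mul_pow]; simp
    linear_combination ((-1) ^ A.length * (-1) ^ (A.length * B.length) *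
      ldet (b :: (B ++ (A ++ C)))) * this

/-- The change of basis along a long edge: the functionals at the two ends vanish on the same columns,
in opposite order, and differ by their normalization. -/
theorem edgeMat_eq_long {n : ℕ} {g : Fin 4 → Matrix (Fin n) (Fin n) ℂ} (hg : IsGenericTuple g)
    (hd : ∀ i, (g i).det = 1) :
    edgeMat g = longMat (detCoords g) 1 * edgeMat fun i => g (sL i) := by
  ext r j
  rw [Matrix.mul_apply, Finset.sum_eq_single r.rev]
  · obtain ⟨b, hb⟩ : ∃ b, (r : ℕ) + b + 1 = n := ⟨n - 1 - r, by omega⟩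
    have e1 : (r.rev : ℕ) = b := by simp [Fin.rev]; omega
    have e2 : n - 1 - (r : ℕ) = b := by omega
    have e3 : n - 1 - b = r := by omega
    have s0 : sL 0 = 1 := by decide
    have s1 : sL 1 = 0 := by decide
    have n1 := hg.faceDet_ne_zero (a := r) (b := b + 1) (c := 0) (by omega)
    have n2 := hg.faceDet_ne_zero (a := r + 1) (b := b) (c := 0) (by omega)
    simp only [longMat, edgeMat, Matrix.of_apply, Fin.rev_rev, if_true, Perm.coe_one, id, e1, e2,
      e3, flagFun, s0, s1]
    rw [val_comb hd (by omega), val_comb hd (by omega)]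
    have f1 : faceDet (fun i => g (sL i)) (b + 1) r 0 =
        (-1) ^ ((r : ℕ) * (b + 1)) * faceDet g r (b + 1) 0 := by
      have := ldet_swap_blocks (cols (g 1) (b + 1)) (cols (g 0) r) [] (by simp; omega)
      simp only [List.append_nil, length_cols] at this
      simp only [faceDet, s0, s1, cols_zero, List.append_nil]
      rw [this, mul_comm (b + 1)]
    have f2 : ldet (cols (g 1) b ++ Pi.single j 1 :: cols (g 0) r) =
        (-1) ^ ((r : ℕ) * (b + 1) + b) *
          ldet (cols (g 0) r ++ Pi.single j 1 :: cols (g 1) b) := by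
      have h1 := ldet_swap_blocks (cols (g 1) b ++ [Pi.single j 1]) (cols (g 0) r) []
        (by simp; omega)
      have h2 := ldet_move (cols (g 0) r) (cols (g 1) b) [] (Pi.single j 1) (by simp; omega)
      simp only [List.append_nil, length_cols, List.length_append, List.length_singleton,
        List.append_assoc, List.cons_append, List.nil_append] at h1 h2
      rw [h1, h2, mul_comm (b + 1), pow_add, mul_assoc]
    rw [f1]
    simp only [cols_zero, List.append_nil, f2]
    rw [pow_add]
    have hs : ((-1 : ℂ) ^ b) * (-1) ^ b = 1 := by rw [← mul_pow]; simp
    have hs2 : ((-1 : ℂ) ^ ((r : ℕ) * (b + 1))) ≠ 0 := by simp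
    field_simp
    rw [sq, hs, mul_one]
  · intro l _ hl
    have : r ≠ l.rev := fun h => hl (by rw [h, Fin.rev_rev])
    simp [longMat, this]
  · simp

/-! ### The formulas for a general ordering of the vertices -/

theorem blockSign_comb (π : Perm (Fin 4)) (a b c : ℕ) : blockSign π (comb 0 1 2 a b c) =
    pairSign π 0 1 ^ (a * b) * pairSign π 0 2 ^ (a * c) * pairSign π 1 2 ^ (b * c) := by
  simp [blockSign, comb_std]

theorem val_pullback_comb {n : ℕ} (π : Perm (Fin 4)) (c : PtolemyFun n) {i j k : ℕ}
    (h : i + j + k = n) : (c.pullback π).val (comb 0 1 2 i j k) =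
      (pairSign π 0 1 ^ (i * j) * pairSign π 0 2 ^ (i * k) * pairSign π 1 2 ^ (j * k)) *
        c.val (comb (π 0) (π 1) (π 2) i j k) := by
  rw [val_pullback π c ((sum_comb ..).trans h), blockSign_comb, permPt_comb]

/-- The block signs of the four Ptolemy coordinates in a diamond combine to the sign of the ordering of
the three vertices of the face, which is the sign in the definition of the diamond coordinates. -/
theorem diamondAt_pullback {n : ℕ} (π : Perm (Fin 4)) (c : PtolemyFun n) {k i : ℕ} (hk : 1 ≤ k)
    (hi : 1 ≤ i) (h : i + k ≤ n) : diamondAt (c.pullback π) 1 k i = diamondAt c π k i := by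
  obtain ⟨a, rfl⟩ : ∃ a, i = a + 1 := ⟨i - 1, by omega⟩
  obtain ⟨d, rfl⟩ : ∃ d, k = d + 1 := ⟨k - 1, by omega⟩
  obtain ⟨b, hb⟩ : ∃ b, a + b + d + 2 = n := ⟨n - 2 - a - d, by omega⟩
  have e : n - (a + 1) - (d + 1) = b := by omega
  have o1 : orderSign 0 1 2 = 1 := by simp [orderSign]
  have o2 : orderSign (π 0) (π 1) (π 2) = pairSign π 0 1 * pairSign π 0 2 * pairSign π 1 2 := rfl
  simp only [diamondAt, diamond, Perm.coe_one, id, e, Nat.add_sub_cancel, comb_add, o1, o2]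
  have hsplit : ∀ s₁ s₂ s₃ s₄ x y z w : ℂ, (s₁ * x) * (s₂ * y) / ((s₃ * z) * (s₄ * w)) =
      s₁ * s₂ / (s₃ * s₄) * ((x * y) / (z * w)) := fun s₁ s₂ s₃ s₄ x y z w => by
    rw [mul_mul_mul_comm, mul_mul_mul_comm s₃, mul_div_mul_comm]
  rw [val_pullback_comb π c (by omega), val_pullback_comb π c (by omega),
    val_pullback_comb π c (by omega), val_pullback_comb π c (by omega), hsplit, ← mul_assoc]
  congr 1
  · have h01 := pairSign_sq π 0 1
    have h02 := pairSign_sq π 0 2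
    have h12 := pairSign_sq π 1 2
    have n01 := pairSign_ne_zero π 0 1
    have n02 := pairSign_ne_zero π 0 2
    have n12 := pairSign_ne_zero π 1 2
    rw [neg_mul, one_mul, neg_inj, div_eq_iff (by simp [n01, n02, n12])]
    generalize pairSign π 0 1 = x at *
    generalize pairSign π 0 2 = y at *
    generalize pairSign π 1 2 = z at *
    have e1 : x ^ ((a + 1) * (b + 1)) * x ^ ((a + 1) * (b + 0)) =
        x * (x ^ ((a + 2) * (b + 0)) * x ^ ((a + 0) * (b + 1))) := by
      ring
    have e2 : y ^ ((a + 1) * (d + 0)) * y ^ ((a + 1) * (d + 1)) =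
        y * (y ^ ((a + 2) * (d + 0)) * y ^ ((a + 0) * (d + 1))) := by
      ring
    have e3 : z ^ ((b + 0) * (d + 0)) * z ^ ((b + 1) * (d + 1)) =
        z * (z ^ ((b + 1) * (d + 0)) * z ^ ((b + 0) * (d + 1))) := by
      ring
    calc _ = (x ^ ((a + 2) * (b + 0)) * x ^ ((a + 0) * (b + 1))) *
          (y ^ ((a + 2) * (d + 0)) * y ^ ((a + 0) * (d + 1))) *
          (z ^ ((b + 0) * (d + 0)) * z ^ ((b + 1) * (d + 1))) := by ring
      _ = (x * x) * (y * y) * z * (x ^ ((a + 2) * (b + 0)) * x ^ ((a + 0) * (b + 1))) *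
          (y ^ ((a + 2) * (d + 0)) * y ^ ((a + 0) * (d + 1))) *
          (z ^ ((b + 1) * (d + 0)) * z ^ ((b + 0) * (d + 1))) := by rw [e3, h01, h02]; ring
      _ = x * y * z * (x ^ ((a + 1) * (b + 1)) * x ^ ((a + 1) * (b + 0))) *
          (y ^ ((a + 1) * (d + 0)) * y ^ ((a + 1) * (d + 1))) *
          (z ^ ((b + 1) * (d + 0)) * z ^ ((b + 0) * (d + 1))) := by rw [e1, e2]; ring
      _ = _ := by ring

theorem middleMat_pullback {n : ℕ} (π : Perm (Fin 4)) (c : PtolemyFun n) :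
    middleMat (c.pullback π) 1 = middleMat c π := by
  unfold middleMat
  congr 1
  refine List.map_congr_left fun k hk => ?_
  rw [List.mem_range'_1] at hk
  congr 1
  refine List.map_congr_left fun i hi => ?_
  rw [List.mem_range'_1] at hi
  rw [diamondAt_pullback π c (by omega) (by omega) (by omega)]

theorem longMat_pullback {n : ℕ} {π : Perm (Fin 4)} (hπ : π 0 < π 1) (c : PtolemyFun n) :
    longMat (c.pullback π) 1 = longMat c π := by
  have h1 : pairSign π 0 1 = 1 := if_neg hπ.not_gt
  ext r l
  have hl := l.2
  simp only [longMat, Matrix.of_apply, Perm.coe_one, id]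
  rw [val_pullback_comb π c (by omega), val_pullback_comb π c (by omega)]
  simp [h1]

/-! ### Natural cochains of affine flags -/

/-- `T` moves the standard pair `(N, qN)`, for a counter-diagonal `q`, to the pair `(p₀, p₁)`. -/
def IsStdPair {n : ℕ} (p₀ p₁ : SLn n ⧸ N n) (T : SLn n) : Prop :=
  p₀ = (T : SLn n ⧸ N n) ∧
    ∃ q : SLn n, IsCounterDiagonal q.1 ∧ p₁ = ((T * q : SLn n) : SLn n ⧸ N n)

theorem IsCounterDiagonal.ne_zero {n : ℕ} {q : SLn n} (hq : IsCounterDiagonal q.1) (r : Fin n) :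
    q.1 r r.rev ≠ 0 := by
  intro h
  have h1 : q.1.det = 0 := Matrix.det_eq_zero_of_row_eq_zero r fun j => by
    by_cases hj : j = r.rev
    · rw [hj, h]
    · exact hq r j hj
  simp at h1

theorem IsCounterDiagonal.mul_apply {n : ℕ} {q : Matrix (Fin n) (Fin n) ℂ}
    (hq : IsCounterDiagonal q) (M : Matrix (Fin n) (Fin n) ℂ) (r s : Fin n) :
    (q * M) r s = q r r.rev * M r.rev s := by
  rw [Matrix.mul_apply, Finset.sum_eq_single r.rev]
  · intro k _ hk
    rw [hq r k hk, zero_mul]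
  · simp

theorem IsCounterDiagonal.apply_mul {n : ℕ} {q : Matrix (Fin n) (Fin n) ℂ}
    (hq : IsCounterDiagonal q) (M : Matrix (Fin n) (Fin n) ℂ) (r s : Fin n) :
    (M * q) r s = M r s.rev * q s.rev s := by
  rw [Matrix.mul_apply, Finset.sum_eq_single s.rev]
  · intro k _ hk
    rw [hq k s (fun h => hk (by rw [h, Fin.rev_rev])), mul_zero]
  · simp

/-- The stabilizer of `(N, qN)` is trivial: conjugation by counter-diagonal matrices turns upper
into lower triangular matrices. -/
theorem IsStdPair.unique {n : ℕ} {p₀ p₁ : SLn n ⧸ N n} {T T' : SLn n} (h : IsStdPair p₀ p₁ T)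
    (h' : IsStdPair p₀ p₁ T') : T = T' := by
  obtain ⟨h0, q, hq, h1⟩ := h
  obtain ⟨h0', q', hq', h1'⟩ := h'
  have hu : T⁻¹ * T' ∈ N n := QuotientGroup.eq.1 (h0.symm.trans h0')
  have hw : (T * q)⁻¹ * (T' * q') ∈ N n := QuotientGroup.eq.1 (h1.symm.trans h1')
  set u := T⁻¹ * T' with hu'
  set w := (T * q)⁻¹ * (T' * q') with hw'
  have he : u * q' = q * w := by rw [hu', hw']; group
  have he' : u.1 * q'.1 = q.1 * w.1 := by
    rw [← Matrix.SpecialLinearGroup.coe_mul, he, Matrix.SpecialLinearGroup.coe_mul]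
  have hu1 : u = 1 := by
    ext r s
    rw [Matrix.SpecialLinearGroup.coe_one]
    rcases lt_trichotomy r s with hrs | rfl | hrs
    · have h2 := congrFun (congrFun he' r) s.rev
      have hw0 : w.1 r.rev s.rev = 0 := hw.1 (Fin.rev_lt_rev.2 hrs)
      rw [hq'.apply_mul, hq.mul_apply, hw0, mul_zero, Fin.rev_rev] at h2
      rw [Matrix.one_apply_ne hrs.ne]
      exact (mul_eq_zero.1 h2).resolve_right (hq'.ne_zero s)
    · exact (hu.2 r).trans (Matrix.one_apply_eq r).symm
    · exact (hu.1 hrs).trans (Matrix.one_apply_ne hrs.ne').symm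
  exact inv_mul_eq_one.1 hu1

theorem IsStdPair.smul {n : ℕ} {p₀ p₁ : SLn n ⧸ N n} {T : SLn n} (x : SLn n)
    (h : IsStdPair p₀ p₁ T) : IsStdPair (x • p₀) (x • p₁) (x * T) := by
  obtain ⟨h0, q, hq, h1⟩ := h
  refine ⟨by rw [h0]; rfl, q, hq, by rw [h1, mul_assoc]; rfl⟩

theorem edgeMat_mul_fst {n : ℕ} {g : Fin 4 → Matrix (Fin n) (Fin n) ℂ} (hg : IsGenericTuple g) :
    (edgeMat g * g 0).BlockTriangular id ∧ ∀ i, (edgeMat g * g 0) i i = 1 := by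
  refine ⟨fun r j hj => ?_, fun r => ?_⟩
  · rw [edgeMat_mul]
    exact flagFun_col_lt g (by omega) hj
  · rw [edgeMat_mul]
    exact flagFun_col_self hg (by omega)

theorem det_of_unipotent {n : ℕ} {M : Matrix (Fin n) (Fin n) ℂ} (h : M.BlockTriangular id)
    (h1 : ∀ i, M i i = 1) : M.det = 1 := by
  rw [Matrix.det_of_isUpperTriangular h]
  simp [h1]

theorem det_edgeMat {n : ℕ} {g : Fin 4 → Matrix (Fin n) (Fin n) ℂ} (hg : IsGenericTuple g)
    (hd : (g 0).det = 1) : (edgeMat g).det = 1 := by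
  have h := det_of_unipotent (edgeMat_mul_fst hg).1 (edgeMat_mul_fst hg).2
  rwa [Matrix.det_mul, hd, mul_one] at h

/-- Two flags in general position are in the big Bruhat cell: relative to `edgeMat g`, the second
one is a counter-diagonal matrix times a unipotent upper triangular one. -/
theorem edgeMat_mul_snd {n : ℕ} {g : Fin 4 → Matrix (Fin n) (Fin n) ℂ} (hg : IsGenericTuple g) :
    ∃ q u : Matrix (Fin n) (Fin n) ℂ, edgeMat g * g 1 = q * u ∧ IsCounterDiagonal q ∧
      u.BlockTriangular id ∧ ∀ i, u i i = 1 := by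
  set M := edgeMat g * g 1 with hM
  have h0 : ∀ r j : Fin n, j < r.rev → M r j = 0 := by
    intro r j hj
    rw [hM, edgeMat_mul]
    refine flagFun_col_one g (by omega) ?_
    have := Fin.lt_def.1 hj
    rw [Fin.val_rev] at this
    omega
  have h1 : ∀ r : Fin n, M r r.rev ≠ 0 := by
    intro r
    obtain ⟨b, hb⟩ : ∃ b, (r : ℕ) + b + 1 = n := ⟨n - 1 - r, by omega⟩
    have e1 : (r.rev : ℕ) = b := by simp [Fin.rev]; omega
    have e2 : n - 1 - (r : ℕ) = b := by omega
    have n1 := hg.faceDet_ne_zero (a := r) (b := b + 1) (c := 0) (by omega)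
    have n2 := hg.faceDet_ne_zero (a := r + 1) (b := b) (c := 0) (by omega)
    rw [hM, edgeMat_mul, flagFun, e1, e2]
    refine div_ne_zero ?_ n2
    have := ldet_move (cols (g 0) r) (cols (g 1) b) [] (colv (g 1) b) (by simp; omega)
    simp only [faceDet, cols_zero, List.append_nil, cols_succ] at n1 this ⊢
    rw [this] at n1
    exact (mul_ne_zero_iff.1 n1).2
  let q : Matrix (Fin n) (Fin n) ℂ := Matrix.of fun r j => if j = r.rev then M r j else 0
  have hq : IsCounterDiagonal q := fun r j hj => by simp [q, hj]
  refine ⟨q, Matrix.of fun s j => M s.rev j / M s.rev s, ?_, hq, ?_, ?_⟩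
  · ext r j
    rw [hq.mul_apply]
    have := h1 r
    simp only [q, Matrix.of_apply, if_true, Fin.rev_rev]
    field_simp
  · intro s j hj
    simp only [Matrix.of_apply]
    rw [h0 _ _ (by rw [Fin.rev_rev]; exact hj), zero_div]
  · intro s
    have := h1 s.rev
    rw [Fin.rev_rev] at this
    simp [this]

theorem exists_isStdPair {n : ℕ} {g : Fin 4 → SLn n} (hg : IsGenericTuple fun i => (g i).1) :
    ∃ T : SLn n, (T⁻¹).1 = edgeMat (fun i => (g i).1) ∧
      IsStdPair (g 0 : SLn n ⧸ N n) (g 1 : SLn n ⧸ N n) T := by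
  let R : SLn n := ⟨edgeMat fun i => (g i).1, det_edgeMat hg (g 0).2⟩
  obtain ⟨q, u, he, hq, hu, hu1⟩ := edgeMat_mul_snd hg
  have hdu := det_of_unipotent hu hu1
  have hdq : q.det = 1 := by
    have := congrArg Matrix.det he
    rw [Matrix.det_mul, Matrix.det_mul, det_edgeMat hg (g 0).2, hdu, mul_one] at this
    rw [← this]
    simp
  let q' : SLn n := ⟨q, hdq⟩
  let u' : SLn n := ⟨u, hdu⟩
  refine ⟨R⁻¹, by rw [inv_inv], ?_, q', hq, ?_⟩
  · symm
    rw [QuotientGroup.eq, inv_inv]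
    exact edgeMat_mul_fst hg
  · symm
    rw [QuotientGroup.eq]
    have : (R⁻¹ * q')⁻¹ * g 1 = u' := by
      rw [inv_mul_eq_iff_eq_mul, mul_assoc, eq_inv_mul_iff_mul_eq]
      exact Subtype.ext he
    rw [this]
    exact ⟨hu, hu1⟩

theorem sS_zero : sS 0 = 0 := by decide
theorem sS_one : sS 1 = 1 := by decide
theorem sS_two : sS 2 = 3 := by decide
theorem sS_three : sS 3 = 2 := by decide
theorem sM_zero : sM 0 = 0 := by decide
theorem sM_one : sM 1 = 2 := by decide
theorem sM_two : sM 2 = 1 := by decide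
theorem sM_three : sM 3 = 3 := by decide
theorem sL_zero : sL 0 = 1 := by decide
theorem sL_one : sL 1 = 0 := by decide
theorem sL_two : sL 2 = 2 := by decide
theorem sL_three : sL 3 = 3 := by decide

theorem exists_naturalSLCochain {n : ℕ} {g : Fin 4 → SLn n}
    (hg : IsGenericTuple fun i => (g i).1) : ∃ τ, IsNaturalSLCochain g τ := by
  have h := fun π : Perm (Fin 4) => exists_isStdPair (g := fun i => g (π i)) (hg.comp π)
  choose τ _ hτ using h
  refine ⟨τ, fun π => ⟨?_, hτ π⟩⟩
  refine (hτ (π * sS)).unique ?_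
  have := hτ π
  simpa [Perm.mul_apply, sS_zero, sS_one] using this

theorem IsNaturalSLCochain.unique {n : ℕ} {g : Fin 4 → SLn n} {τ τ' : Perm (Fin 4) → SLn n}
    (h : IsNaturalSLCochain g τ) (h' : IsNaturalSLCochain g τ') : τ = τ' :=
  funext fun π => IsStdPair.unique (h π).2 (h' π).2

theorem IsNaturalSLCochain.inv_eq {n : ℕ} {g : Fin 4 → SLn n} {τ : Perm (Fin 4) → SLn n}
    (hg : IsGenericTuple fun i => (g i).1) (h : IsNaturalSLCochain g τ) (π : Perm (Fin 4)) :
    ((τ π)⁻¹).1 = edgeMat fun i => (g (π i)).1 := by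
  obtain ⟨T, hT, hT'⟩ := exists_isStdPair (g := fun i => g (π i)) (hg.comp π)
  rw [← hT, hT'.unique (h π).2]

theorem coe_inv_mul_eq {n : ℕ} {S T : SLn n} {M : Matrix (Fin n) (Fin n) ℂ}
    (h : (S⁻¹).1 = M * (T⁻¹).1) : (S⁻¹ * T).1 = M := by
  rw [Matrix.SpecialLinearGroup.coe_mul, h, Matrix.mul_assoc,
    ← Matrix.SpecialLinearGroup.coe_mul, inv_mul_cancel, Matrix.SpecialLinearGroup.coe_one,
    Matrix.mul_one]

theorem coboundary_α {G : Type} [Group G] (τ : Perm (Fin 4) → G) (π : Perm (Fin 4)) :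
    (coboundary τ).α π = (τ π)⁻¹ * τ (π * sL) := by
  simp [coboundary, Cocycle.act, Cocycle.triv]

theorem coboundary_β {G : Type} [Group G] (τ : Perm (Fin 4) → G) (π : Perm (Fin 4)) :
    (coboundary τ).β π = (τ π)⁻¹ * τ (π * sM) := by
  simp [coboundary, Cocycle.act, Cocycle.triv]

theorem coboundary_γ {G : Type} [Group G] (τ : Perm (Fin 4) → G) (π : Perm (Fin 4)) :
    (coboundary τ).γ π = (τ π)⁻¹ * τ (π * sS) := by
  simp [coboundary, Cocycle.act, Cocycle.triv]

theorem isPtolemyFormula_coboundary {n : ℕ} {g : Fin 4 → SLn n} {τ : Perm (Fin 4) → SLn n}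
    (hg : IsGenericTuple fun i => (g i).1) (h : IsNaturalSLCochain g τ) :
    IsPtolemyFormula (detCoords fun i => (g i).1) (coboundary τ) := by
  intro π
  have hd : ∀ i, ((fun i => (g (π i)).1) i).det = 1 := fun i => (g (π i)).2
  refine ⟨fun hπ => ?_, ?_, ?_⟩
  · rw [coboundary_α]
    refine coe_inv_mul_eq ?_
    rw [h.inv_eq hg, h.inv_eq hg, edgeMat_eq_long (hg.comp π) hd,
      detCoords_comp (fun i => (g i).1) π, longMat_pullback hπ]
    rfl
  · rw [coboundary_β]
    refine coe_inv_mul_eq ?_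
    rw [h.inv_eq hg, h.inv_eq hg, edgeMat_eq_middle (hg.comp π) hd,
      detCoords_comp (fun i => (g i).1) π, middleMat_pullback]
    rfl
  · rw [coboundary_γ, (h π).1, inv_mul_cancel]

theorem IsPtolemyFormula.unique {n : ℕ} {c : PtolemyFun n} {σ σ' : Cocycle (SLn n)}
    (h : IsPtolemyFormula c σ) (h' : IsPtolemyFormula c σ') : σ = σ' := by
  have hlt : ∀ π : Perm (Fin 4), π 0 < π 1 → σ.α π = σ'.α π := fun π hπ =>
    Subtype.ext (((h π).1 hπ).trans ((h' π).1 hπ).symm)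
  ext1
  · funext π
    rcases lt_or_gt_of_ne (fun h0 => absurd (π.injective h0) (by decide) : π 0 ≠ π 1) with h1 | h1
    · exact hlt π h1
    · have h2 := hlt (π * sL) (by simpa [Perm.mul_apply, sL_zero, sL_one] using h1)
      rw [σ.α_rev, σ'.α_rev] at h2
      exact _root_.inv_inj.1 h2
  · exact funext fun π => Subtype.ext ((h π).2.1.trans (h' π).2.1.symm)
  · exact funext fun π => (h π).2.2.trans (h' π).2.2.symm

/-! ### Flags with prescribed Ptolemy coordinates -/

/-- A triangular system of linear equations `φ a w = y a`, with `a < M` and `P a`, is solvable; only the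
diagonal values of the equations that are imposed have to be non-zero. -/
theorem exists_triangular {V : Type*} [AddCommGroup V] [Module ℂ V] (M : ℕ) (P : ℕ → Prop)
    (φ : ℕ → V →ₗ[ℂ] ℂ) (e : ℕ → V) (h0 : ∀ a a', a < M → a' < a → φ a (e a') = 0)
    (h1 : ∀ a, a < M → P a → φ a (e a) ≠ 0) (y : ℕ → ℂ) :
    ∃ w, ∀ a, a < M → P a → φ a w = y a := by
  have : ∀ j, ∃ w, ∀ a, M - j ≤ a → a < M → P a → φ a w = y a := by
    intro j
    induction j with
    | zero => exact ⟨0, fun a ha ha' => by omega⟩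
    | succ j ih =>
      obtain ⟨w, hw⟩ := ih
      by_cases hM : j < M ∧ P (M - (j + 1))
      · set a₀ := M - (j + 1) with ha₀
        refine ⟨w + ((y a₀ - φ a₀ w) / φ a₀ (e a₀)) • e a₀, fun a ha ha' hP => ?_⟩
        rw [map_add, map_smul, smul_eq_mul]
        rcases eq_or_ne a a₀ with rfl | hne
        · rw [div_mul_cancel₀ _ (h1 a₀ ha' hP)]
          ring
        · rw [h0 a a₀ ha' (by omega), mul_zero, add_zero]
          exact hw a (by omega) ha' hP
      · refine ⟨w, fun a ha ha' hP => hw a ?_ ha' hP⟩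
        by_contra hlt
        have : a = M - (j + 1) := by omega
        exact hM ⟨by omega, this ▸ hP⟩
  obtain ⟨w, hw⟩ := this M
  exact ⟨w, fun a ha hP => hw a (by omega) ha hP⟩

/-- One more column can be chosen with prescribed determinants: the conditions on it form a
triangular system with respect to the columns of `g₀`. -/
theorem exists_column {n : ℕ} (g₀ g₁ : Matrix (Fin n) (Fin n) ℂ) (P : ℕ → Prop)
    (W : List (Fin n → ℂ)) (hW : W.length < n)
    (h : ∀ a b, P b → a + b + W.length = n → ldet (cols g₀ a ++ (cols g₁ b ++ W)) ≠ 0)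
    (y : ℕ → ℕ → ℂ) : ∃ w, ∀ a b, P b → a + b + W.length + 1 = n →
      ldet (cols g₀ a ++ (cols g₁ b ++ (W ++ [w]))) = y a b := by
  let m := n - W.length - 1
  have hlen : ∀ a, a < m + 1 → (cols g₀ a ++ (cols g₁ (m - a) ++ W)).length < n := by
    intro a ha; simp; omega
  let φ : ℕ → (Fin n → ℂ) →ₗ[ℂ] ℂ := fun a =>
    if ha : a < m + 1 then slot (cols g₀ a ++ (cols g₁ (m - a) ++ W)) [] (hlen a ha) else 0
  have hφ : ∀ a, a < m + 1 → ∀ v,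
      φ a v = ldet (cols g₀ a ++ (cols g₁ (m - a) ++ (W ++ [v]))) := by
    intro a ha v
    simp only [φ, dif_pos ha, ← ldet_slot, List.append_assoc]
  obtain ⟨w, hw⟩ := exists_triangular (m + 1) (fun a => P (m - a)) φ (colv g₀) (by
    intro a a' ha ha'
    rw [hφ a ha]
    refine ldet_eq_zero _ (by simp; omega) fun hn => ?_
    exact List.disjoint_of_nodup_append hn (colv_mem_cols _ ha') (by simp)) (by
    intro a ha hP
    rw [hφ a ha]
    have h1 := h (a + 1) (m - a) hP (by omega)
    have h2 := ldet_move (cols g₀ a) (cols g₁ (m - a) ++ W) [] (colv g₀ a) (by simp; omega)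
    simp only [List.append_nil, List.append_assoc] at h2
    rw [h2]
    refine mul_ne_zero (by simp) ?_
    simpa [cols_succ] using h1) (fun a => y a (m - a))
  refine ⟨w, fun a b hP hab => ?_⟩
  have hb : m - a = b := by omega
  have := hw a (by omega) (by rwa [hb])
  rw [hφ a (by omega)] at this
  simpa [hb] using this

/-- A matrix can be built column by column so that its columns have prescribed determinants with those
of `g₀` and `g₁`. The predicate `P` restricts the numbers of columns of `g₁` for which a determinant is
prescribed; with `P b ↔ b = 0` the matrix `g₁` plays no role. -/
theorem exists_flag {n : ℕ} (g₀ g₁ : Matrix (Fin n) (Fin n) ℂ) (P : ℕ → Prop)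
    (y : ℕ → ℕ → ℕ → ℂ) (hy : ∀ a b k, a + b + k = n → y a b k ≠ 0)
    (h : ∀ a b, P b → a + b = n → ldet (cols g₀ a ++ cols g₁ b) = y a b 0) :
    ∃ g₂ : Matrix (Fin n) (Fin n) ℂ, ∀ a b k, P b → a + b + k = n →
      ldet (cols g₀ a ++ (cols g₁ b ++ cols g₂ k)) = y a b k := by
  have key : ∀ k, k ≤ n → ∃ W : List (Fin n → ℂ), W.length = k ∧
      ∀ a b k', P b → k' ≤ k → a + b + k' = n →
        ldet (cols g₀ a ++ (cols g₁ b ++ W.take k')) = y a b k' := by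
    intro k
    induction k with
    | zero =>
      intro _
      refine ⟨[], rfl, fun a b k' hP hk' hab => ?_⟩
      obtain rfl : k' = 0 := by omega
      simpa using h a b hP (by omega)
    | succ k ih =>
      intro hk
      obtain ⟨W, hWl, hW⟩ := ih (by omega)
      obtain ⟨w, hw⟩ := exists_column g₀ g₁ P W (by omega) (fun a b hP hab => by
        have := hW a b k hP le_rfl (by omega)
        rw [List.take_of_length_le hWl.le] at this
        rw [this]
        exact hy a b k (by omega)) (fun a b => y a b (k + 1))
      refine ⟨W ++ [w], by simp [hWl], fun a b k' hP hk' hab => ?_⟩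
      rcases Nat.lt_or_ge k k' with hlt | hge
      · obtain rfl : k' = k + 1 := by omega
        rw [List.take_of_length_le (by simp [hWl])]
        exact hw a b hP (by omega)
      · rw [List.take_append_of_le_length (by omega)]
        exact hW a b k' hP hge hab
  obtain ⟨W, hWl, hW⟩ := key n le_rfl
  refine ⟨Matrix.of fun r j => W.getD j 0 r, fun a b k hP hab => ?_⟩
  rw [← hW a b k hP (by omega) hab]
  congr 3
  refine List.ext_getElem (by simp; omega) fun j h1 h2 => ?_
  have hj : j < n := by simp at h1; omega
  funext r
  have e1 : (cols (Matrix.of fun (r : Fin n) (j : Fin n) => W.getD j 0 r) k)[j] =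
      colv (Matrix.of fun (r : Fin n) (j : Fin n) => W.getD j 0 r) j := by
    simp only [cols, List.getElem_map, List.getElem_range]
  rw [e1]
  simp [colv, hj, hWl]

/-- A solution of the Ptolemy relations without zeros is determined by its values on the faces
`t 2 = 0` and `t 3 = 0`. -/
theorem ptolemy_ext {n : ℕ} (f f' : (Fin 4 → ℕ) → ℂ)
    (hf : ∀ s, ∑ i, s i + 2 = n → f (s + ![1, 0, 0, 1]) * f (s + ![0, 1, 1, 0]) +
      f (s + ![1, 1, 0, 0]) * f (s + ![0, 0, 1, 1]) =
      f (s + ![1, 0, 1, 0]) * f (s + ![0, 1, 0, 1]))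
    (hf' : ∀ s, ∑ i, s i + 2 = n → f' (s + ![1, 0, 0, 1]) * f' (s + ![0, 1, 1, 0]) +
      f' (s + ![1, 1, 0, 0]) * f' (s + ![0, 0, 1, 1]) =
      f' (s + ![1, 0, 1, 0]) * f' (s + ![0, 1, 0, 1]))
    (h0 : ∀ t, ∑ i, t i = n → f t ≠ 0)
    (hface : ∀ t, ∑ i, t i = n → t 2 = 0 ∨ t 3 = 0 → f' t = f t) :
    ∀ t, ∑ i, t i = n → f' t = f t := by
  suffices ∀ m, ∀ t : Fin 4 → ℕ, t 2 + t 3 = m → ∑ i, t i = n → f' t = f t from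
    fun t ht => this _ t rfl ht
  intro m
  induction m using Nat.strong_induction_on with
  | _ m ih =>
    intro t htm ht
    by_cases h2 : t 2 = 0
    · exact hface t ht (Or.inl h2)
    by_cases h3 : t 3 = 0
    · exact hface t ht (Or.inr h3)
    let s : Fin 4 → ℕ := ![t 0, t 1, t 2 - 1, t 3 - 1]
    have hs : ∑ i, s i + 2 = n := by
      rw [Fin.sum_univ_four] at ht
      simp only [Fin.sum_univ_four, s, Matrix.cons_val]
      omega
    have hst : s + ![0, 0, 1, 1] = t := by
      funext i; fin_cases i <;> simp [s] <;> omega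
    have hsum : ∀ e : Fin 4 → ℕ, ∑ i, e i = 2 → ∑ i, (s + e) i = n := by
      intro e he
      simp only [Pi.add_apply, Finset.sum_add_distrib]
      omega
    have hlow : ∀ e : Fin 4 → ℕ, ∑ i, e i = 2 → e 2 + e 3 < 2 → f' (s + e) = f (s + e) := by
      intro e he hlt
      refine ih _ ?_ _ rfl (hsum e he)
      simp only [Pi.add_apply, s, Matrix.cons_val]
      omega
    have e1 := hf s hs
    have e2 := hf' s hs
    rw [hlow ![1, 0, 0, 1] (by simp [Fin.sum_univ_four]) (by simp),
      hlow ![0, 1, 1, 0] (by simp [Fin.sum_univ_four]) (by simp),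
      hlow ![1, 1, 0, 0] (by simp [Fin.sum_univ_four]) (by simp),
      hlow ![1, 0, 1, 0] (by simp [Fin.sum_univ_four]) (by simp),
      hlow ![0, 1, 0, 1] (by simp [Fin.sum_univ_four]) (by simp), hst] at e2
    rw [hst] at e1
    have hne := h0 (s + ![1, 1, 0, 0]) (hsum _ (by simp [Fin.sum_univ_four]))
    refine mul_left_cancel₀ hne ?_
    linear_combination e2 - e1

theorem val_ne_zero {n : ℕ} {c : PtolemyFun n} (hc : ∀ t, c t ≠ 0) (t : Fin 4 → ℕ) :
    c.val t ≠ 0 := by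
  unfold PtolemyFun.val
  split_ifs
  · exact hc _
  · exact one_ne_zero

theorem val_vertex {n : ℕ} (c : PtolemyFun n) {t : Fin 4 → ℕ} {i : Fin 4} (h : t i = n) :
    c.val t = 1 := by
  rw [PtolemyFun.val, dif_neg]
  exact fun h' => h'.2 i h

/-- Every Ptolemy assignment is realized by matrices. Take `g₀ = 1`, choose `g₁` with the given values on
the edge `01`, then `g₂` and `g₃` with the given values on the faces `t 3 = 0` and `t 2 = 0`; all
other values are then determined by the Ptolemy relations. -/
theorem exists_detCoords_eq {n : ℕ} {c : PtolemyFun n} (hc : c ∈ ptolemySet n) :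
    ∃ g : Fin 4 → SLn n, IsGenericTuple (fun i => (g i).1) ∧
      detCoords (fun i => (g i).1) = c := by
  have hne := val_ne_zero hc.1
  obtain ⟨m₁, h1⟩ := exists_flag (1 : Matrix (Fin n) (Fin n) ℂ) 1 (fun b => b = 0)
    (fun a _ k => c.val ![a, k, 0, 0]) (fun _ _ _ _ => hne _) (by
      rintro a b rfl hab
      obtain rfl : a = n := by omega
      rw [cols_zero, List.append_nil, ldet_cols_self, Matrix.det_one]
      exact (val_vertex c (i := 0) (by simp)).symm)
  have h1' : ∀ a b, a + b = n → ldet (cols (1 : Matrix (Fin n) (Fin n) ℂ) a ++ cols m₁ b) =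
      c.val ![a, b, 0, 0] := fun a b hab => by simpa using h1 a 0 b rfl hab
  obtain ⟨m₂, h2⟩ := exists_flag (1 : Matrix (Fin n) (Fin n) ℂ) m₁ (fun _ => True)
    (fun a b k => c.val ![a, b, k, 0]) (fun _ _ _ _ => hne _) (fun a b _ hab => h1' a b hab)
  obtain ⟨m₃, h3⟩ := exists_flag (1 : Matrix (Fin n) (Fin n) ℂ) m₁ (fun _ => True)
    (fun a b k => c.val ![a, b, 0, k]) (fun _ _ _ _ => hne _) (fun a b _ hab => h1' a b hab)
  have d1 : m₁.det = 1 := by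
    have := h1' 0 n (by omega)
    rw [cols_zero, List.nil_append, ldet_cols_self] at this
    rw [this]
    exact val_vertex c (i := 1) (by simp)
  have d2 : m₂.det = 1 := by
    have := h2 0 0 n trivial (by omega)
    rw [cols_zero, cols_zero, List.nil_append, List.nil_append, ldet_cols_self] at this
    rw [this]
    exact val_vertex c (i := 2) (by simp)
  have d3 : m₃.det = 1 := by
    have := h3 0 0 n trivial (by omega)
    rw [cols_zero, cols_zero, List.nil_append, List.nil_append, ldet_cols_self] at this
    rw [this]
    exact val_vertex c (i := 3) (by simp)
  let G₁ : SLn n := ⟨m₁, d1⟩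
  let G₂ : SLn n := ⟨m₂, d2⟩
  let G₃ : SLn n := ⟨m₃, d3⟩
  let g : Fin 4 → SLn n := ![1, G₁, G₂, G₃]
  have key : ∀ t, ∑ i, t i = n → cdet (fun i => (g i).1) t = c.val t := by
    refine ptolemy_ext c.val (cdet fun i => (g i).1)
      (fun s hs => hc.2 ⟨s, hs⟩) (fun s hs => cdet_ptolemy _ s hs) (fun t _ => hne t) ?_
    intro t ht hface
    rw [Fin.sum_univ_four] at ht
    have g0 : (g 0).1 = 1 := Matrix.SpecialLinearGroup.coe_one
    have g1 : (g 1).1 = m₁ := rfl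
    have g2 : (g 2).1 = m₂ := rfl
    have g3 : (g 3).1 = m₃ := rfl
    simp only [cdet, colList, g0, g1, g2, g3]
    have ht' : t = ![t 0, t 1, t 2, t 3] := by
      funext i; fin_cases i <;> rfl
    rcases hface with h | h
    · rw [h, cols_zero, List.nil_append, h3 _ _ _ trivial (by omega)]
      conv_rhs => rw [ht', h]
    · rw [h, cols_zero, List.append_nil, h2 _ _ _ trivial (by omega)]
      conv_rhs => rw [ht', h]
  refine ⟨g, (isGenericTuple_iff _).2 fun t ht => by rw [key t ht]; exact hne t, ?_⟩
  funext t
  have h := val_detCoords (fun i => (g i).1) t.2.1 t.2.2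
  rw [key t.1 t.2.1, PtolemyFun.val, PtolemyFun.val, dif_pos t.2, dif_pos t.2] at h
  exact h

theorem detCoords_mem_ptolemySet {n : ℕ} {g : Fin 4 → SLn n}
    (hg : IsGenericTuple fun i => (g i).1) : detCoords (fun i => (g i).1) ∈ ptolemySet n := by
  refine ⟨fun t => hg t.1 t.2.1, fun s => ?_⟩
  have hsum : ∀ e : Fin 4 → ℕ, ∑ i, e i = 2 → ∑ i, (s.1 + e) i = n := by
    intro e he
    have := s.2
    simp only [Pi.add_apply, Finset.sum_add_distrib]
    omega
  have hd : ∀ i, ((fun i => (g i).1) i).det = 1 := fun i => (g i).2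
  rw [val_detCoords_of_det _ hd (hsum _ (by simp [Fin.sum_univ_four])),
    val_detCoords_of_det _ hd (hsum _ (by simp [Fin.sum_univ_four])),
    val_detCoords_of_det _ hd (hsum _ (by simp [Fin.sum_univ_four])),
    val_detCoords_of_det _ hd (hsum _ (by simp [Fin.sum_univ_four])),
    val_detCoords_of_det _ hd (hsum _ (by simp [Fin.sum_univ_four])),
    val_detCoords_of_det _ hd (hsum _ (by simp [Fin.sum_univ_four]))]
  exact cdet_ptolemy _ s.1 s.2

/-! ### Decorations and their natural cocycles -/

section

variable {G : Type} [Group G] {H : Subgroup G}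

theorem decMk_eq_iff {p p' : Fin 4 → G ⧸ H} : decMk p = decMk p' ↔ ∃ x : G, p' = x • p := by
  constructor
  · intro h
    obtain ⟨x, hx⟩ := (Quotient.exact h.symm : MulAction.orbitRel G (Fin 4 → G ⧸ H) p' p)
    exact ⟨x, hx.symm⟩
  · rintro ⟨x, hx⟩
    exact (Quotient.sound (⟨x, hx.symm⟩ : MulAction.orbitRel G (Fin 4 → G ⧸ H) p' p) :
      decMk p' = decMk p).symm

theorem decMk_surjective (D : Decoration H) : ∃ p, decMk p = D := Quotient.exists_rep D

theorem exists_lift (p : Fin 4 → G ⧸ H) : ∃ g : Fin 4 → G, (fun i => (g i : G ⧸ H)) = p :=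
  ⟨fun i => (p i).out, funext fun i => QuotientGroup.out_eq' (p i)⟩

theorem dec_surjective (D : Decoration H) : ∃ g, dec H g = D := by
  obtain ⟨p, rfl⟩ := decMk_surjective D
  obtain ⟨g, rfl⟩ := exists_lift p
  exact ⟨g, rfl⟩

theorem decMk_pullback (ρ : Perm (Fin 4)) (p : Fin 4 → G ⧸ H) :
    (decMk p).pullback ρ = decMk fun i => p (ρ i) := rfl

theorem dec_eq_iff {g g' : Fin 4 → G} :
    dec H g = dec H g' ↔ ∃ x : G, ∀ i, ∃ u ∈ H, g' i = x * g i * u := by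
  rw [dec, dec, decMk_eq_iff]
  refine exists_congr fun x => ?_
  rw [funext_iff]
  refine forall_congr' fun i => ?_
  change ((g' i : G) : G ⧸ H) = ((x * g i : G) : G ⧸ H) ↔ _
  rw [eq_comm, QuotientGroup.eq]
  constructor
  · exact fun h => ⟨_, h, by group⟩
  · rintro ⟨u, hu, h⟩
    rw [h]
    simpa [mul_assoc] using hu

theorem coboundary_smul (x : G) (τ : Perm (Fin 4) → G) :
    coboundary (fun π => x * τ π) = coboundary τ := by
  ext1 <;> funext π <;> simp [coboundary, Cocycle.act, Cocycle.triv, mul_assoc]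

theorem coboundary_pullback (ρ : Perm (Fin 4)) (τ : Perm (Fin 4) → G) :
    coboundary (fun π => τ (ρ * π)) = (coboundary τ).pullback ρ := by
  ext1 <;> funext π <;> simp [coboundary, Cocycle.act, Cocycle.triv, Cocycle.pullback, mul_assoc]

/-- A relation between tuples of cosets and 0-cochains, as satisfied by natural cochains: it is
equivariant under `G` and under reordering, the value of a cochain at a flag lies in the
coset of the first vertex, and it only depends on the cosets at the first three
vertices of the flag. -/
structure IsNaturality (P : (Fin 4 → G ⧸ H) → (Perm (Fin 4) → G) → Prop) : Prop where
  smul : ∀ {p τ} (x : G), P p τ → P (x • p) fun π => x * τ π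
  comp : ∀ {p τ} (ρ : Perm (Fin 4)), P p τ → P (fun i => p (ρ i)) fun π => τ (ρ * π)
  coset : ∀ {p τ}, P p τ → ∀ π, p (π 0) = (τ π : G ⧸ H)
  local_eq : ∀ {p p' τ τ'}, P p τ → P p' τ' → ∀ π : Perm (Fin 4),
    (∀ v, v ≠ π 3 → p v = p' v) → τ π = τ' π

open Classical in
/-- The coboundary of the natural cochain of a decoration (trivial if there is none). -/
noncomputable def natCocycle (P : (Fin 4 → G ⧸ H) → (Perm (Fin 4) → G) → Prop)
    (D : Decoration H) : Cocycle G :=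
  if h : ∃ τ, ∃ p, decMk p = D ∧ P p τ then coboundary h.choose else Cocycle.triv G

variable {P : (Fin 4 → G ⧸ H) → (Perm (Fin 4) → G) → Prop}

theorem IsNaturality.unique (hP : IsNaturality P) {p : Fin 4 → G ⧸ H} {τ τ' : Perm (Fin 4) → G}
    (h : P p τ) (h' : P p τ') : τ = τ' :=
  funext fun π => hP.local_eq h h' π fun _ _ => rfl

theorem IsNaturality.natCocycle_eq (hP : IsNaturality P) {p : Fin 4 → G ⧸ H}
    {τ : Perm (Fin 4) → G} (h : P p τ) : natCocycle P (decMk p) = coboundary τ := by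
  have hex : ∃ τ, ∃ p', decMk p' = decMk p ∧ P p' τ := ⟨τ, p, rfl, h⟩
  rw [natCocycle, dif_pos hex]
  obtain ⟨p', hp', h'⟩ := hex.choose_spec
  obtain ⟨x, rfl⟩ := decMk_eq_iff.1 hp'
  have := hP.unique (hP.smul x h') h
  rw [← this, coboundary_smul]

theorem IsNaturality.natCocycle_pullback (hP : IsNaturality P) {p : Fin 4 → G ⧸ H}
    {τ : Perm (Fin 4) → G} (h : P p τ) (ρ : Perm (Fin 4)) :
    natCocycle P ((decMk p).pullback ρ) = (natCocycle P (decMk p)).pullback ρ := by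
  rw [decMk_pullback, hP.natCocycle_eq (hP.comp ρ h), hP.natCocycle_eq h, coboundary_pullback]

/-- A decoration is recovered from its natural cocycle by following edges from the vertex `012` of the
doubly truncated simplex. -/
theorem IsNaturality.toDec_natCocycle (hP : IsNaturality P) {p : Fin 4 → G ⧸ H}
    {τ : Perm (Fin 4) → G} (h : P p τ) : (natCocycle P (decMk p)).toDec H = decMk p := by
  rw [hP.natCocycle_eq h, Cocycle.toDec, dec, decMk_eq_iff]
  refine ⟨τ 1, ?_⟩
  funext i
  have h0 := hP.coset h 1
  have h1 := hP.coset h sL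
  have h2 := hP.coset h (sM * sL)
  have h3 := hP.coset h (sS * sM * sL)
  have e2 : (sM * sL) 0 = 2 := by decide
  have e3 : (sS * sM * sL) 0 = 3 := by decide
  rw [e2] at h2
  rw [e3] at h3
  rw [Perm.one_apply] at h0
  rw [sL_zero] at h1
  have smul_mk : ∀ x y : G, x • (y : G ⧸ H) = ((x * y : G) : G ⧸ H) := fun _ _ => rfl
  fin_cases i
  · simp [h0, smul_mk]
  · simp [h1, smul_mk, coboundary_α]
  · simp [h2, smul_mk, coboundary_α, coboundary_β, mul_assoc]
  · simp [h3, smul_mk, coboundary_α, coboundary_β, coboundary_γ, mul_assoc]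

theorem IsNaturality.β_mem (hP : IsNaturality P) {p : Fin 4 → G ⧸ H} {τ : Perm (Fin 4) → G}
    (h : P p τ) (π : Perm (Fin 4)) : (coboundary τ).β π ∈ H := by
  rw [coboundary_β, ← QuotientGroup.eq, ← hP.coset h π, ← hP.coset h (π * sM), Perm.mul_apply,
    sM_zero]

end

/-! ### Change of representatives -/

/-- Left multiplication by `x` and right multiplication by upper triangular matrices rescale a
determinant of columns. -/
theorem cdet_mul {n : ℕ} (x : Matrix (Fin n) (Fin n) ℂ) (g b : Fin 4 → Matrix (Fin n) (Fin n) ℂ)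
    (hb : ∀ i, (b i).BlockTriangular id) {t : Fin 4 → ℕ} (ht : ∑ i, t i = n) :
    cdet (fun i => x * g i * b i) t =
      x.det * (∏ i, ∏ j ∈ Finset.range (t i), dg (b i) j) * cdet g t := by
  rw [Fin.sum_univ_four] at ht
  simp only [cdet, colList, Fin.prod_univ_four]
  have h0 := ldet_cols_mul_upper (x * g 0) (b 0) (hb 0) [] (cols (x * g 1 * b 1) (t 1) ++
    (cols (x * g 2 * b 2) (t 2) ++ cols (x * g 3 * b 3) (t 3))) (t 0) (by simp; omega)
  have h1 := ldet_cols_mul_upper (x * g 1) (b 1) (hb 1) (cols (x * g 0) (t 0))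
    (cols (x * g 2 * b 2) (t 2) ++ cols (x * g 3 * b 3) (t 3)) (t 1) (by simp; omega)
  have h2 := ldet_cols_mul_upper (x * g 2) (b 2) (hb 2) (cols (x * g 0) (t 0) ++
    cols (x * g 1) (t 1)) (cols (x * g 3 * b 3) (t 3)) (t 2) (by simp; omega)
  have h3 := ldet_cols_mul_upper (x * g 3) (b 3) (hb 3) (cols (x * g 0) (t 0) ++
    (cols (x * g 1) (t 1) ++ cols (x * g 2) (t 2))) [] (t 3) (by simp; omega)
  simp only [List.nil_append, List.append_nil, List.append_assoc] at h0 h1 h2 h3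
  rw [h0, h1, h2, h3]
  simp only [cols_mul, ← List.map_append]
  rw [ldet_map]
  ring

theorem dg_of_mem_N {n : ℕ} {u : SLn n} (hu : u ∈ N n) (j : ℕ) : dg u.1 j = 1 := by
  unfold dg
  split_ifs with h
  · exact hu.2 _
  · rfl

theorem cdet_eq_of_dec_eq {n : ℕ} {g g' : Fin 4 → SLn n} (h : dec (N n) g = dec (N n) g')
    {t : Fin 4 → ℕ} (ht : ∑ i, t i = n) :
    cdet (fun i => (g' i).1) t = cdet (fun i => (g i).1) t := by
  obtain ⟨x, hx⟩ := dec_eq_iff.1 h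
  choose u hu hgu using hx
  have e : (fun i => (g' i).1) = fun i => x.1 * (g i).1 * (u i).1 := by
    funext i
    rw [hgu i, Matrix.SpecialLinearGroup.coe_mul, Matrix.SpecialLinearGroup.coe_mul]
  rw [e, cdet_mul _ _ _ (fun i => (hu i).1) ht, x.2, one_mul]
  simp [dg_of_mem_N (hu _)]

theorem detCoords_eq_of_dec_eq {n : ℕ} {g g' : Fin 4 → SLn n} (h : dec (N n) g = dec (N n) g') :
    detCoords (fun i => (g' i).1) = detCoords (fun i => (g i).1) := by
  funext t
  change (concat _ t.1).det = (concat _ t.1).det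
  rw [det_concat _ _ t.2.1, det_concat _ _ t.2.1]
  exact cdet_eq_of_dec_eq h t.2.1

/-! ### The upper row of the diagram -/

/-- The Ptolemy assignment `𝒞(D)` of an `SL(n, ℂ)/N`-decoration. -/
noncomputable def ptolemyOf {n : ℕ} (D : Decoration (N n)) : PtolemyFun n :=
  detCoords fun i => ((dec_surjective D).choose i).1

theorem ptolemyOf_dec {n : ℕ} (g : Fin 4 → SLn n) :
    ptolemyOf (dec (N n) g) = detCoords fun i => (g i).1 :=
  detCoords_eq_of_dec_eq (dec_surjective (dec (N n) g)).choose_spec.symm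

/-- Natural 0-cochains of a tuple of affine flags. -/
def IsNatSL {n : ℕ} (p : Fin 4 → SLn n ⧸ N n) (τ : Perm (Fin 4) → SLn n) : Prop :=
  ∀ π, τ (π * sS) = τ π ∧ IsStdPair (p (π 0)) (p (π 1)) (τ π)

theorem isNaturality_SL (n : ℕ) : IsNaturality (IsNatSL (n := n)) where
  smul x h π := ⟨congrArg (x * ·) (h π).1, (h π).2.smul x⟩
  comp {_ τ} ρ h π := ⟨(congrArg τ (mul_assoc ρ π sS)).symm.trans (h (ρ * π)).1, (h (ρ * π)).2⟩
  coset h π := (h π).2.1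
  local_eq h h' π hv := by
    refine (h π).2.unique ?_
    rw [hv _ (fun h0 => absurd (π.injective h0) (by decide)),
      hv _ (fun h0 => absurd (π.injective h0) (by decide))]
    exact (h' π).2

/-- The natural cocycle of an `SL(n, ℂ)/N`-decoration. -/
noncomputable def cocycleSL {n : ℕ} (D : Decoration (N n)) : Cocycle (SLn n) :=
  natCocycle IsNatSL D

theorem cocycleSL_dec {n : ℕ} {g : Fin 4 → SLn n} {τ : Perm (Fin 4) → SLn n}
    (h : IsNaturalSLCochain g τ) : cocycleSL (dec (N n) g) = coboundary τ :=
  (isNaturality_SL n).natCocycle_eq h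

theorem exists_isNatSL {n : ℕ} {D : Decoration (N n)} (hD : D ∈ genericSL n) :
    ∃ p τ, decMk p = D ∧ IsNatSL p τ := by
  obtain ⟨g, hg, rfl⟩ := hD
  obtain ⟨τ, hτ⟩ := exists_naturalSLCochain hg
  exact ⟨_, τ, rfl, hτ⟩

theorem isPtolemyFormula_SL {n : ℕ} {D : Decoration (N n)} (hD : D ∈ genericSL n) :
    IsPtolemyFormula (ptolemyOf D) (cocycleSL D) := by
  obtain ⟨g, hg, rfl⟩ := hD
  obtain ⟨τ, hτ⟩ := exists_naturalSLCochain hg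
  rw [ptolemyOf_dec, cocycleSL_dec hτ]
  exact isPtolemyFormula_coboundary hg hτ

theorem toDec_cocycleSL {n : ℕ} {D : Decoration (N n)} (hD : D ∈ genericSL n) :
    (cocycleSL D).toDec (N n) = D := by
  obtain ⟨p, τ, rfl, h⟩ := exists_isNatSL hD
  exact (isNaturality_SL n).toDec_natCocycle h

theorem cocycleSL_pullback {n : ℕ} {D : Decoration (N n)} (hD : D ∈ genericSL n)
    (ρ : Perm (Fin 4)) : cocycleSL (D.pullback ρ) = (cocycleSL D).pullback ρ := by
  obtain ⟨p, τ, rfl, h⟩ := exists_isNatSL hD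
  exact (isNaturality_SL n).natCocycle_pullback h ρ

theorem ptolemyOf_pullback {n : ℕ} (D : Decoration (N n)) (ρ : Perm (Fin 4)) :
    ptolemyOf (D.pullback ρ) = (ptolemyOf D).pullback ρ := by
  obtain ⟨g, rfl⟩ := dec_surjective D
  rw [ptolemyOf_dec, ← detCoords_comp]
  exact ptolemyOf_dec fun i => g (ρ i)

theorem genericSL_pullback {n : ℕ} {D : Decoration (N n)} (hD : D ∈ genericSL n)
    (ρ : Perm (Fin 4)) : D.pullback ρ ∈ genericSL n := by
  obtain ⟨g, hg, rfl⟩ := hD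
  exact ⟨fun i => g (ρ i), hg.comp ρ, rfl⟩

theorem cocycleSL_mem {n : ℕ} {D : Decoration (N n)} (hD : D ∈ genericSL n) :
    cocycleSL D ∈ naturalSL n := by
  obtain ⟨g, hg, rfl⟩ := hD
  obtain ⟨τ, hτ⟩ := exists_naturalSLCochain hg
  rw [cocycleSL_dec hτ]
  refine ⟨fun π => ⟨(isNaturality_SL n).β_mem (p := fun i => (g i : SLn n ⧸ N n)) hτ π, ?_⟩,
    g, τ, hg, hτ, rfl⟩
  rw [Subgroup.mem_bot]
  exact (isPtolemyFormula_coboundary hg hτ π).2.2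

theorem bijOn_cocycleSL (n : ℕ) : Set.BijOn cocycleSL (genericSL n) (naturalSL n) := by
  refine ⟨fun D hD => cocycleSL_mem hD, fun D hD D' hD' h => ?_, ?_⟩
  · rw [← toDec_cocycleSL hD, ← toDec_cocycleSL hD', h]
  · rintro σ ⟨-, g, τ, hg, hτ, rfl⟩
    exact ⟨dec (N n) g, ⟨g, hg, rfl⟩, cocycleSL_dec hτ⟩

theorem bijOn_ptolemyOf (n : ℕ) : Set.BijOn ptolemyOf (genericSL n) (ptolemySet n) := by
  refine ⟨?_, fun D hD D' hD' h => ?_, fun c hc => ?_⟩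
  · rintro D ⟨g, hg, rfl⟩
    rw [ptolemyOf_dec]
    exact detCoords_mem_ptolemySet hg
  · have h1 := isPtolemyFormula_SL hD
    rw [h] at h1
    have h2 := h1.unique (isPtolemyFormula_SL hD')
    exact (bijOn_cocycleSL n).injOn hD hD' h2
  · obtain ⟨g, hg, rfl⟩ := exists_detCoords_eq hc
    exact ⟨dec (N n) g, ⟨g, hg, rfl⟩, ptolemyOf_dec g⟩

theorem pullback_mem_ptolemySet {n : ℕ} {c : PtolemyFun n} (hc : c ∈ ptolemySet n)
    (ρ : Perm (Fin 4)) : c.pullback ρ ∈ ptolemySet n := by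
  obtain ⟨D, hD, rfl⟩ := (bijOn_ptolemyOf n).surjOn hc
  rw [← ptolemyOf_pullback]
  exact (bijOn_ptolemyOf n).mapsTo (genericSL_pullback hD ρ)

/-! ### Products of shape parameters -/

/-- The six edges of a subsimplex. -/
def edgePt : Fin 6 → Fin 4 → ℕ :=
  ![![1, 1, 0, 0], ![0, 0, 1, 1], ![0, 1, 1, 0], ![1, 0, 0, 1], ![0, 1, 0, 1], ![1, 0, 1, 0]]

theorem edgePt_spec : ∀ j, ∑ i, edgePt j i = 2 ∧ ∀ i, edgePt j i ≠ 2 := by decide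

theorem edgePt_injective : Function.Injective edgePt := by
  intro i j h
  revert i j
  decide

theorem exists_edgePt {e : Fin 4 → ℕ} (he : ∑ i, e i = 2 ∧ ∀ i, e i ≠ 2) :
    ∃ j, edgePt j = e := by
  obtain ⟨h, h'⟩ := he
  rw [Fin.sum_univ_four] at h
  have h0 := h' 0
  have h1 := h' 1
  have h2 := h' 2
  have h3 := h' 3
  have he : e = ![e 0, e 1, e 2, e 3] := by
    funext i
    fin_cases i <;> rfl
  generalize e 0 = a, e 1 = b, e 2 = c, e 3 = d at *
  subst he
  have ha : a ≤ 1 := by omega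
  have hb : b ≤ 1 := by omega
  have hc : c ≤ 1 := by omega
  have hd : d ≤ 1 := by omega
  clear h' h0 h1 h2 h3
  interval_cases a <;> interval_cases b <;> interval_cases c <;> interval_cases d <;>
    first
    | (exfalso; revert h; decide)
    | exact ⟨0, rfl⟩
    | exact ⟨1, rfl⟩
    | exact ⟨2, rfl⟩
    | exact ⟨3, rfl⟩
    | exact ⟨4, rfl⟩
    | exact ⟨5, rfl⟩

theorem prod_intPt_two (f : (Fin 4 → ℕ) → ℂ) : ∏ e : IntPt 2, f e.1 = ∏ j, f (edgePt j) := by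
  let E : Fin 6 → IntPt 2 := fun j => ⟨edgePt j, edgePt_spec j⟩
  have hE : Function.Bijective E := by
    refine ⟨fun i j h => edgePt_injective (congrArg Subtype.val h), fun e => ?_⟩
    obtain ⟨j, hj⟩ := exists_edgePt e.2
    exact ⟨j, Subtype.ext hj⟩
  exact (hE.prod_comp fun e => f e.1).symm

theorem ShapeFun.val_eq {n : ℕ} (z : ShapeFun n) (s : Sub n) (e : IntPt 2) :
    z.val s.1 e.1 = z s e := by
  rw [ShapeFun.val, dif_pos ⟨s.2, e.2⟩]
  rfl

open Classical in
/-- The factor `z_s^e` of `shapeProd z t` with `s = t - e`, or `1` if there is none. -/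
noncomputable def edgeFactor {n : ℕ} (z : ShapeFun n) (t e : Fin 4 → ℕ) : ℂ :=
  if e ≤ t then z.val (t - e) e else 1

theorem edgeFactor_add {n : ℕ} (z : ShapeFun n) (s e : Fin 4 → ℕ) :
    edgeFactor z (s + e) e = z.val s e := by
  rw [edgeFactor, if_pos le_add_self, add_tsub_cancel_right]

theorem edgeFactor_of_lt {n : ℕ} (z : ShapeFun n) {t e : Fin 4 → ℕ} (i : Fin 4)
    (h : t i < e i) : edgeFactor z t e = 1 :=
  if_neg fun h' => absurd (h' i) (not_le.2 h)

theorem shapeProd_eq {n : ℕ} (z : ShapeFun n) {t : Fin 4 → ℕ} (ht : ∑ i, t i = n) :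
    shapeProd z t = ∏ j, edgeFactor z t (edgePt j) := by
  classical
  rw [← prod_intPt_two (edgeFactor z t), shapeProd, Finset.prod_filter,
    Fintype.prod_prod_type_right]
  refine Finset.prod_congr rfl fun e _ => ?_
  dsimp only
  by_cases h : e.1 ≤ t
  · have hs : ∑ i, (t - e.1) i + 2 = n := by
      have h1 : ∑ i, (t - e.1) i + ∑ i, e.1 i = n := by
        rw [← Finset.sum_add_distrib, ← ht]
        exact Finset.sum_congr rfl fun i _ => Nat.sub_add_cancel (h i)
      have h2 := e.2.1
      omega
    let s₀ : Sub n := ⟨t - e.1, hs⟩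
    refine (Finset.prod_eq_single s₀ ?_ ?_).trans ?_
    · intro s _ hne
      refine if_neg fun h' => hne (Subtype.ext ?_)
      change s.1 = t - e.1
      rw [← h', add_tsub_cancel_right]
    · exact fun h => absurd (Finset.mem_univ _) h
    · rw [if_pos (tsub_add_cancel_of_le h), edgeFactor, if_pos h]
      exact (z.val_eq s₀ e).symm
  · rw [edgeFactor, if_neg h]
    refine Finset.prod_eq_one fun s _ => if_neg fun h' => h ?_
    rw [← h']
    exact le_add_self

theorem sum_add_eq {n : ℕ} {s : Fin 4 → ℕ} (hs : ∑ i, s i + 2 = n) (e : Fin 4 → ℕ)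
    (he : ∑ i, e i = 2) : ∑ i, (s + e) i = n := by
  simp only [Pi.add_apply, Finset.sum_add_distrib]
  omega

theorem edgeFactor_of_eq {n : ℕ} (z : ShapeFun n) (u : Fin 4 → ℕ) {e e' t : Fin 4 → ℕ}
    (h : e' + e = t) : edgeFactor z (u + t) e = z.val (u + e') e := by
  rw [← h, ← add_assoc, edgeFactor_add]

/-- All six subsimplices around an interior point contribute. -/
theorem shapeProd_interior {n : ℕ} (z : ShapeFun n) {u : Fin 4 → ℕ}
    (hu : ∑ i, u i + 4 = n) : shapeProd z (u + ![1, 1, 1, 1]) =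
      z.val (u + ![0, 0, 1, 1]) ![1, 1, 0, 0] * z.val (u + ![1, 1, 0, 0]) ![0, 0, 1, 1] *
      z.val (u + ![1, 0, 0, 1]) ![0, 1, 1, 0] * z.val (u + ![0, 1, 1, 0]) ![1, 0, 0, 1] *
      z.val (u + ![1, 0, 1, 0]) ![0, 1, 0, 1] * z.val (u + ![0, 1, 0, 1]) ![1, 0, 1, 0] := by
  rw [shapeProd_eq z (by
    simp only [Pi.add_apply, Finset.sum_add_distrib]; simp [Fin.sum_univ_four] at hu ⊢; omega),
    Fin.prod_univ_six]
  simp only [edgePt, Matrix.cons_val]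
  rw [edgeFactor_of_eq z u (e' := ![0, 0, 1, 1]) (e := ![1, 1, 0, 0]) (by decide),
    edgeFactor_of_eq z u (e' := ![1, 1, 0, 0]) (e := ![0, 0, 1, 1]) (by decide),
    edgeFactor_of_eq z u (e' := ![1, 0, 0, 1]) (e := ![0, 1, 1, 0]) (by decide),
    edgeFactor_of_eq z u (e' := ![0, 1, 1, 0]) (e := ![1, 0, 0, 1]) (by decide),
    edgeFactor_of_eq z u (e' := ![1, 0, 1, 0]) (e := ![0, 1, 0, 1]) (by decide),
    edgeFactor_of_eq z u (e' := ![0, 1, 0, 1]) (e := ![1, 0, 1, 0]) (by decide)]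

/-- At a point in the interior of the face `t 3 = 0` only the three subsimplices along this face
contribute. -/
theorem shapeProd_face {n : ℕ} (z : ShapeFun n) {u : Fin 4 → ℕ} (hu3 : u 3 = 0)
    (hu : ∑ i, u i + 3 = n) : shapeProd z (u + ![1, 1, 1, 0]) =
      z.val (u + ![0, 0, 1, 0]) ![1, 1, 0, 0] * z.val (u + ![1, 0, 0, 0]) ![0, 1, 1, 0] *
      z.val (u + ![0, 1, 0, 0]) ![1, 0, 1, 0] := by
  rw [shapeProd_eq z (by
    simp only [Pi.add_apply, Finset.sum_add_distrib]; simp [Fin.sum_univ_four] at hu ⊢; omega),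
    Fin.prod_univ_six]
  simp only [edgePt, Matrix.cons_val]
  rw [edgeFactor_of_eq z u (e' := ![0, 0, 1, 0]) (e := ![1, 1, 0, 0]) (by decide),
    edgeFactor_of_lt z (e := ![0, 0, 1, 1]) 3 (by simp [hu3]),
    edgeFactor_of_eq z u (e' := ![1, 0, 0, 0]) (e := ![0, 1, 1, 0]) (by decide),
    edgeFactor_of_lt z (e := ![1, 0, 0, 1]) 3 (by simp [hu3]),
    edgeFactor_of_lt z (e := ![0, 1, 0, 1]) 3 (by simp [hu3]),
    edgeFactor_of_eq z u (e' := ![0, 1, 0, 0]) (e := ![1, 0, 1, 0]) (by decide)]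
  ring

/-- At a point in the interior of the edge `01` only the subsimplex on this edge contributes. -/
theorem shapeProd_edge {n : ℕ} (z : ShapeFun n) {u : Fin 4 → ℕ} (hu2 : u 2 = 0) (hu3 : u 3 = 0)
    (hu : ∑ i, u i + 2 = n) : shapeProd z (u + ![1, 1, 0, 0]) = z.val u ![1, 1, 0, 0] := by
  rw [shapeProd_eq z (sum_add_eq hu _ (by simp [Fin.sum_univ_four])), Fin.prod_univ_six]
  simp only [edgePt, Matrix.cons_val]
  rw [edgeFactor_add, edgeFactor_of_lt z (e := ![0, 0, 1, 1]) 2 (by simp [hu2]),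
    edgeFactor_of_lt z (e := ![0, 1, 1, 0]) 2 (by simp [hu2]),
    edgeFactor_of_lt z (e := ![1, 0, 0, 1]) 3 (by simp [hu3]),
    edgeFactor_of_lt z (e := ![0, 1, 0, 1]) 3 (by simp [hu3]),
    edgeFactor_of_lt z (e := ![1, 0, 1, 0]) 2 (by simp [hu2])]
  ring

/-! ### The monomial map on arbitrary functions -/

/-- The monomial expression defining `μ`, for a function of all integral points. -/
noncomputable def muFun (f : (Fin 4 → ℕ) → ℂ) (s e : Fin 4 → ℕ) : ℂ :=
  if e = ![1, 1, 0, 0] ∨ e = ![0, 0, 1, 1] then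
    (f (s + ![1, 0, 0, 1]) * f (s + ![0, 1, 1, 0])) /
      (f (s + ![1, 0, 1, 0]) * f (s + ![0, 1, 0, 1]))
  else if e = ![0, 1, 1, 0] ∨ e = ![1, 0, 0, 1] then
    (f (s + ![0, 1, 0, 1]) * f (s + ![1, 0, 1, 0])) /
      (f (s + ![1, 1, 0, 0]) * f (s + ![0, 0, 1, 1]))
  else
    -((f (s + ![1, 1, 0, 0]) * f (s + ![0, 0, 1, 1])) /
      (f (s + ![1, 0, 0, 1]) * f (s + ![0, 1, 1, 0])))

theorem mu_eq {n : ℕ} (c : PtolemyFun n) (s : Sub n) (e : IntPt 2) :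
    mu c s e = muFun c.val s.1 e.1 := rfl

theorem val_mu {n : ℕ} (c : PtolemyFun n) {s : Fin 4 → ℕ} (hs : ∑ i, s i + 2 = n) (j : Fin 6) :
    (mu c).val s (edgePt j) = muFun c.val s (edgePt j) := by
  rw [ShapeFun.val, dif_pos ⟨hs, edgePt_spec j⟩]
  rfl

section

variable (f : (Fin 4 → ℕ) → ℂ) (s : Fin 4 → ℕ)

theorem muFun_1100 : muFun f s ![1, 1, 0, 0] = (f (s + ![1, 0, 0, 1]) * f (s + ![0, 1, 1, 0])) /
    (f (s + ![1, 0, 1, 0]) * f (s + ![0, 1, 0, 1])) := by simp [muFun]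

theorem muFun_0011 : muFun f s ![0, 0, 1, 1] = (f (s + ![1, 0, 0, 1]) * f (s + ![0, 1, 1, 0])) /
    (f (s + ![1, 0, 1, 0]) * f (s + ![0, 1, 0, 1])) := by simp [muFun]

theorem muFun_0110 : muFun f s ![0, 1, 1, 0] = (f (s + ![0, 1, 0, 1]) * f (s + ![1, 0, 1, 0])) /
    (f (s + ![1, 1, 0, 0]) * f (s + ![0, 0, 1, 1])) := by simp [muFun]

theorem muFun_1001 : muFun f s ![1, 0, 0, 1] = (f (s + ![0, 1, 0, 1]) * f (s + ![1, 0, 1, 0])) /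
    (f (s + ![1, 1, 0, 0]) * f (s + ![0, 0, 1, 1])) := by simp [muFun]

theorem muFun_0101 : muFun f s ![0, 1, 0, 1] = -((f (s + ![1, 1, 0, 0]) * f (s + ![0, 0, 1, 1])) /
    (f (s + ![1, 0, 0, 1]) * f (s + ![0, 1, 1, 0]))) := by simp [muFun]

theorem muFun_1010 : muFun f s ![1, 0, 1, 0] = -((f (s + ![1, 1, 0, 0]) * f (s + ![0, 0, 1, 1])) /
    (f (s + ![1, 0, 0, 1]) * f (s + ![0, 1, 1, 0]))) := by simp [muFun]

end

theorem muFun_ne_zero {f : (Fin 4 → ℕ) → ℂ} (hf : ∀ t, f t ≠ 0) (s e : Fin 4 → ℕ) :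
    muFun f s e ≠ 0 := by
  unfold muFun
  split_ifs <;> simp [hf]

/-- The product of cross-ratios around an interior point: all twelve neighbours cancel. -/
theorem muFun_interior {f : (Fin 4 → ℕ) → ℂ} (hf : ∀ t, f t ≠ 0) (u : Fin 4 → ℕ) :
    muFun f (u + ![0, 0, 1, 1]) ![1, 1, 0, 0] * muFun f (u + ![1, 1, 0, 0]) ![0, 0, 1, 1] *
      muFun f (u + ![1, 0, 0, 1]) ![0, 1, 1, 0] * muFun f (u + ![0, 1, 1, 0]) ![1, 0, 0, 1] *
      muFun f (u + ![1, 0, 1, 0]) ![0, 1, 0, 1] * muFun f (u + ![0, 1, 0, 1]) ![1, 0, 1, 0] =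
    1 := by
  rw [muFun_1100, muFun_0011, muFun_0110, muFun_1001, muFun_0101, muFun_1010]
  simp only [add_assoc, Matrix.add_cons, Matrix.head_cons, Matrix.tail_cons, Matrix.empty_add_empty,
    Nat.reduceAdd]
  field_simp
  exact div_self (by simp [hf])

/-- The cross-ratio at an edge of a subsimplex satisfies the shape parameter relations when the
Ptolemy relation holds. -/
theorem isShapeAssignment_mu {n : ℕ} {c : PtolemyFun n} (hc : c ∈ ptolemySet n) :
    IsShapeAssignment (mu c) := by
  have hf := val_ne_zero hc.1
  have key : ∀ s : Sub n, ∀ j, muFun c.val s.1 (edgePt j) ≠ 1 := by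
    intro s j
    have hP := hc.2 s
    have h1 := hf (s.1 + ![1, 0, 0, 1])
    have h2 := hf (s.1 + ![0, 1, 1, 0])
    have h3 := hf (s.1 + ![1, 1, 0, 0])
    have h4 := hf (s.1 + ![0, 0, 1, 1])
    have h5 := hf (s.1 + ![1, 0, 1, 0])
    have h6 := hf (s.1 + ![0, 1, 0, 1])
    intro h
    fin_cases j <;>
      simp only [edgePt, Fin.zero_eta, Fin.mk_one, Fin.reduceFinMk, Matrix.cons_val, muFun_1100,
        muFun_0011, muFun_0110, muFun_1001, muFun_0101, muFun_1010] at h <;>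
      field_simp at h
    · exact mul_ne_zero h3 h4 (by linear_combination hP - h)
    · exact mul_ne_zero h3 h4 (by linear_combination hP - h)
    · exact mul_ne_zero h1 h2 (by linear_combination hP + h)
    · exact mul_ne_zero h1 h2 (by linear_combination hP + h)
    · exact mul_ne_zero h5 h6 (by linear_combination -hP - h)
    · exact mul_ne_zero h5 h6 (by linear_combination -hP - h)
  refine ⟨fun s e => ?_, fun s => ?_⟩
  · obtain ⟨j, hj⟩ := exists_edgePt e.2
    rw [mu_eq, ← hj]
    exact ⟨muFun_ne_zero hf _ _, key s j⟩
  · have hP := hc.2 s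
    have h1 := hf (s.1 + ![1, 0, 0, 1])
    have h2 := hf (s.1 + ![0, 1, 1, 0])
    have h3 := hf (s.1 + ![1, 1, 0, 0])
    have h4 := hf (s.1 + ![0, 0, 1, 1])
    have h5 := hf (s.1 + ![1, 0, 1, 0])
    have h6 := hf (s.1 + ![0, 1, 0, 1])
    have k0 := val_mu c s.2 0
    have k1 := val_mu c s.2 1
    have k2 := val_mu c s.2 2
    have k3 := val_mu c s.2 3
    have k4 := val_mu c s.2 4
    have k5 := val_mu c s.2 5
    have n0 := key s 0
    have n2 := key s 2
    have n4 := key s 4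
    simp only [edgePt, Matrix.cons_val] at k0 k1 k2 k3 k4 k5 n0 n2 n4
    rw [k0, k1, k2, k3, k4, k5]
    refine ⟨⟨by rw [muFun_1100, muFun_0011], ?_⟩, ⟨by rw [muFun_0110, muFun_1001], ?_⟩,
      ⟨by rw [muFun_0101, muFun_1010], ?_⟩⟩
    · rw [eq_div_iff (sub_ne_zero.2 n4.symm), muFun_1100, muFun_0101]
      field_simp
      linear_combination hP
    · rw [eq_div_iff (sub_ne_zero.2 (by rw [muFun_0011, ← muFun_1100]; exact n0.symm)), muFun_1001,
        muFun_0011]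
      field_simp
      linear_combination -hP
    · rw [eq_div_iff (sub_ne_zero.2 n2.symm), muFun_1010, muFun_0110]
      field_simp
      linear_combination -hP

theorem mu_mem_shapeSet {n : ℕ} {c : PtolemyFun n} (hc : c ∈ ptolemySet n) :
    mu c ∈ shapeSet n := by
  refine ⟨isShapeAssignment_mu hc, fun t ht => ?_⟩
  let u : Fin 4 → ℕ := fun i => t.1 i - 1
  have htu : t.1 = u + ![1, 1, 1, 1] := by
    funext i
    have := ht i
    fin_cases i <;> simp [u] at this ⊢ <;> omega
  have hu : ∑ i, u i + 4 = n := by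
    have := t.2.1
    rw [htu] at this
    simp only [Pi.add_apply, Finset.sum_add_distrib] at this
    simpa [Fin.sum_univ_four] using this
  have hs : ∀ e : Fin 4 → ℕ, ∑ i, e i = 2 → ∑ i, (u + e) i + 2 = n := by
    intro e he
    simp only [Pi.add_apply, Finset.sum_add_distrib]
    omega
  rw [htu, shapeProd_interior _ hu]
  have k0 := val_mu c (hs ![0, 0, 1, 1] (by simp [Fin.sum_univ_four])) 0
  have k1 := val_mu c (hs ![1, 1, 0, 0] (by simp [Fin.sum_univ_four])) 1
  have k2 := val_mu c (hs ![1, 0, 0, 1] (by simp [Fin.sum_univ_four])) 2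
  have k3 := val_mu c (hs ![0, 1, 1, 0] (by simp [Fin.sum_univ_four])) 3
  have k4 := val_mu c (hs ![1, 0, 1, 0] (by simp [Fin.sum_univ_four])) 4
  have k5 := val_mu c (hs ![0, 1, 0, 1] (by simp [Fin.sum_univ_four])) 5
  simp only [edgePt, Matrix.cons_val] at k0 k1 k2 k3 k4 k5
  rw [k0, k1, k2, k3, k4, k5]
  exact muFun_interior (val_ne_zero hc.1) u

/-! ### Symmetries of shape parameters -/

theorem permPt_mul (σ ρ : Perm (Fin 4)) (t : Fin 4 → ℕ) :
    permPt (σ * ρ) t = permPt σ (permPt ρ t) := rfl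

theorem ShapeFun.val_pullback {n : ℕ} (z : ShapeFun n) (π : Perm (Fin 4)) (s e : Fin 4 → ℕ) :
    (z.pullback π).val s e =
      z.val (permPt π s) (permPt π e) ^ ((Perm.sign π : ℤˣ) : ℤ) := by
  by_cases h : (∑ i, s i + 2 = n) ∧ (∑ i, e i = 2 ∧ ∀ i, e i ≠ 2)
  · have h' : (∑ i, permPt π s i + 2 = n) ∧ (∑ i, permPt π e i = 2 ∧ ∀ i, permPt π e i ≠ 2) := by
      rw [sum_permPt, sum_permPt]
      exact ⟨h.1, h.2.1, fun i => h.2.2 _⟩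
    rw [ShapeFun.val, dif_pos h, ShapeFun.val, dif_pos h']
    rfl
  · have h' : ¬((∑ i, permPt π s i + 2 = n) ∧
        (∑ i, permPt π e i = 2 ∧ ∀ i, permPt π e i ≠ 2)) := by
      rw [sum_permPt, sum_permPt]
      refine fun h' => h ⟨h'.1, h'.2.1, fun i => ?_⟩
      have := h'.2.2 (π i)
      simpa [permPt] using this
    rw [ShapeFun.val, dif_neg h, ShapeFun.val, dif_neg h', _root_.one_zpow]

theorem ShapeFun.pullback_pullback {n : ℕ} (z : ShapeFun n) (π ρ : Perm (Fin 4)) :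
    (z.pullback π).pullback ρ = z.pullback (π * ρ) := by
  funext s e
  change (z ((s.act ρ).act π) ((e.act ρ).act π) ^ ((Perm.sign π : ℤˣ) : ℤ)) ^
    ((Perm.sign ρ : ℤˣ) : ℤ) = z (s.act (π * ρ)) (e.act (π * ρ)) ^ ((Perm.sign (π * ρ) : ℤˣ) : ℤ)
  rw [← _root_.zpow_mul, Perm.sign_mul, Units.val_mul]
  rfl

theorem ShapeFun.pullback_one {n : ℕ} (z : ShapeFun n) : z.pullback 1 = z := by
  funext s e
  change z (s.act 1) (e.act 1) ^ ((Perm.sign (1 : Perm (Fin 4)) : ℤˣ) : ℤ) = z s e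
  rw [Perm.sign_one, Units.val_one, zpow_one]
  rfl

theorem shapeProd_pullback {n : ℕ} (z : ShapeFun n) (π : Perm (Fin 4)) (t : Fin 4 → ℕ) :
    shapeProd (z.pullback π) t = shapeProd z (permPt π t) ^ ((Perm.sign π : ℤˣ) : ℤ) := by
  classical
  have hinv : ∀ (m : ℕ) (s : Sub m), (s.act π).act π⁻¹ = s := fun m s =>
    Subtype.ext (by
      change permPt π⁻¹ (permPt π s.1) = s.1
      rw [← permPt_mul, inv_mul_cancel]; rfl)
  have hinv' : ∀ (m : ℕ) (s : Sub m), (s.act π⁻¹).act π = s := fun m s =>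
    Subtype.ext (by
      change permPt π (permPt π⁻¹ s.1) = s.1
      rw [← permPt_mul, mul_inv_cancel]; rfl)
  have einv : ∀ (m : ℕ) (s : IntPt m), (s.act π).act π⁻¹ = s := fun m s =>
    Subtype.ext (by
      change permPt π⁻¹ (permPt π s.1) = s.1
      rw [← permPt_mul, inv_mul_cancel]; rfl)
  have einv' : ∀ (m : ℕ) (s : IntPt m), (s.act π⁻¹).act π = s := fun m s =>
    Subtype.ext (by
      change permPt π (permPt π⁻¹ s.1) = s.1
      rw [← permPt_mul, mul_inv_cancel]; rfl)
  let E : Sub n × IntPt 2 ≃ Sub n × IntPt 2 :=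
    { toFun := fun p => (p.1.act π, p.2.act π)
      invFun := fun p => (p.1.act π⁻¹, p.2.act π⁻¹)
      left_inv := fun p => Prod.ext (hinv n p.1) (einv 2 p.2)
      right_inv := fun p => Prod.ext (hinv' n p.1) (einv' 2 p.2) }
  rw [shapeProd, shapeProd, ← Finset.prod_zpow]
  refine Finset.prod_equiv E (fun p => ?_) fun p _ => rfl
  simp only [Finset.mem_filter, Finset.mem_univ, true_and]
  change p.1.1 + p.2.1 = t ↔ permPt π p.1.1 + permPt π p.2.1 = permPt π t
  rw [← permPt_add]
  refine ⟨fun h => by rw [h], fun h => ?_⟩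
  funext i
  have := congrFun h (π i)
  simpa [permPt] using this

theorem blockSign_swap01 (t : Fin 4 → ℕ) : blockSign (swap 0 1) t = (-1) ^ (t 0 * t 1) := by
  simp [blockSign, pairSign, swap_apply_def, Fin.lt_def]

theorem blockSign_swap12 (t : Fin 4 → ℕ) : blockSign (swap 1 2) t = (-1) ^ (t 1 * t 2) := by
  simp [blockSign, pairSign, swap_apply_def, Fin.lt_def]

theorem blockSign_swap23 (t : Fin 4 → ℕ) : blockSign (swap 2 3) t = (-1) ^ (t 2 * t 3) := by
  simp [blockSign, pairSign, swap_apply_def, Fin.lt_def]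

/-- The cross-ratios at an edge before and after an adjacent transposition are inverse to each other,
including the block signs of the transposed Ptolemy coordinates. -/
theorem muFun_swap {f : (Fin 4 → ℕ) → ℂ} (hf : ∀ t, f t ≠ 0) (k : Fin 3) (s : Fin 4 → ℕ)
    (j : Fin 6) :
    muFun (fun t => blockSign (swap k.castSucc k.succ) t * f (permPt (swap k.castSucc k.succ) t)) s
      (edgePt j) = (muFun f (permPt (swap k.castSucc k.succ) s)
        (permPt (swap k.castSucc k.succ) (edgePt j)))⁻¹ := by
  have hm : ∀ a : ℕ, (-1 : ℂ) ^ a ≠ 0 := fun a => pow_ne_zero _ (by norm_num)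
  fin_cases k
  · have h0 : permPt (swap 0 1) ![1, 1, 0, 0] = ![1, 1, 0, 0] := by decide
    have h1 : permPt (swap 0 1) ![0, 0, 1, 1] = ![0, 0, 1, 1] := by decide
    have h2 : permPt (swap 0 1) ![0, 1, 1, 0] = ![1, 0, 1, 0] := by decide
    have h3 : permPt (swap 0 1) ![1, 0, 0, 1] = ![0, 1, 0, 1] := by decide
    have h4 : permPt (swap 0 1) ![0, 1, 0, 1] = ![1, 0, 0, 1] := by decide
    have h5 : permPt (swap 0 1) ![1, 0, 1, 0] = ![0, 1, 1, 0] := by decide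
    change muFun (fun t => blockSign (swap 0 1) t * f (permPt (swap 0 1) t)) s
      (edgePt j) = (muFun f (permPt (swap 0 1) s) (permPt (swap 0 1) (edgePt j)))⁻¹
    fin_cases j <;>
      simp only [edgePt, Fin.zero_eta, Fin.mk_one, Fin.reduceFinMk, Matrix.cons_val, h0, h1, h2, h3,
        h4, h5, permPt_add, blockSign_swap01, muFun_1100, muFun_0011, muFun_0110, muFun_1001,
        muFun_0101, muFun_1010, Pi.add_apply, add_zero, add_mul, mul_add, one_mul, mul_one,
        pow_add, pow_one] <;>
      field_simp [hm, hf]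
  · have h0 : permPt (swap 1 2) ![1, 1, 0, 0] = ![1, 0, 1, 0] := by decide
    have h1 : permPt (swap 1 2) ![0, 0, 1, 1] = ![0, 1, 0, 1] := by decide
    have h2 : permPt (swap 1 2) ![0, 1, 1, 0] = ![0, 1, 1, 0] := by decide
    have h3 : permPt (swap 1 2) ![1, 0, 0, 1] = ![1, 0, 0, 1] := by decide
    have h4 : permPt (swap 1 2) ![0, 1, 0, 1] = ![0, 0, 1, 1] := by decide
    have h5 : permPt (swap 1 2) ![1, 0, 1, 0] = ![1, 1, 0, 0] := by decide
    change muFun (fun t => blockSign (swap 1 2) t * f (permPt (swap 1 2) t)) s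
      (edgePt j) = (muFun f (permPt (swap 1 2) s) (permPt (swap 1 2) (edgePt j)))⁻¹
    fin_cases j <;>
      simp only [edgePt, Fin.zero_eta, Fin.mk_one, Fin.reduceFinMk, Matrix.cons_val, h0, h1, h2, h3,
        h4, h5, permPt_add, blockSign_swap12, muFun_1100, muFun_0011, muFun_0110, muFun_1001,
        muFun_0101, muFun_1010, Pi.add_apply, add_zero, add_mul, mul_add, one_mul, mul_one,
        pow_add, pow_one] <;>
      field_simp [hm, hf]
  · have h0 : permPt (swap 2 3) ![1, 1, 0, 0] = ![1, 1, 0, 0] := by decide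
    have h1 : permPt (swap 2 3) ![0, 0, 1, 1] = ![0, 0, 1, 1] := by decide
    have h2 : permPt (swap 2 3) ![0, 1, 1, 0] = ![0, 1, 0, 1] := by decide
    have h3 : permPt (swap 2 3) ![1, 0, 0, 1] = ![1, 0, 1, 0] := by decide
    have h4 : permPt (swap 2 3) ![0, 1, 0, 1] = ![0, 1, 1, 0] := by decide
    have h5 : permPt (swap 2 3) ![1, 0, 1, 0] = ![1, 0, 0, 1] := by decide
    change muFun (fun t => blockSign (swap 2 3) t * f (permPt (swap 2 3) t)) s
      (edgePt j) = (muFun f (permPt (swap 2 3) s) (permPt (swap 2 3) (edgePt j)))⁻¹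
    fin_cases j <;>
      simp only [edgePt, Fin.zero_eta, Fin.mk_one, Fin.reduceFinMk, Matrix.cons_val, h0, h1, h2, h3,
        h4, h5, permPt_add, blockSign_swap23, muFun_1100, muFun_0011, muFun_0110, muFun_1001,
        muFun_0101, muFun_1010, Pi.add_apply, add_zero, add_mul, mul_add, one_mul, mul_one,
        pow_add, pow_one] <;>
      field_simp [hm, hf]

theorem muFun_congr {f g : (Fin 4 → ℕ) → ℂ} {s : Fin 4 → ℕ}
    (h : ∀ e : Fin 4 → ℕ, ∑ i, e i = 2 → f (s + e) = g (s + e)) (e : Fin 4 → ℕ) :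
    muFun f s e = muFun g s e := by
  unfold muFun
  rw [h _ (by decide), h _ (by decide), h _ (by decide), h _ (by decide), h _ (by decide),
    h _ (by decide)]

theorem Decoration.pullback_pullback {G : Type} [Group G] {H : Subgroup G} (D : Decoration H)
    (σ ρ : Perm (Fin 4)) : (D.pullback σ).pullback ρ = D.pullback (σ * ρ) := by
  obtain ⟨p, rfl⟩ := decMk_surjective D
  rfl

theorem Decoration.pullback_one {G : Type} [Group G] {H : Subgroup G} (D : Decoration H) :
    D.pullback 1 = D := by
  obtain ⟨p, rfl⟩ := decMk_surjective D
  rfl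

theorem pullback_pullback_of_mem {n : ℕ} {c : PtolemyFun n} (hc : c ∈ ptolemySet n)
    (σ ρ : Perm (Fin 4)) : (c.pullback σ).pullback ρ = c.pullback (σ * ρ) := by
  obtain ⟨D, hD, rfl⟩ := (bijOn_ptolemyOf n).surjOn hc
  rw [← ptolemyOf_pullback, ← ptolemyOf_pullback, D.pullback_pullback, ptolemyOf_pullback]

theorem pullback_one_of_mem {n : ℕ} {c : PtolemyFun n} (hc : c ∈ ptolemySet n) :
    c.pullback 1 = c := by
  obtain ⟨D, hD, rfl⟩ := (bijOn_ptolemyOf n).surjOn hc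
  rw [← ptolemyOf_pullback, D.pullback_one]

/-- The monomial map is equivariant; it is enough to check this for adjacent transpositions. -/
theorem mu_pullback {n : ℕ} {c : PtolemyFun n} (hc : c ∈ ptolemySet n) (ρ : Perm (Fin 4)) :
    mu (c.pullback ρ) = (mu c).pullback ρ := by
  have hρ : ρ ∈ Submonoid.closure
      (Set.range fun i : Fin 3 => swap i.castSucc i.succ) := by
    rw [Perm.mclosure_swap_castSucc_succ]; trivial
  revert c
  induction hρ using Submonoid.closure_induction with
  | mem σ hσ =>
    obtain ⟨k, rfl⟩ := hσ
    intro c hc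
    funext s e
    obtain ⟨j, hj⟩ := exists_edgePt e.2
    change muFun _ _ _ = muFun c.val (permPt _ s.1) (permPt _ e.1) ^ _
    rw [← hj, muFun_congr (g := fun t => blockSign (swap k.castSucc k.succ) t *
      c.val (permPt (swap k.castSucc k.succ) t)) fun e he => val_pullback _ c (sum_add_eq s.2 e he)]
    refine (muFun_swap (val_ne_zero hc.1) k s.1 j).trans ?_
    rw [Perm.sign_swap (by fin_cases k <;> decide)]
    simp
  | one =>
    intro c hc
    rw [pullback_one_of_mem hc, ShapeFun.pullback_one]
  | mul σ ρ _ _ h1 h2 =>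
    intro c hc
    rw [← pullback_pullback_of_mem hc, h2 (pullback_mem_ptolemySet hc σ), h1 hc,
      ShapeFun.pullback_pullback]

/-! ### Ptolemy assignments with given shapes -/

/-- The solution of the equations `μ(c)_s^{1100} = w_s` and of the Ptolemy relations, built layer by
layer in `t₂ + t₃ = k + l`. Inside a layer the points with `k, l > 0` come first: they
are determined by the Ptolemy relation. On the faces `l = 0` and `k = 0` the equation for the shape
gives the value at `(a + 1, b, k, l)` in terms of the one at `(a, b + 1, k, l)`, and
the remaining values are free; they are put equal to `1`. -/
noncomputable def layerFun (w : ℕ → ℕ → ℕ → ℕ → ℂ) : ℕ → ℕ → ℕ → ℕ → ℂ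
  | a, b, k + 1, l + 1 => (1 - w a b k l) * layerFun w (a + 1) b (k + 1) l *
      layerFun w a (b + 1) k (l + 1) / layerFun w (a + 1) (b + 1) k l
  | 0, _, _ + 1, 0 => 1
  | a + 1, b, k + 1, 0 => layerFun w (a + 1) b k 1 * layerFun w a (b + 1) (k + 1) 0 /
      (w a b k 0 * layerFun w a (b + 1) k 1)
  | 0, _, 0, _ + 2 => 1
  | a + 1, b, 0, l + 2 => w a b 0 (l + 1) * layerFun w (a + 1) b 1 (l + 1) *
      layerFun w a (b + 1) 0 (l + 2) / layerFun w a (b + 1) 1 (l + 1)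
  | _, _, 0, 1 => 1
  | _, _, 0, 0 => 1
termination_by a _ k l =>
  (k + l, (if k = 0 then (if l ≤ 1 then 0 else 1) else if l = 0 then 1 else 0), a)
decreasing_by
  all_goals
    simp only [Prod.lex_def]
    split_ifs <;> simp at * <;> omega

theorem layerFun_ne_zero {w : ℕ → ℕ → ℕ → ℕ → ℂ} (h0 : ∀ a b k l, w a b k l ≠ 0)
    (h1 : ∀ a b k l, w a b k l ≠ 1) (a b k l : ℕ) : layerFun w a b k l ≠ 0 := by
  induction a, b, k, l using layerFun.induct with
  | case1 a b k l ih1 ih2 ih3 =>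
    rw [layerFun]
    exact div_ne_zero (mul_ne_zero (mul_ne_zero (sub_ne_zero.2 (h1 _ _ _ _).symm) ih1) ih2) ih3
  | case2 b k => rw [layerFun]; exact one_ne_zero
  | case3 a b k ih1 ih2 ih3 =>
    rw [layerFun]
    exact div_ne_zero (mul_ne_zero ih1 ih2) (mul_ne_zero (h0 _ _ _ _) ih3)
  | case4 b l => rw [layerFun]; exact one_ne_zero
  | case5 a b l ih1 ih2 ih3 =>
    rw [layerFun]
    exact div_ne_zero (mul_ne_zero (mul_ne_zero (h0 _ _ _ _) ih1) ih2) ih3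
  | case6 a b => rw [layerFun]; exact one_ne_zero
  | case7 a b => rw [layerFun]; exact one_ne_zero

theorem layerFun_vertex (w : ℕ → ℕ → ℕ → ℕ → ℂ) (m : ℕ) (i : Fin 4) (t : Fin 4 → ℕ)
    (ht : t = Pi.single i m) : layerFun w (t 0) (t 1) (t 2) (t 3) = 1 := by
  subst ht
  rcases m with _ | _ | m <;> fin_cases i <;> simp [layerFun]

/-- A tuple of non-zero numbers with prescribed cross-ratio `w` at `1100` which satisfies the Ptolemy
relation realizes all six shapes of a subsimplex. -/
theorem muFun_eq_val {n : ℕ} {z : ShapeFun n} (hz : IsShapeAssignment z) {f : (Fin 4 → ℕ) → ℂ}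
    (hf : ∀ t, f t ≠ 0) {s : Fin 4 → ℕ} (hs : ∑ i, s i + 2 = n)
    (hP : f (s + ![1, 0, 0, 1]) * f (s + ![0, 1, 1, 0]) +
      f (s + ![1, 1, 0, 0]) * f (s + ![0, 0, 1, 1]) =
      f (s + ![1, 0, 1, 0]) * f (s + ![0, 1, 0, 1]))
    (hR : muFun f s ![1, 1, 0, 0] = z.val s ![1, 1, 0, 0]) (j : Fin 6) :
    muFun f s (edgePt j) = z.val s (edgePt j) := by
  obtain ⟨⟨a1, a2⟩, ⟨b1, b2⟩, ⟨c1, c2⟩⟩ := hz.2 ⟨s, hs⟩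
  change z.val s _ = z.val s _ at a1 b1 c1
  change z.val s _ = 1 / (1 - z.val s _) at a2 b2 c2
  have h1 := hf (s + ![1, 0, 0, 1])
  have h2 := hf (s + ![0, 1, 1, 0])
  have h3 := hf (s + ![1, 1, 0, 0])
  have h4 := hf (s + ![0, 0, 1, 1])
  have h5 := hf (s + ![1, 0, 1, 0])
  have h6 := hf (s + ![0, 1, 0, 1])
  have k0 : muFun f s ![0, 0, 1, 1] = z.val s ![0, 0, 1, 1] := by
    rw [a1, ← hR, muFun_0011, muFun_1100]
  have k1 : muFun f s ![1, 0, 0, 1] = z.val s ![1, 0, 0, 1] := by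
    have e : 1 - muFun f s ![0, 0, 1, 1] = f (s + ![1, 1, 0, 0]) * f (s + ![0, 0, 1, 1]) /
        (f (s + ![1, 0, 1, 0]) * f (s + ![0, 1, 0, 1])) := by
      rw [muFun_0011]
      field_simp
      linear_combination -hP
    rw [b2, ← k0, e, muFun_1001]
    field_simp
  have k2 : muFun f s ![0, 1, 1, 0] = z.val s ![0, 1, 1, 0] := by
    rw [b1, ← k1, muFun_0110, muFun_1001]
  have k3 : muFun f s ![1, 0, 1, 0] = z.val s ![1, 0, 1, 0] := by
    have e : 1 - muFun f s ![0, 1, 1, 0] = -(f (s + ![1, 0, 0, 1]) * f (s + ![0, 1, 1, 0])) /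
        (f (s + ![1, 1, 0, 0]) * f (s + ![0, 0, 1, 1])) := by
      rw [muFun_0110]
      field_simp
      linear_combination hP
    rw [c2, ← k2, e, muFun_1010]
    field_simp
  have k4 : muFun f s ![0, 1, 0, 1] = z.val s ![0, 1, 0, 1] := by
    rw [c1, ← k3, muFun_0101, muFun_1010]
  fin_cases j
  · exact hR
  · exact k0
  · exact k2
  · exact k1
  · exact k4
  · exact k3

/-- The shape parameter `z_s^{1100}`. Outside of the simplex its value is `2`, so that it is never `0`
or `1`. -/
noncomputable def shapeW {n : ℕ} (z : ShapeFun n) (a b k l : ℕ) : ℂ :=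
  if a + b + k + l + 2 = n then z.val ![a, b, k, l] ![1, 1, 0, 0] else 2

theorem shapeW_ne {n : ℕ} {z : ShapeFun n} (hz : IsShapeAssignment z) (a b k l : ℕ) :
    shapeW z a b k l ≠ 0 ∧ shapeW z a b k l ≠ 1 := by
  unfold shapeW
  split_ifs with h
  · have hs : ∑ i, ![a, b, k, l] i + 2 = n := by
      rw [Fin.sum_univ_four]; exact h
    have := hz.1 ⟨_, hs⟩ ⟨_, edgePt_spec 0⟩
    rw [ShapeFun.val, dif_pos ⟨hs, edgePt_spec 0⟩]
    exact this
  · norm_num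

/-- `layerFun` as a function on `ℕ⁴`. -/
noncomputable def layerPt {n : ℕ} (z : ShapeFun n) (t : Fin 4 → ℕ) : ℂ :=
  layerFun (shapeW z) (t 0) (t 1) (t 2) (t 3)

/-- The layers are built by solving the Ptolemy relation with the prescribed value of the shape, so it
holds as soon as that value is attained. -/
theorem layerPt_ptolemy {n : ℕ} {z : ShapeFun n} (hz : IsShapeAssignment z) (s : Fin 4 → ℕ)
    (hR : muFun (layerPt z) s ![1, 1, 0, 0] = shapeW z (s 0) (s 1) (s 2) (s 3)) :
    layerPt z (s + ![1, 0, 0, 1]) * layerPt z (s + ![0, 1, 1, 0]) +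
      layerPt z (s + ![1, 1, 0, 0]) * layerPt z (s + ![0, 0, 1, 1]) =
      layerPt z (s + ![1, 0, 1, 0]) * layerPt z (s + ![0, 1, 0, 1]) := by
  have hf : ∀ t, layerPt z t ≠ 0 := fun t =>
    layerFun_ne_zero (fun a b k l => (shapeW_ne hz a b k l).1)
      (fun a b k l => (shapeW_ne hz a b k l).2) _ _ _ _
  have h3 := hf (s + ![1, 1, 0, 0])
  have h5 := hf (s + ![1, 0, 1, 0])
  have h6 := hf (s + ![0, 1, 0, 1])
  have key : layerPt z (s + ![0, 0, 1, 1]) = (1 - shapeW z (s 0) (s 1) (s 2) (s 3)) *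
      layerPt z (s + ![1, 0, 1, 0]) * layerPt z (s + ![0, 1, 0, 1]) /
        layerPt z (s + ![1, 1, 0, 0]) := by
    change layerFun (shapeW z) (s 0) (s 1) (s 2 + 1) (s 3 + 1) = _
    rw [layerFun]
    rfl
  rw [key, ← hR, muFun_1100]
  field_simp
  ring

/-- The shape equation holds for all subsimplices: away from the faces it follows from the gluing
equation at the interior point `s + 1100`, by induction on the layer. -/
theorem layerPt_shape {n : ℕ} {z : ShapeFun n} (hz : z ∈ shapeSet n) :
    ∀ m, ∀ s : Fin 4 → ℕ, s 2 + s 3 = m → ∑ i, s i + 2 = n →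
      muFun (layerPt z) s ![1, 1, 0, 0] = z.val s ![1, 1, 0, 0] := by
  have hf : ∀ t, layerPt z t ≠ 0 := fun t =>
    layerFun_ne_zero (fun a b k l => (shapeW_ne hz.1 a b k l).1)
      (fun a b k l => (shapeW_ne hz.1 a b k l).2) _ _ _ _
  have hw : ∀ s : Fin 4 → ℕ, ∑ i, s i + 2 = n →
      shapeW z (s 0) (s 1) (s 2) (s 3) = z.val s ![1, 1, 0, 0] := by
    intro s hs
    rw [Fin.sum_univ_four] at hs
    rw [shapeW, if_pos hs]
    congr 1
    funext i
    fin_cases i <;> rfl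
  intro m
  induction m using Nat.strong_induction_on with
  | _ m ih =>
  intro s hm hs
  by_cases h3 : s 3 = 0
  · have h1 := hf (s + ![0, 1, 0, 1])
    have h2 := hf (s + ![1, 0, 1, 0])
    have h4 := hf (s + ![1, 0, 0, 1])
    have h5 := hf (s + ![0, 1, 1, 0])
    have hw0 := (shapeW_ne hz.1 (s 0) (s 1) (s 2) (s 3)).1
    have key : layerPt z (s + ![1, 0, 1, 0]) = layerPt z (s + ![1, 0, 0, 1]) *
        layerPt z (s + ![0, 1, 1, 0]) / (shapeW z (s 0) (s 1) (s 2) (s 3) *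
          layerPt z (s + ![0, 1, 0, 1])) := by
      change layerFun (shapeW z) (s 0 + 1) (s 1) (s 2 + 1) (s 3) =
        layerFun (shapeW z) (s 0 + 1) (s 1) (s 2) (s 3 + 1) *
          layerFun (shapeW z) (s 0) (s 1 + 1) (s 2 + 1) (s 3) / (_ *
          layerFun (shapeW z) (s 0) (s 1 + 1) (s 2) (s 3 + 1))
      rw [h3, layerFun]
    rw [muFun_1100, key, ← hw s hs]
    field_simp
  by_cases h2 : s 2 = 0
  · obtain ⟨l, hl⟩ := Nat.exists_eq_succ_of_ne_zero h3
    have h1 := hf (s + ![0, 1, 1, 0])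
    have h4 := hf (s + ![1, 0, 1, 0])
    have h5 := hf (s + ![0, 1, 0, 1])
    have key : layerPt z (s + ![1, 0, 0, 1]) = shapeW z (s 0) (s 1) (s 2) (s 3) *
        layerPt z (s + ![1, 0, 1, 0]) * layerPt z (s + ![0, 1, 0, 1]) /
          layerPt z (s + ![0, 1, 1, 0]) := by
      change layerFun (shapeW z) (s 0 + 1) (s 1) (s 2) (s 3 + 1) =
        _ * layerFun (shapeW z) (s 0 + 1) (s 1) (s 2 + 1) (s 3) *
          layerFun (shapeW z) (s 0) (s 1 + 1) (s 2) (s 3 + 1) /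
          layerFun (shapeW z) (s 0) (s 1 + 1) (s 2 + 1) (s 3)
      rw [h2, hl, layerFun.eq_5]
    rw [muFun_1100, key, ← hw s hs]
    field_simp
  -- Five of the six factors of the gluing equation at `u + 1111 = s + 1100` belong to lower layers.
  let u : Fin 4 → ℕ := ![s 0, s 1, s 2 - 1, s 3 - 1]
  have hsu : u + ![0, 0, 1, 1] = s := by
    funext i
    fin_cases i <;> simp [u] <;> omega
  have hu : ∑ i, u i + 4 = n := by
    rw [← hs, Fin.sum_univ_four, Fin.sum_univ_four]
    change s 0 + s 1 + (s 2 - 1) + (s 3 - 1) + 4 = _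
    omega
  have hu2 : u 2 = s 2 - 1 := rfl
  have hu3 : u 3 = s 3 - 1 := rfl
  have hsum : ∑ i, (u + ![1, 1, 1, 1] : Fin 4 → ℕ) i = n := by
    simp only [Pi.add_apply, Finset.sum_add_distrib]
    rw [← hu]
    rfl
  have hlt : ∀ i, (u + ![1, 1, 1, 1] : Fin 4 → ℕ) i < n := by
    intro i
    rw [← hsum]
    refine Finset.single_lt_sum (j := i + 1) (by fin_cases i <;> decide) (Finset.mem_univ _)
      (Finset.mem_univ _) ?_ fun _ _ _ => Nat.zero_le _
    fin_cases i <;> simp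
  have hg := hz.2 ⟨u + ![1, 1, 1, 1], hsum, fun i => (hlt i).ne⟩ fun i => by
    change u i + ![1, 1, 1, 1] i ≠ 0
    fin_cases i <;> simp
  change shapeProd z (u + ![1, 1, 1, 1]) = 1 at hg
  rw [shapeProd_interior z hu] at hg
  have key : ∀ e : Fin 4 → ℕ, ∑ i, e i = 2 → e 2 + e 3 < 2 → ∀ j,
      muFun (layerPt z) (u + e) (edgePt j) = z.val (u + e) (edgePt j) := by
    intro e he he2 j
    have hs' : ∑ i, (u + e) i + 2 = n := by
      simp only [Pi.add_apply, Finset.sum_add_distrib]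
      omega
    have hR := ih ((u + e) 2 + (u + e) 3) (by simp only [Pi.add_apply]; omega) (u + e) rfl hs'
    exact muFun_eq_val hz.1 hf hs' (layerPt_ptolemy hz.1 _ (hR.trans (hw _ hs').symm)) hR j
  have hM := muFun_interior hf u
  have k1 := key ![1, 1, 0, 0] (by decide) (by decide) 1
  have k2 := key ![1, 0, 0, 1] (by decide) (by decide) 2
  have k3 := key ![0, 1, 1, 0] (by decide) (by decide) 3
  have k4 := key ![1, 0, 1, 0] (by decide) (by decide) 4
  have k5 := key ![0, 1, 0, 1] (by decide) (by decide) 5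
  simp only [edgePt, Matrix.cons_val] at k1 k2 k3 k4 k5
  rw [← hg, k1, k2, k3, k4, k5] at hM
  have ne : ∀ e : Fin 4 → ℕ, ∑ i, e i = 2 → e 2 + e 3 < 2 → ∀ j,
      z.val (u + e) (edgePt j) ≠ 0 := fun e he he2 j => key e he he2 j ▸ muFun_ne_zero hf _ _
  have n1 := ne ![1, 1, 0, 0] (by decide) (by decide) 1
  have n2 := ne ![1, 0, 0, 1] (by decide) (by decide) 2
  have n3 := ne ![0, 1, 1, 0] (by decide) (by decide) 3
  have n4 := ne ![1, 0, 1, 0] (by decide) (by decide) 4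
  have n5 := ne ![0, 1, 0, 1] (by decide) (by decide) 5
  simp only [edgePt, Matrix.cons_val] at n1 n2 n3 n4 n5
  rw [← hsu]
  -- both products around the interior point are `1`, and these five factors agree
  have := mul_right_cancel₀ n5 hM
  have := mul_right_cancel₀ n4 this
  have := mul_right_cancel₀ n3 this
  have := mul_right_cancel₀ n2 this
  exact mul_right_cancel₀ n1 this

/-- The map `μ` is surjective. -/
theorem exists_mu_eq {n : ℕ} {z : ShapeFun n} (hz : z ∈ shapeSet n) :
    ∃ c ∈ ptolemySet n, mu c = z := by
  have hf : ∀ t, layerPt z t ≠ 0 := fun t =>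
    layerFun_ne_zero (fun a b k l => (shapeW_ne hz.1 a b k l).1)
      (fun a b k l => (shapeW_ne hz.1 a b k l).2) _ _ _ _
  let c : PtolemyFun n := fun t => layerPt z t.1
  have hc : ∀ t : Fin 4 → ℕ, ∑ i, t i = n → c.val t = layerPt z t := by
    intro t ht
    by_cases h : ∀ i, t i ≠ n
    · rw [PtolemyFun.val, dif_pos ⟨ht, h⟩]
    · push Not at h
      obtain ⟨i, hi⟩ := h
      rw [PtolemyFun.val, dif_neg fun h => h.2 i hi]
      exact (layerFun_vertex _ n i t (by
        funext j
        by_cases hj : j = i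
        · rw [hj, Pi.single_eq_same, hi]
        · rw [Pi.single_eq_of_ne hj, eq_single_of_sum ht hi hj])).symm
  have hR := fun s => layerPt_shape hz _ s rfl
  have hP : ∀ s : Fin 4 → ℕ, ∑ i, s i + 2 = n → _ := fun s hs =>
    layerPt_ptolemy hz.1 s ((hR s hs).trans (by
      rw [shapeW, if_pos (by rwa [Fin.sum_univ_four] at hs)]
      congr 1
      funext i
      fin_cases i <;> rfl))
  refine ⟨c, ⟨fun t => hf _, fun s => ?_⟩, ?_⟩
  · have h := hP s.1 s.2
    rw [hc _ (sum_add_eq s.2 _ (by decide)), hc _ (sum_add_eq s.2 _ (by decide)),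
      hc _ (sum_add_eq s.2 _ (by decide)), hc _ (sum_add_eq s.2 _ (by decide)),
      hc _ (sum_add_eq s.2 _ (by decide)), hc _ (sum_add_eq s.2 _ (by decide))]
    exact h
  · funext s e
    obtain ⟨j, hj⟩ := exists_edgePt e.2
    refine Eq.trans ?_ (z.val_eq s e)
    rw [mu_eq, ← hj,
      muFun_congr (g := layerPt z) fun e he => hc _ (sum_add_eq s.2 e he)]
    exact muFun_eq_val hz.1 hf s.2 (hP s.1 s.2) (hR s.1 s.2) j

/-! ### Factorizations of unipotent matrices -/

/-- Moving a diagonal matrix past `x_i(t)`; only the two entries of `D` numbered `i - 1` and `i` matter. -/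
theorem hMat_mul_xMat {n i : ℕ} {s t : ℂ} {D : Fin n → ℂ}
    (h : ∀ r q : Fin n, (r : ℕ) + 1 = i → (q : ℕ) = i → D r * s = t * D q) :
    xMat n i t * diagonal D = diagonal D * xMat n i s := by
  ext r q
  rw [xMat, xMat, Matrix.add_mul, Matrix.mul_add, Matrix.add_apply, Matrix.add_apply,
    Matrix.one_mul, Matrix.mul_one, Matrix.mul_diagonal, Matrix.diagonal_mul, Matrix.of_apply,
    Matrix.of_apply]
  congr 1
  split_ifs with h'
  · exact (h r q h'.1 (by omega)).symm
  · simp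

theorem list_xMat_mul_diagonal {n : ℕ} (l : List ℕ) {s t : ℕ → ℂ} {D : Fin n → ℂ}
    (h : ∀ i ∈ l, ∀ r q : Fin n, (r : ℕ) + 1 = i → (q : ℕ) = i → D r * s i = t i * D q) :
    (l.map fun i => xMat n i (t i)).prod * diagonal D =
      diagonal D * (l.map fun i => xMat n i (s i)).prod := by
  induction l with
  | nil => simp
  | cons a l ih =>
    simp only [List.map_cons, List.prod_cons]
    rw [Matrix.mul_assoc, ih fun i hi => h i (List.mem_cons_of_mem _ hi), ← Matrix.mul_assoc,
      hMat_mul_xMat (h a (List.mem_cons_self ..)), Matrix.mul_assoc]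

/-- The entry of `∏_{i ≤ m} H_i(f_i)` in row `r`, counted from `0`, is the product of the `f_i` with `i > r`. -/
theorem prod_hMat (n m : ℕ) (f : ℕ → ℂ) :
    ((List.range' 1 m).map fun i => hMat n i (f i)).prod =
      diagonal fun r : Fin n => ∏ i ∈ Finset.Ioc (r : ℕ) m, f i := by
  induction m with
  | zero => simp
  | succ m ih =>
    rw [List.range'_concat, List.map_append, List.prod_append, ih, List.map_singleton,
      List.prod_singleton, one_mul, hMat, Matrix.diagonal_mul_diagonal, add_comm 1 m]
    congr 1
    funext r
    split_ifs with h
    · rw [Finset.prod_Ioc_succ_top (by omega)]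
    · rw [Finset.Ioc_eq_empty (by omega), Finset.Ioc_eq_empty (by omega)]
      simp

section

variable (n : ℕ) (d : ℕ → ℕ → ℂ)

/-- Moving diagonal matrices through the product `∏_k ∏_i x_i(d_{k,i})`: conjugation
by `T_k = ∏_i H_i(d_{k,i})` normalizes the `k`-th inner product, and `T_k⁻¹ T_{k+1}` contributes the
ratios `d_{k+1,i} / d_{k,i}` and one factor which commutes with everything that follows. -/
theorem prod_xMat_factor (hd : ∀ k i, 1 ≤ k → 1 ≤ i → i + k ≤ n → d k i ≠ 0) (m k : ℕ)
    (hk : 1 ≤ k) (hkm : k + m = n) :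
    ((List.range' k m).map fun k =>
        ((List.range' 1 (n - k)).map fun i => xMat n i (d k i)).prod).prod *
      (diagonal fun r : Fin n => ∏ i ∈ Finset.Ioc (r : ℕ) (n - k), d (n - i) i) =
    (diagonal fun r : Fin n => ∏ i ∈ Finset.Ioc (r : ℕ) (n - k), d k i) *
      ((List.range' k m).map fun k =>
        ((List.range' 1 (n - k)).map fun i => xMat n i 1).prod *
        (diagonal fun r : Fin n => ∏ i ∈ Finset.Ioc (r : ℕ) (n - k - 1), d (k + 1) i / d k i)).prod
    := by
  induction m generalizing k with
  | zero =>
    have : n - k = 0 := by omega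
    simp [this]
  | succ m ih =>
    have ih := ih (k + 1) (by omega) (by omega)
    have e1 : n - k = m + 1 := by omega
    have e2 : n - (k + 1) = m := by omega
    have e3 : n - (m + 1) = k := by omega
    rw [List.range'_succ, List.map_cons, List.map_cons, List.prod_cons, List.prod_cons]
    set W := ((List.range' (k + 1) m).map fun k =>
        ((List.range' 1 (n - k)).map fun i => xMat n i (d k i)).prod).prod
    set F : ℕ → Matrix (Fin n) (Fin n) ℂ := fun k =>
        ((List.range' 1 (n - k)).map fun i => xMat n i 1).prod *
        (diagonal fun r : Fin n => ∏ i ∈ Finset.Ioc (r : ℕ) (n - k - 1), d (k + 1) i / d k i)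
      with hF
    set h : Matrix (Fin n) (Fin n) ℂ := hMat n (m + 1) (d k (m + 1)) with hh
    have hE : (diagonal fun r : Fin n => ∏ i ∈ Finset.Ioc (r : ℕ) (n - k), d (n - i) i) =
        (diagonal fun r : Fin n => ∏ i ∈ Finset.Ioc (r : ℕ) (n - (k + 1)), d (n - i) i) * h := by
      rw [hh, hMat, Matrix.diagonal_mul_diagonal, e1, e2]
      congr 1
      funext r
      split_ifs with hr
      · rw [Finset.prod_Ioc_succ_top (by omega), e3]
      · rw [Finset.Ioc_eq_empty (by omega), Finset.Ioc_eq_empty (by omega)]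
        simp
    have hcomm : Commute h ((List.range' (k + 1) m).map F).prod := by
      refine Commute.list_prod_right _ _ fun x hx => ?_
      obtain ⟨j, hj, rfl⟩ := List.mem_map.1 hx
      rw [List.mem_range'_1] at hj
      refine Commute.mul_right ?_ ?_
      · refine (list_xMat_mul_diagonal _ fun i hi r q hr hq => ?_).symm
        rw [List.mem_range'_1] at hi
        rw [if_pos (by omega), if_pos (by omega), mul_comm]
      · rw [hh, hMat]
        exact Matrix.commute_diagonal _ _
    have hT : (diagonal fun r : Fin n => ∏ i ∈ Finset.Ioc (r : ℕ) (n - (k + 1)), d (k + 1) i) * h =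
        (diagonal fun r : Fin n => ∏ i ∈ Finset.Ioc (r : ℕ) (n - k), d k i) *
        (diagonal fun r : Fin n =>
          ∏ i ∈ Finset.Ioc (r : ℕ) (n - k - 1), d (k + 1) i / d k i) := by
      rw [hh, hMat, Matrix.diagonal_mul_diagonal, Matrix.diagonal_mul_diagonal, e1, e2,
        Nat.add_sub_cancel]
      congr 1
      funext r
      split_ifs with hr
      · have hne : ∏ i ∈ Finset.Ioc (r : ℕ) m, d k i ≠ 0 := by
          refine Finset.prod_ne_zero_iff.2 fun i hi => ?_
          rw [Finset.mem_Ioc] at hi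
          exact hd k i hk (by omega) (by omega)
        rw [Finset.prod_Ioc_succ_top (by omega), Finset.prod_div_distrib]
        field_simp
      · rw [Finset.Ioc_eq_empty (by omega), Finset.Ioc_eq_empty (by omega)]
        simp
    have hA : ((List.range' 1 (n - k)).map fun i => xMat n i (d k i)).prod *
        (diagonal fun r : Fin n => ∏ i ∈ Finset.Ioc (r : ℕ) (n - k), d k i) =
        (diagonal fun r : Fin n => ∏ i ∈ Finset.Ioc (r : ℕ) (n - k), d k i) *
          ((List.range' 1 (n - k)).map fun i => xMat n i 1).prod := by
      refine list_xMat_mul_diagonal _ fun i hi r q hr hq => ?_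
      rw [List.mem_range'_1] at hi
      have : Finset.Ioc (r : ℕ) (n - k) = insert i (Finset.Ioc (q : ℕ) (n - k)) := by
        ext x
        simp only [Finset.mem_Ioc, Finset.mem_insert]
        omega
      rw [this, Finset.prod_insert (by simp; omega), mul_one]
    calc _ = ((List.range' 1 (n - k)).map fun i => xMat n i (d k i)).prod *
          (W * (diagonal fun r : Fin n =>
            ∏ i ∈ Finset.Ioc (r : ℕ) (n - (k + 1)), d (n - i) i)) * h := by
          rw [hE]; simp only [Matrix.mul_assoc]
      _ = ((List.range' 1 (n - k)).map fun i => xMat n i (d k i)).prod *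
          ((diagonal fun r : Fin n => ∏ i ∈ Finset.Ioc (r : ℕ) (n - (k + 1)), d (k + 1) i) *
          (((List.range' (k + 1) m).map F).prod * h)) := by
          rw [ih]; simp only [Matrix.mul_assoc]
      _ = ((List.range' 1 (n - k)).map fun i => xMat n i (d k i)).prod *
          (((diagonal fun r : Fin n => ∏ i ∈ Finset.Ioc (r : ℕ) (n - (k + 1)), d (k + 1) i) * h) *
          ((List.range' (k + 1) m).map F).prod) := by
          rw [← hcomm.eq]; simp only [Matrix.mul_assoc]
      _ = _ := by
          rw [hT]
          rw [← Matrix.mul_assoc, ← Matrix.mul_assoc, hA]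
          simp only [Matrix.mul_assoc]

end

theorem tauMat_eq {n : ℕ} (c : PtolemyFun n) (π : Perm (Fin 4)) : tauMat c π =
    diagonal fun r : Fin n => ∏ i ∈ Finset.Ioc (r : ℕ) (n - 1), diamondAt c π 1 i :=
  prod_hMat _ _ _

theorem tauMat_pullback {n : ℕ} (c : PtolemyFun n) (π : Perm (Fin 4)) :
    tauMat (c.pullback π) 1 = tauMat c π := by
  rw [tauMat_eq, tauMat_eq]
  congr 1
  funext r
  refine Finset.prod_congr rfl fun i hi => ?_
  rw [Finset.mem_Ioc] at hi
  exact diamondAt_pullback π c le_rfl (by omega) (by omega)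

theorem diamondAt_ne_zero {n : ℕ} {c : PtolemyFun n} (hc : ∀ t, c t ≠ 0) (π : Perm (Fin 4))
    (k i : ℕ) : diamondAt c π k i ≠ 0 := by
  have := val_ne_zero hc
  have ho : orderSign (π 0) (π 1) (π 2) ≠ 0 := by
    unfold orderSign
    split_ifs <;> simp
  simp [diamondAt, diamond, this, ho]

/-- The diamond coordinates along the edge from the first to the third vertex of a face, for the two
orders of the last two vertices; the sign is that of their transposition. -/
theorem diamondAt_sM {n : ℕ} (c : PtolemyFun n) (i : ℕ) :
    diamondAt c sM 1 i = -diamondAt c 1 (n - i) i := by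
  have e : n - i - (n - i) = 0 := by omega
  have h : ∀ a b b', comb 0 2 1 a b b' = comb 0 1 2 a b' b := fun a b b' => by
    simp only [comb, add_assoc]
    rw [add_comm (Pi.single (2 : Fin 4) b : Fin 4 → ℕ)]
  simp only [diamondAt, diamond, sM_zero, sM_one, sM_two, Perm.coe_one, id, e, h, Nat.sub_self]
  have o1 : orderSign 0 1 2 = 1 := by simp [orderSign]
  have o2 : orderSign 0 2 1 = -1 := by simp [orderSign]
  rw [o1, o2, mul_comm (c.val (_ + comb 0 1 2 1 0 1))]
  ring

/-- The ratio of two neighbouring diamond coordinates is an `X`-coordinate. -/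
theorem xCoord_mu {n : ℕ} {c : PtolemyFun n} (hc : ∀ t, c t ≠ 0) {k i : ℕ} (hk : 1 ≤ k)
    (hi : 1 ≤ i) (h : i + k + 1 ≤ n) :
    xCoord (mu c) (comb 0 1 2 i (n - k - i) k) = diamondAt c 1 (k + 1) i / diamondAt c 1 k i := by
  obtain ⟨a, rfl⟩ : ∃ a, i = a + 1 := ⟨i - 1, by omega⟩
  obtain ⟨e, rfl⟩ : ∃ e, k = e + 1 := ⟨k - 1, by omega⟩
  obtain ⟨b, hb⟩ : ∃ b, a + b + e + 3 = n := ⟨n - 3 - a - e, by omega⟩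
  have e1 : n - (e + 1) - (a + 1) = b + 1 := by omega
  have e2 : n - (a + 1) - (e + 1) = b + 1 := by omega
  have e3 : n - (a + 1) - (e + 1 + 1) = b := by omega
  have hf := val_ne_zero hc
  have o1 : orderSign 0 1 2 = 1 := by simp [orderSign]
  have hu : ∑ i, ![a, b, e, 0] i + 3 = n := by
    rw [Fin.sum_univ_four]
    simpa using hb
  have hv : comb 0 1 2 (a + 1) (b + 1) (e + 1) = ![a, b, e, 0] + ![1, 1, 1, 0] := by
    rw [comb_std]
    funext i
    fin_cases i <;> rfl
  have hs : ∀ x : Fin 4 → ℕ, ∑ i, x i = 1 → ∑ i, (![a, b, e, 0] + x) i + 2 = n := by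
    intro x hx
    have : ∑ i, (![a, b, e, 0] + x) i = ∑ i, ![a, b, e, 0] i + ∑ i, x i :=
      Finset.sum_add_distrib
    omega
  have k0 := val_mu c (hs ![0, 0, 1, 0] (by decide)) 0
  have k1 := val_mu c (hs ![1, 0, 0, 0] (by decide)) 2
  have k2 := val_mu c (hs ![0, 1, 0, 0] (by decide)) 5
  simp only [edgePt, Matrix.cons_val] at k0 k1 k2
  rw [xCoord, e1, hv, shapeProd_face _ rfl hu, k0, k1, k2, muFun_1100, muFun_0110, muFun_1010]
  simp only [diamondAt, diamond, Perm.coe_one, id, e2, e3, o1, Nat.add_sub_cancel,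
    comb_std]
  simp only [Matrix.add_cons, Matrix.head_cons, Matrix.tail_cons, Matrix.empty_add_empty, add_zero,
    zero_add, add_assoc, Nat.reduceAdd]
  field_simp
  rw [div_eq_div_iff (by simp [hf]) (by simp [hf])]
  ring

/-! ### Classes of matrices in the projective linear group -/

theorem isClassOf_pcl {n : ℕ} (g : GLn n) : IsClassOf (pcl g) g.1 := ⟨g, rfl, rfl⟩

theorem isClassOf_slToPGL {n : ℕ} (g : SLn n) : IsClassOf (slToPGL g) g.1 :=
  ⟨Matrix.SpecialLinearGroup.toGL g, rfl, rfl⟩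

theorem exists_isClassOf {n : ℕ} {M : Matrix (Fin n) (Fin n) ℂ} (h : M.det ≠ 0) :
    ∃ x : PGLn n, IsClassOf x M :=
  ⟨_, Matrix.GeneralLinearGroup.mkOfDetNeZero M h, rfl, rfl⟩

section

variable {n : ℕ} {x y : PGLn n} {A A' : Matrix (Fin n) (Fin n) ℂ}

theorem IsClassOf.det_ne_zero (h : IsClassOf x A) : A.det ≠ 0 := by
  obtain ⟨g, rfl, -⟩ := h
  exact ((Matrix.isUnit_iff_isUnit_det _).1 g.isUnit).ne_zero

theorem IsClassOf.mul (h : IsClassOf x A) (h' : IsClassOf y A') : IsClassOf (x * y) (A * A') := by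
  obtain ⟨g, rfl, rfl⟩ := h
  obtain ⟨g', rfl, rfl⟩ := h'
  exact ⟨g * g', rfl, map_mul _ _ _⟩

theorem IsClassOf.eq (h : IsClassOf x A) (h' : IsClassOf y A') {c : ℂ} (hc : c ≠ 0)
    (hA : A' = c • A) : x = y := by
  obtain ⟨g, rfl, rfl⟩ := h
  obtain ⟨g', hg', rfl⟩ := h'
  refine Matrix.ProjGenLinGroup.mk_eq_mk_iff.2 ⟨Units.mk0 c hc, ?_⟩
  apply Units.ext
  rw [hg', hA]
  ext i j
  simp [mul_comm]

theorem IsClassOf.exists_smul (h : IsClassOf x A) (h' : IsClassOf x A') :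
    ∃ c : ℂ, c ≠ 0 ∧ A' = c • A := by
  obtain ⟨g, rfl, rfl⟩ := h
  obtain ⟨g', rfl, h⟩ := h'
  obtain ⟨u, hu⟩ := Matrix.ProjGenLinGroup.mk_eq_mk_iff.1 h.symm
  refine ⟨u, u.ne_zero, ?_⟩
  rw [← hu]
  ext i j
  simp [mul_comm]

theorem IsClassOf.inv_mul (h : IsClassOf x A) (h' : IsClassOf y A')
    {M : Matrix (Fin n) (Fin n) ℂ} (hM : A * M = A') : IsClassOf (x⁻¹ * y) M := by
  have hd : M.det ≠ 0 := by
    intro h0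
    apply h'.det_ne_zero
    rw [← hM, Matrix.det_mul, h0, mul_zero]
  obtain ⟨z, hz⟩ := exists_isClassOf hd
  have : x * z = y := (h.mul hz).eq h' one_ne_zero (by rw [hM, one_smul])
  rwa [← this, inv_mul_cancel_left]

theorem IsClassOf.mem_B_iff (h : IsClassOf x A) : x ∈ B n ↔ A.BlockTriangular id := by
  constructor
  · rintro ⟨g, hg, hx⟩
    obtain ⟨c, -, rfl⟩ := IsClassOf.exists_smul ⟨g, rfl, hx⟩ h
    intro i j hij
    rw [Matrix.smul_apply, hg hij, smul_zero]
  · obtain ⟨g, rfl, rfl⟩ := h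
    exact fun hA => ⟨g, hA, rfl⟩

theorem IsClassOf.mem_H {d : Fin n → ℂ} (h : IsClassOf x (diagonal d)) : x ∈ H n := by
  have hd : ∀ i, d i ≠ 0 := by
    have := h.det_ne_zero
    rw [Matrix.det_diagonal] at this
    exact fun i => Finset.prod_ne_zero_iff.1 this i (Finset.mem_univ i)
  obtain ⟨g, hg, rfl⟩ := h
  refine ⟨g, ⟨⟨d, fun i => (d i)⁻¹, ?_, ?_⟩, ?_⟩, rfl⟩
  · funext i; simp [hd i]
  · funext i; simp [hd i]
  · apply Units.ext
    exact hg.symm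

theorem IsClassOf.coset_eq (h : IsClassOf x A) (h' : IsClassOf y A')
    {U : Matrix (Fin n) (Fin n) ℂ} (hU : U.BlockTriangular id) (hM : A * U = A') :
    (x : PGLn n ⧸ B n) = (y : PGLn n ⧸ B n) :=
  QuotientGroup.eq.2 ((h.inv_mul h' hM).mem_B_iff.2 hU)

theorem IsClassOf.of_coset_eq (h : IsClassOf x A) (h' : IsClassOf y A')
    (he : (x : PGLn n ⧸ B n) = (y : PGLn n ⧸ B n)) :
    ∃ U : Matrix (Fin n) (Fin n) ℂ, U.BlockTriangular id ∧ A * U = A' := by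
  obtain ⟨g, rfl, rfl⟩ := h
  obtain ⟨g', rfl, rfl⟩ := h'
  have h1 : (g : Matrix (Fin n) (Fin n) ℂ) * ((g⁻¹ * g' : GLn n) : Matrix (Fin n) (Fin n) ℂ) =
      g' := by
    rw [← Units.val_mul, mul_inv_cancel_left]
  exact ⟨_, ((isClassOf_pcl g).inv_mul (isClassOf_pcl g') h1).mem_B_iff.1
    (QuotientGroup.eq.1 he), h1⟩

end

theorem q₁_counter (n : ℕ) : IsCounterDiagonal (q₁ n).1 := fun i j h => by
  change (if j = i.rev then (1 : ℂ) else 0) = 0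
  rw [if_neg h]

theorem q₁_apply_rev {n : ℕ} (i : Fin n) : (q₁ n).1 i i.rev = 1 := by
  change (if i.rev = i.rev then (1 : ℂ) else 0) = 1
  rw [if_pos rfl]

theorem q₁_mul_self (n : ℕ) : (q₁ n).1 * (q₁ n).1 = 1 := (q₁ n).3

/-! ### Three flags in general position -/

/-- `(p₀, p₁, p₂) = x (B, q₁B, n₋B)` with `n₋` normalized lower triangular. -/
def IsStdTriple {n : ℕ} (p₀ p₁ p₂ : PGLn n ⧸ B n) (x : PGLn n) : Prop :=
  p₀ = (x : PGLn n ⧸ B n) ∧ p₁ = ((x * pcl (q₁ n) : PGLn n) : PGLn n ⧸ B n) ∧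
    ∃ m : GLn n, IsNormalizedLower (m : Matrix (Fin n) (Fin n) ℂ) ∧
      p₂ = ((x * pcl m : PGLn n) : PGLn n ⧸ B n)

theorem IsStdTriple.smul {n : ℕ} {p₀ p₁ p₂ : PGLn n ⧸ B n} {x : PGLn n} (y : PGLn n)
    (h : IsStdTriple p₀ p₁ p₂ x) : IsStdTriple (y • p₀) (y • p₁) (y • p₂) (y * x) := by
  obtain ⟨h0, h1, m, hm, h2⟩ := h
  exact ⟨by rw [h0]; rfl, by rw [h1, mul_assoc]; rfl, m, hm, by rw [h2, mul_assoc]; rfl⟩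

/-- The stabilizer of `(B, q₁B)` is the diagonal torus, which acts freely on the normalized lower
triangular matrices modulo `B`. -/
theorem IsStdTriple.unique {n : ℕ} {p₀ p₁ p₂ : PGLn n ⧸ B n} {x x' : PGLn n}
    (h : IsStdTriple p₀ p₁ p₂ x) (h' : IsStdTriple p₀ p₁ p₂ x') : x = x' := by
  obtain ⟨h0, h1, m, hm, h2⟩ := h
  obtain ⟨h0', h1', m', hm', h2'⟩ := h'
  obtain ⟨a, rfl⟩ := Matrix.ProjGenLinGroup.mk_surjective x
  obtain ⟨a', rfl⟩ := Matrix.ProjGenLinGroup.mk_surjective x'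
  obtain ⟨A, hA, hA'⟩ := (isClassOf_pcl a').of_coset_eq (isClassOf_pcl a) (h0'.symm.trans h0)
  obtain ⟨U, hU, hU'⟩ := ((isClassOf_pcl a').mul (isClassOf_pcl (q₁ n))).of_coset_eq
    ((isClassOf_pcl a).mul (isClassOf_pcl (q₁ n))) (h1'.symm.trans h1)
  obtain ⟨W, hW, hW'⟩ := ((isClassOf_pcl a').mul (isClassOf_pcl m')).of_coset_eq
    ((isClassOf_pcl a).mul (isClassOf_pcl m)) (h2'.symm.trans h2)
  have hinj : ∀ M M' : Matrix (Fin n) (Fin n) ℂ, a'.1 * M = a'.1 * M' → M = M' := by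
    intro M M' h
    have := congrArg ((a'⁻¹ : GLn n).1 * ·) h
    simpa [← Matrix.mul_assoc] using this
  rw [← hA', Matrix.mul_assoc, Matrix.mul_assoc] at hU' hW'
  have hU2 := hinj _ _ hU'
  have hW2 := hinj _ _ hW'
  have hdiag : ∀ i j, i ≠ j → A i j = 0 := by
    intro i j hij
    rcases lt_or_gt_of_ne hij with hlt | hlt
    · have e := congrFun (congrFun hU2 i) j.rev
      rw [(q₁_counter n).mul_apply, (q₁_counter n).apply_mul, q₁_apply_rev, Fin.rev_rev] at e
      rw [q₁_apply_rev, one_mul, mul_one] at e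
      rw [← e]
      exact hU (Fin.rev_lt_rev.2 hlt)
    · exact hA hlt
  rcases Nat.eq_zero_or_pos n with rfl | hn
  · exact congrArg _ (Units.ext (Subsingleton.elim _ _))
  have hc : ∀ i, A i i = W ⟨0, hn⟩ ⟨0, hn⟩ := by
    intro i
    have e := congrFun (congrFun hW2 i) ⟨0, hn⟩
    rw [Matrix.mul_apply, Matrix.mul_apply, Finset.sum_eq_single ⟨0, hn⟩, Finset.sum_eq_single i,
      hm'.2.2 i _ rfl, hm.2.2 i _ rfl, one_mul, mul_one] at e
    · exact e.symm
    · intro k _ hk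
      rw [hdiag i k hk.symm, zero_mul]
    · simp
    · intro k _ hk
      rw [hW (show (⟨0, hn⟩ : Fin n) < k from
        Nat.pos_of_ne_zero fun h => hk (Fin.ext h)), mul_zero]
    · simp
  have hA1 : A = W ⟨0, hn⟩ ⟨0, hn⟩ • (1 : Matrix (Fin n) (Fin n) ℂ) := by
    ext i j
    by_cases hij : i = j
    · subst hij
      simp [hc]
    · simp [hdiag i j hij, hij]
  rw [hA1, Matrix.mul_smul, Matrix.mul_one] at hA'
  refine ((isClassOf_pcl a').eq (isClassOf_pcl a) (fun h0 => ?_) hA'.symm).symm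
  apply (isClassOf_pcl a).det_ne_zero
  have : Nonempty (Fin n) := ⟨⟨0, hn⟩⟩
  rw [← hA', h0, zero_smul]
  exact Matrix.det_zero

theorem flagFun_col_two {n : ℕ} (g : Fin 4 → Matrix (Fin n) (Fin n) ℂ) {a b : ℕ}
    (h : a + b + 2 = n) : flagFun g a b 1 (colv (g 2) 0) = 0 := by
  rw [flagFun, ldet_eq_zero, zero_div]
  · simp; omega
  · intro hn
    have := (List.nodup_append.1 hn).2.1
    exact (List.nodup_cons.1 this).1 (List.mem_append_right _ (colv_mem_cols _ one_pos))

/-- The diagonal matrix `∏_i H_i(d_{1,i})` is proportional to the first column of the third flag in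
the basis adapted to the first two. -/
theorem prod_diamondAt {n : ℕ} {g : Fin 4 → Matrix (Fin n) (Fin n) ℂ} (hg : IsGenericTuple g)
    (hd : ∀ i, (g i).det = 1) (m r : ℕ) (hr : r + m + 1 = n) :
    (∏ i ∈ Finset.Ioc r (n - 1), diamondAt (detCoords g) 1 1 i) *
      flagFun g (n - 1) 0 0 (colv (g 2) 0) = flagFun g r (n - 1 - r) 0 (colv (g 2) 0) := by
  induction m generalizing r with
  | zero =>
    obtain rfl : r = n - 1 := by omega
    simp
  | succ m ih =>
    have hI : Finset.Ioc r (n - 1) = insert (r + 1) (Finset.Ioc (r + 1) (n - 1)) := by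
      ext x
      simp only [Finset.mem_Ioc, Finset.mem_insert]
      omega
    have e1 : n - 1 - r = m + 1 := by omega
    have e2 : n - 1 - (r + 1) = m := by omega
    rw [hI, Finset.prod_insert (by simp), mul_assoc, ih (r + 1) (by omega), e1, e2,
      flagFun_sub hg (a := r) (b := m) (c := 0) (by omega), flagFun_col_two g (by omega), zero_add,
      ← diamondAt_std hd (by omega)]

theorem tauMat_apply {n : ℕ} {g : Fin 4 → Matrix (Fin n) (Fin n) ℂ} (hg : IsGenericTuple g)
    (hd : ∀ i, (g i).det = 1) : ∃ w : Fin n → ℂ, tauMat (detCoords g) 1 = diagonal w ∧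
      (∀ r, w r ≠ 0) ∧ ∀ r, w r * flagFun g (n - 1) 0 0 (colv (g 2) 0) =
        flagFun g r (n - 1 - r) 0 (colv (g 2) 0) := by
  refine ⟨_, tauMat_eq _ _, fun r => ?_, fun r => prod_diamondAt hg hd (n - 1 - r) r (by omega)⟩
  refine Finset.prod_ne_zero_iff.2 fun i _ => diamondAt_ne_zero (fun t => hg _ t.2.1) _ _ _

theorem flagFun_last_ne_zero {n : ℕ} (hn : 0 < n) {g : Fin 4 → Matrix (Fin n) (Fin n) ℂ}
    (hg : IsGenericTuple g) : flagFun g (n - 1) 0 0 (colv (g 2) 0) ≠ 0 := by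
  have h1 := hg.faceDet_ne_zero (a := n - 1) (b := 0) (c := 1) (by omega)
  have h2 := hg.faceDet_ne_zero (a := n - 1 + 1) (b := 0) (c := 0) (by omega)
  refine div_ne_zero ?_ h2
  simpa [faceDet, cols] using h1

/-- Three flags in general position are in standard position relative to `edgeMat g` followed by the
diagonal matrix of diamond coordinates. -/
theorem isStdTriple_of_edgeMat {n : ℕ} (hn : 0 < n) {g : Fin 4 → SLn n}
    (hg : IsGenericTuple fun i => (g i).1) {T : SLn n}
    (hT : (T⁻¹).1 = edgeMat fun i => (g i).1) {x : PGLn n}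
    (hx : IsClassOf x (T.1 * tauMat (detCoords fun i => (g i).1) 1)) :
    IsStdTriple (slToPGL (g 0) : PGLn n ⧸ B n) (slToPGL (g 1) : PGLn n ⧸ B n)
      (slToPGL (g 2) : PGLn n ⧸ B n) x := by
  have hd : ∀ i, ((fun i => (g i).1) i).det = 1 := fun i => (g i).2
  obtain ⟨w, hw, hw0, hwv⟩ := tauMat_apply hg hd
  rw [hw] at hx
  set G : Fin 4 → Matrix (Fin n) (Fin n) ℂ := fun i => (g i).1 with hG
  set R := edgeMat G with hR
  have hTR : T.1 * R = 1 := by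
    rw [← hT, ← Matrix.SpecialLinearGroup.coe_mul, mul_inv_cancel,
      Matrix.SpecialLinearGroup.coe_one]
  have hdiag : ∀ c : Fin n → ℂ, (∀ r, c r ≠ 0) → diagonal c * diagonal (fun r => (c r)⁻¹) = 1 := by
    intro c hc
    rw [Matrix.diagonal_mul_diagonal, ← Matrix.diagonal_one]
    congr 1
    funext r
    exact mul_inv_cancel₀ (hc r)
  set V := diagonal w with hV
  set V' := diagonal fun r => (w r)⁻¹ with hV'
  have hVV : V * V' = 1 := hdiag w hw0
  -- the relative position of the first and the second flag
  obtain ⟨q, u, hqu, hq, hu, hu1⟩ := edgeMat_mul_snd hg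
  change R * G 1 = q * u at hqu
  -- the relative position of the second and the third flag
  have hg' : IsGenericTuple fun i => G ((sL * sM) i) := hg.comp (sL * sM)
  have i0 : (sL * sM) 0 = 1 := by decide
  have i1 : (sL * sM) 1 = 2 := by decide
  obtain ⟨q', u', hqu', hq', hu', hu1'⟩ := edgeMat_mul_snd hg'
  have hu₁ := edgeMat_mul_fst hg'
  rw [i0] at hu₁
  rw [i1] at hqu'
  set R' := edgeMat fun i => G ((sL * sM) i) with hR'
  set u₁ := R' * G 1 with hu₁'
  have hu₁d : u₁.det = 1 := det_of_unipotent hu₁.1 hu₁.2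
  have hinv : u₁ * u₁⁻¹ = 1 := Matrix.mul_nonsing_inv _ (by rw [hu₁d]; exact isUnit_one)
  have hinv' : u₁⁻¹ * u₁ = 1 := Matrix.nonsing_inv_mul _ (by rw [hu₁d]; exact isUnit_one)
  have hiu := inv_upper hinv hu₁.1
  have hiu1 : ∀ i, u₁⁻¹ i i = 1 := by
    intro i
    have e := diag_mul_upper hu₁.1 hiu i
    rw [hinv, hu₁.2, one_mul, Matrix.one_apply_eq] at e
    exact e.symm
  set W := u * u₁⁻¹ with hW
  have hWu : W.BlockTriangular id := hu.mul hiu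
  have hW1 : ∀ i, W i i = 1 := fun i => by rw [hW, diag_mul_upper hu hiu, hu1, hiu1, one_mul]
  -- `G 1 * u₁⁻¹` is the inverse of `R'`
  have hR'inv : G 1 * u₁⁻¹ * R' = 1 := by
    have h1 : R' * (G 1 * u₁⁻¹) = 1 := by rw [← Matrix.mul_assoc]; exact hinv
    exact mul_eq_one_comm.1 h1
  -- the lower triangular part of the third flag in the basis adapted to the first two
  set Lo := q * (W * q') with hLo
  have hRG : R * G 2 = Lo * u' := by
    calc R * G 2 = R * (G 1 * u₁⁻¹ * R') * G 2 := by rw [hR'inv, Matrix.mul_one]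
      _ = R * G 1 * u₁⁻¹ * (R' * G 2) := by simp only [Matrix.mul_assoc]
      _ = _ := by rw [hqu, hqu', hLo, hW]; simp only [Matrix.mul_assoc]
  have hLoe : ∀ r s, Lo r s = q r r.rev * (W r.rev s.rev * q' s.rev s) := by
    intro r s
    rw [hLo, hq.mul_apply, hq'.apply_mul]
  have hdq : q.det = 1 := by
    have e := congrArg Matrix.det hqu
    rw [Matrix.det_mul, Matrix.det_mul, det_edgeMat hg (g 0).2, hd 1, det_of_unipotent hu hu1] at e
    simpa using e.symm
  have hdq' : q'.det = 1 := by
    have e := congrArg Matrix.det hqu'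
    rw [Matrix.det_mul, Matrix.det_mul, det_edgeMat hg' (g _).2, hd 2,
      det_of_unipotent hu' hu1'] at e
    simpa using e.symm
  have hq0 : ∀ r, q r r.rev ≠ 0 := IsCounterDiagonal.ne_zero (q := ⟨q, hdq⟩) hq
  have hq0' : ∀ r, q' r r.rev ≠ 0 := IsCounterDiagonal.ne_zero (q := ⟨q', hdq'⟩) hq'
  have hLo0 : ∀ r, Lo r r ≠ 0 := by
    intro r
    have := hq0' r.rev
    rw [Fin.rev_rev] at this
    rw [hLoe, hW1, one_mul]
    exact mul_ne_zero (hq0 r) this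
  set k := flagFun G (n - 1) 0 0 (colv (G 2) 0) with hk
  have hk0 : k ≠ 0 := flagFun_last_ne_zero hn hg
  have hcol : ∀ r, w r * k = Lo r ⟨0, hn⟩ := by
    intro r
    rw [hwv r]
    have e := edgeMat_mul G (G 2) r ⟨0, hn⟩
    rw [← hR, hRG, Matrix.mul_apply, Finset.sum_eq_single ⟨0, hn⟩, hu1', mul_one] at e
    · exact e.symm
    · intro j _ hj
      rw [hu' (show (⟨0, hn⟩ : Fin n) < j from Nat.pos_of_ne_zero fun h => hj (Fin.ext h)),
        mul_zero]
    · simp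
  -- rows are scaled by `w⁻¹` to make the first column constant, columns by `c` to make the diagonal `1`
  set c : Fin n → ℂ := fun r => w r / Lo r r with hc
  have hc0 : ∀ r, c r ≠ 0 := fun r => div_ne_zero (hw0 r) (hLo0 r)
  set m := V' * Lo * diagonal c with hm
  have hme : ∀ r s, m r s = (w r)⁻¹ * Lo r s * c s := by
    intro r s
    rw [hm, Matrix.mul_diagonal, hV', Matrix.diagonal_mul]
  have hmn : IsNormalizedLower m := by
    refine ⟨fun i j hij => ?_, fun i => ?_, fun i j hj => ?_⟩
    · have e : W i.rev j.rev = 0 := hWu (Fin.rev_lt_rev.2 hij)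
      rw [hme, hLoe, e]
      ring
    · have h1 := hw0 i
      have h2 := hLo0 i
      rw [hme, hc]
      field_simp
    · obtain rfl : j = ⟨0, hn⟩ := Fin.ext hj
      have h1 := hw0 i
      have h2 := hw0 ⟨0, hn⟩
      rw [hme, hc]
      simp only
      rw [← hcol, ← hcol]
      field_simp
  have hmd : m.det ≠ 0 := by
    have e := Matrix.det_of_isLowerTriangular m fun i j hij => hmn.1 i j hij
    rw [e]
    simp [hmn.2.1]
  refine ⟨?_, ?_, Matrix.GeneralLinearGroup.mkOfDetNeZero m hmd, hmn, ?_⟩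
  · refine (hx.coset_eq (isClassOf_slToPGL (g 0)) (U := V' * (R * G 0)) ?_ ?_).symm
    · exact (Matrix.blockTriangular_diagonal _).mul (edgeMat_mul_fst hg).1
    · calc T.1 * V * (V' * (R * G 0)) = T.1 * (V * V') * R * G 0 := by
            simp only [Matrix.mul_assoc]
        _ = _ := by rw [hVV, Matrix.mul_one, hTR, Matrix.one_mul]
  · refine ((hx.mul (isClassOf_pcl (q₁ n))).coset_eq (isClassOf_slToPGL (g 1))
      (U := (q₁ n).1 * (V' * (q * u))) ?_ ?_).symm
    · intro i j hij
      rw [(q₁_counter n).mul_apply, hV', Matrix.diagonal_mul, hq.mul_apply, Fin.rev_rev, hu hij]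
      ring
    · calc T.1 * V * (q₁ n).1 * ((q₁ n).1 * (V' * (q * u))) =
            T.1 * (V * ((q₁ n).1 * (q₁ n).1) * V') * (q * u) := by
            simp only [Matrix.mul_assoc]
        _ = _ := by
          rw [q₁_mul_self, Matrix.mul_one, hVV, Matrix.mul_one, ← hqu, ← Matrix.mul_assoc, hTR,
            Matrix.one_mul]
  · refine ((hx.mul (isClassOf_pcl _)).coset_eq (isClassOf_slToPGL (g 2))
      (U := diagonal (fun r => (c r)⁻¹) * u') ?_ ?_).symm
    · exact (Matrix.blockTriangular_diagonal _).mul hu'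
    · change T.1 * V * m * (diagonal (fun r => (c r)⁻¹) * u') = G 2
      calc T.1 * V * m * (diagonal (fun r => (c r)⁻¹) * u') =
            T.1 * (V * V') * Lo * (diagonal c * diagonal (fun r => (c r)⁻¹)) * u' := by
            rw [hm]; simp only [Matrix.mul_assoc]
        _ = T.1 * (R * G 2) := by
          rw [hVV, hdiag c hc0, Matrix.mul_one, Matrix.mul_one, Matrix.mul_assoc, ← hRG]
        _ = G 2 := by rw [← Matrix.mul_assoc, hTR, Matrix.one_mul]

/-! ### Decorations by flags -/

/-- Natural 0-cochains of a tuple of flags. -/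
def IsNatPGL {n : ℕ} (p : Fin 4 → PGLn n ⧸ B n) (τ : Perm (Fin 4) → PGLn n) : Prop :=
  ∀ π, IsStdTriple (p (π 0)) (p (π 1)) (p (π 2)) (τ π)

theorem isNaturality_PGL (n : ℕ) : IsNaturality (IsNatPGL (n := n)) where
  smul x h π := (h π).smul x
  comp ρ h π := h (ρ * π)
  coset h π := (h π).1
  local_eq h h' π hv := by
    have h1 := h π
    rw [hv _ (π.injective.ne (by decide)), hv _ (π.injective.ne (by decide)),
      hv _ (π.injective.ne (by decide))] at h1
    exact h1.unique (h' π)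

/-- The natural cocycle of a decoration by flags, trivial if there is no natural cochain. -/
noncomputable def cocyclePGL {n : ℕ} (D : Decoration (B n)) : Cocycle (PGLn n) :=
  natCocycle IsNatPGL D

theorem cocyclePGL_dec {n : ℕ} {g : Fin 4 → PGLn n} {τ : Perm (Fin 4) → PGLn n}
    (h : IsNaturalPGLCochain g τ) : cocyclePGL (dec (B n) g) = coboundary τ :=
  (isNaturality_PGL n).natCocycle_eq h

theorem IsNaturalPGLCochain.unique {n : ℕ} {g : Fin 4 → PGLn n} {τ τ' : Perm (Fin 4) → PGLn n}
    (h : IsNaturalPGLCochain g τ) (h' : IsNaturalPGLCochain g τ') : τ = τ' :=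
  (isNaturality_PGL n).unique (p := fun i => (g i : PGLn n ⧸ B n)) h h'

theorem slToPGL_mem_B {n : ℕ} {u : SLn n} (hu : u ∈ N n) : slToPGL u ∈ B n :=
  (isClassOf_slToPGL u).mem_B_iff.2 hu.1

/-- The projection from decorations by affine flags to decorations by flags. -/
noncomputable def toFlags {n : ℕ} (D : Decoration (N n)) : Decoration (B n) :=
  dec (B n) fun i => slToPGL ((dec_surjective D).choose i)

theorem toFlags_dec {n : ℕ} (g : Fin 4 → SLn n) :
    toFlags (dec (N n) g) = dec (B n) fun i => slToPGL (g i) := by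
  obtain ⟨x, hx⟩ := dec_eq_iff.1 (dec_surjective (dec (N n) g)).choose_spec
  refine dec_eq_iff.2 ⟨slToPGL x, fun i => ?_⟩
  obtain ⟨u, hu, h⟩ := hx i
  exact ⟨slToPGL u, slToPGL_mem_B hu, by rw [h, map_mul, map_mul]⟩

theorem toFlags_pullback {n : ℕ} (D : Decoration (N n)) (ρ : Perm (Fin 4)) :
    toFlags (D.pullback ρ) = (toFlags D).pullback ρ := by
  obtain ⟨g, rfl⟩ := dec_surjective D
  rw [toFlags_dec]
  exact toFlags_dec fun i => g (ρ i)

/-- Over `ℂ` every invertible matrix is proportional to one of determinant `1`. -/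
theorem exists_sl_multiple {n : ℕ} (hn : 0 < n) (g : GLn n) :
    ∃ (h : SLn n) (c : ℂ), c ≠ 0 ∧ h.1 = c • g.1 := by
  have hg : g.1.det ≠ 0 := (isClassOf_pcl g).det_ne_zero
  obtain ⟨c, hc⟩ := IsAlgClosed.exists_pow_nat_eq (g.1.det)⁻¹ hn
  have hc0 : c ≠ 0 := by
    rintro rfl
    rw [zero_pow hn.ne'] at hc
    exact inv_ne_zero hg hc.symm
  refine ⟨⟨c • g.1, ?_⟩, c, hc0, rfl⟩
  rw [Matrix.det_smul, Fintype.card_fin, hc, inv_mul_cancel₀ hg]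

theorem dg_smul_one {n : ℕ} (c : ℂ) {j : ℕ} (hj : j < n) :
    dg (c • (1 : Matrix (Fin n) (Fin n) ℂ)) j = c := by
  rw [dg, dif_pos hj]
  simp

theorem exists_sl_tuple {n : ℕ} (hn : 0 < n) {g : Fin 4 → GLn n}
    (hg : IsGenericTuple fun i => (g i).1) : ∃ h : Fin 4 → SLn n,
      IsGenericTuple (fun i => (h i).1) ∧ (fun i => slToPGL (h i)) = fun i => pcl (g i) := by
  choose h c hc hh using fun i => exists_sl_multiple hn (g i)
  refine ⟨h, ?_, funext fun i => ?_⟩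
  · rw [isGenericTuple_iff] at hg ⊢
    intro t ht
    have e : (fun i => (h i).1) = fun i => (1 : Matrix (Fin n) (Fin n) ℂ) * (g i).1 * (c i • 1) := by
      funext i
      rw [hh, Matrix.one_mul, Matrix.mul_smul, Matrix.mul_one]
    have hb : ∀ i, (c i • (1 : Matrix (Fin n) (Fin n) ℂ)).BlockTriangular id := fun i j k hjk => by
      rw [Matrix.smul_apply, Matrix.blockTriangular_one hjk, smul_zero]
    rw [e, cdet_mul 1 (fun i => (g i).1) _ hb ht, Matrix.det_one, one_mul]
    refine mul_ne_zero ?_ (hg t ht)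
    refine Finset.prod_ne_zero_iff.2 fun i _ => Finset.prod_ne_zero_iff.2 fun j hj => ?_
    have : t i ≤ n := ht ▸ Finset.single_le_sum (fun _ _ => Nat.zero_le _) (Finset.mem_univ i)
    rw [Finset.mem_range] at hj
    rw [dg_smul_one _ (by omega)]
    exact hc i
  · exact ((isClassOf_pcl (g i)).eq (isClassOf_slToPGL (h i)) (hc i) (hh i)).symm

theorem toFlags_mem {n : ℕ} {D : Decoration (N n)} (hD : D ∈ genericSL n) :
    toFlags D ∈ genericPGL n := by
  obtain ⟨g, hg, rfl⟩ := hD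
  exact ⟨fun i => Matrix.SpecialLinearGroup.toGL (g i), hg, (toFlags_dec g).symm⟩

theorem exists_toFlags_eq {n : ℕ} (hn : 0 < n) {D : Decoration (B n)} (hD : D ∈ genericPGL n) :
    ∃ D' ∈ genericSL n, toFlags D' = D := by
  obtain ⟨g, hg, rfl⟩ := hD
  obtain ⟨h, hh, he⟩ := exists_sl_tuple hn hg
  exact ⟨dec (N n) h, ⟨h, hh, rfl⟩, (toFlags_dec h).trans (congrArg _ he)⟩

theorem genericPGL_pullback {n : ℕ} {D : Decoration (B n)} (hD : D ∈ genericPGL n)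
    (ρ : Perm (Fin 4)) : D.pullback ρ ∈ genericPGL n := by
  obtain ⟨g, hg, rfl⟩ := hD
  exact ⟨fun i => g (ρ i), hg.comp ρ, rfl⟩

/-! ### Shape assignments of decorations by flags -/

/-- Cross-ratios do not change under rescaling by a product of functions of the coordinates. -/
theorem muFun_scale {f f' : (Fin 4 → ℕ) → ℂ} {K : ℂ} {φ : Fin 4 → ℕ → ℂ} (hK : K ≠ 0)
    (hφ : ∀ i m, φ i m ≠ 0) {s : Fin 4 → ℕ}
    (h : ∀ e : Fin 4 → ℕ, ∑ i, e i = 2 → (∀ i, e i ≠ 2) →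
      f' (s + e) = K * (∏ i, φ i ((s + e) i)) * f (s + e)) (e : Fin 4 → ℕ) :
    muFun f' s e = muFun f s e := by
  unfold muFun
  rw [h _ (by decide) (by decide), h _ (by decide) (by decide), h _ (by decide) (by decide),
    h _ (by decide) (by decide), h _ (by decide) (by decide), h _ (by decide) (by decide)]
  simp only [Fin.prod_univ_four, Pi.add_apply, Matrix.cons_val, add_zero]
  have hne : K * K * (φ 0 (s 0) * φ 0 (s 0 + 1) * (φ 1 (s 1) * φ 1 (s 1 + 1)) *
      (φ 2 (s 2) * φ 2 (s 2 + 1)) * (φ 3 (s 3) * φ 3 (s 3 + 1))) ≠ 0 := by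
    simp [hK, hφ]
  split_ifs
  · symm
    rw [← mul_div_mul_left _ _ hne]
    congr 1 <;> ring
  · symm
    rw [← mul_div_mul_left _ _ hne]
    congr 1 <;> ring
  · symm
    rw [← mul_div_mul_left _ _ hne]
    congr 2 <;> ring

theorem exists_upper_of_dec_eq {n : ℕ} {g g' : Fin 4 → GLn n}
    (h : dec (B n) (fun i => pcl (g i)) = dec (B n) fun i => pcl (g' i)) :
    ∃ (x : GLn n) (b : Fin 4 → Matrix (Fin n) (Fin n) ℂ), (∀ i, (b i).BlockTriangular id) ∧
      (∀ i, (b i).det ≠ 0) ∧ ∀ i, (g' i).1 = x.1 * (g i).1 * b i := by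
  obtain ⟨x, hx⟩ := dec_eq_iff.1 h
  obtain ⟨x, rfl⟩ := Matrix.ProjGenLinGroup.mk_surjective x
  have key : ∀ i, ∃ b : Matrix (Fin n) (Fin n) ℂ, b.BlockTriangular id ∧ b.det ≠ 0 ∧
      (g' i).1 = x.1 * (g i).1 * b := by
    intro i
    obtain ⟨u, hu, he⟩ := hx i
    obtain ⟨b, hb, hb'⟩ := (isClassOf_pcl (x * g i)).of_coset_eq (isClassOf_pcl (g' i))
      (QuotientGroup.eq.2 (by
        rw [he, map_mul]
        change (pcl x * pcl (g i))⁻¹ * (pcl x * pcl (g i) * u) ∈ B n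
        rwa [inv_mul_cancel_left]))
    refine ⟨b, hb, fun h0 => (isClassOf_pcl (g' i)).det_ne_zero ?_, hb'.symm⟩
    rw [← hb', Matrix.det_mul, h0, mul_zero]
  choose b hb hd he using key
  exact ⟨x, b, hb, hd, he⟩

theorem dg_ne_zero {n : ℕ} {b : Matrix (Fin n) (Fin n) ℂ} (hb : b.BlockTriangular id)
    (hd : b.det ≠ 0) (j : ℕ) : dg b j ≠ 0 := by
  unfold dg
  split_ifs with h
  · rw [Matrix.det_of_isUpperTriangular hb] at hd
    exact Finset.prod_ne_zero_iff.1 hd _ (Finset.mem_univ _)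
  · exact one_ne_zero

/-- The shapes depend only on the flags: changing the representatives rescales the determinants by a
product of functions of the coordinates, and cross-ratios are invariant under this. -/
theorem mu_detCoords_eq_of_dec_eq {n : ℕ} {g g' : Fin 4 → GLn n}
    (h : dec (B n) (fun i => pcl (g i)) = dec (B n) fun i => pcl (g' i)) :
    mu (detCoords fun i => (g' i).1) = mu (detCoords fun i => (g i).1) := by
  obtain ⟨x, b, hb, hd, he⟩ := exists_upper_of_dec_eq h
  funext s e
  rw [mu_eq, mu_eq]
  refine muFun_scale (K := x.1.det) (φ := fun i m => ∏ j ∈ Finset.range m, dg (b i) j)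
    (isClassOf_pcl x).det_ne_zero
    (fun i m => Finset.prod_ne_zero_iff.2 fun j _ => dg_ne_zero (hb i) (hd i) j) ?_ e.1
  intro e he' he2
  have hs := sum_add_eq s.2 e he'
  have hv : ∀ i, (s.1 + e) i ≠ n := by
    intro i h0
    have h1 : s.1 i ≤ ∑ j, s.1 j := Finset.single_le_sum (fun _ _ => Nat.zero_le _) (Finset.mem_univ i)
    have h2 : e i ≤ ∑ j, e j := Finset.single_le_sum (fun _ _ => Nat.zero_le _) (Finset.mem_univ i)
    have h3 := s.2
    have h4 := he2 i
    rw [Pi.add_apply] at h0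
    omega
  rw [val_detCoords _ hs hv, val_detCoords _ hs hv, ← cdet_mul x.1 (fun i => (g i).1) b hb hs]
  simp only [he]

/-- The shape assignment of a decoration by flags, computed from arbitrary representatives; it is
meaningful for generic decorations. -/
noncomputable def shapeOf {n : ℕ} (D : Decoration (B n)) : ShapeFun n :=
  mu (detCoords fun i =>
    (Matrix.ProjGenLinGroup.mk_surjective ((dec_surjective D).choose i)).choose.1)

theorem shapeOf_dec {n : ℕ} (g : Fin 4 → GLn n) :
    shapeOf (dec (B n) fun i => pcl (g i)) = mu (detCoords fun i => (g i).1) := by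
  refine mu_detCoords_eq_of_dec_eq ?_
  refine (dec_surjective (dec (B n) fun i => pcl (g i))).choose_spec.symm.trans (congrArg _ ?_)
  funext i
  exact (Matrix.ProjGenLinGroup.mk_surjective
    ((dec_surjective (dec (B n) fun i => pcl (g i))).choose i)).choose_spec.symm

theorem shapeOf_toFlags {n : ℕ} (D : Decoration (N n)) :
    shapeOf (toFlags D) = mu (ptolemyOf D) := by
  obtain ⟨g, rfl⟩ := dec_surjective D
  rw [toFlags_dec, ptolemyOf_dec]
  exact shapeOf_dec fun i => Matrix.SpecialLinearGroup.toGL (g i)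

theorem shapeOf_pullback {n : ℕ} (hn : 0 < n) {D : Decoration (B n)} (hD : D ∈ genericPGL n)
    (ρ : Perm (Fin 4)) : shapeOf (D.pullback ρ) = (shapeOf D).pullback ρ := by
  obtain ⟨D, hD', rfl⟩ := exists_toFlags_eq hn hD
  rw [← toFlags_pullback, shapeOf_toFlags, shapeOf_toFlags, ptolemyOf_pullback,
    mu_pullback ((bijOn_ptolemyOf n).mapsTo hD')]

/-! ### Natural cocycles of decorations by flags -/

theorem exists_isClassOf_tauMat {n : ℕ} {c : PtolemyFun n} (hc : ∀ t, c t ≠ 0)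
    (π : Perm (Fin 4)) : ∃ x : PGLn n, IsClassOf x (tauMat c π) := by
  refine exists_isClassOf ?_
  rw [tauMat_eq, Matrix.det_diagonal]
  exact Finset.prod_ne_zero_iff.2 fun r _ => Finset.prod_ne_zero_iff.2 fun i _ =>
    diamondAt_ne_zero hc _ _ _

theorem isNaturalPGLCochain_of_SL {n : ℕ} (hn : 0 < n) {g : Fin 4 → SLn n}
    (hg : IsGenericTuple fun i => (g i).1) {τ : Perm (Fin 4) → SLn n}
    (hτ : IsNaturalSLCochain g τ) {x : Perm (Fin 4) → PGLn n}
    (hx : ∀ π, IsClassOf (x π) (tauMat (detCoords fun i => (g i).1) π)) :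
    IsNaturalPGLCochain (fun i => slToPGL (g i)) fun π => slToPGL (τ π) * x π := by
  intro π
  refine isStdTriple_of_edgeMat hn (g := fun i => g (π i)) (hg.comp π) (hτ.inv_eq hg π) ?_
  have e : detCoords (fun i => (g (π i)).1) = (detCoords fun i => (g i).1).pullback π :=
    detCoords_comp (fun i => (g i).1) π
  rw [e, tauMat_pullback]
  exact (isClassOf_slToPGL _).mul (hx π)

theorem coboundary_map_act {G G' : Type} [Group G] [Group G'] (f : G →* G')
    (τ : Perm (Fin 4) → G) (x : Perm (Fin 4) → G') :
    coboundary (fun π => f (τ π) * x π) = ((coboundary τ).map f).act x := by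
  ext1 <;> funext π <;>
    simp [coboundary, Cocycle.act, Cocycle.triv, Cocycle.map, mul_assoc]

theorem exists_cochains {n : ℕ} (hn : 0 < n) {D : Decoration (N n)} (hD : D ∈ genericSL n) :
    ∃ (g : Fin 4 → SLn n) (τ : Perm (Fin 4) → SLn n) (x : Perm (Fin 4) → PGLn n),
      dec (N n) g = D ∧ IsGenericTuple (fun i => (g i).1) ∧ IsNaturalSLCochain g τ ∧
      (∀ π, IsClassOf (x π) (tauMat (ptolemyOf D) π)) ∧
      IsNaturalPGLCochain (fun i => slToPGL (g i)) fun π => slToPGL (τ π) * x π := by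
  obtain ⟨g, hg, rfl⟩ := hD
  obtain ⟨τ, hτ⟩ := exists_naturalSLCochain hg
  choose x hx using exists_isClassOf_tauMat (c := detCoords fun i => (g i).1) fun t => hg _ t.2.1
  refine ⟨g, τ, x, rfl, hg, hτ, ?_, isNaturalPGLCochain_of_SL hn hg hτ hx⟩
  rw [ptolemyOf_dec]
  exact hx

theorem isTauOf_toFlags {n : ℕ} (hn : 0 < n) {D : Decoration (N n)} (hD : D ∈ genericSL n) :
    IsTauOf (ptolemyOf D) (cocycleSL D) (cocyclePGL (toFlags D)) := by
  obtain ⟨g, τ, x, rfl, -, hτ, hx, h⟩ := exists_cochains hn hD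
  exact ⟨x, hx, by rw [toFlags_dec, cocyclePGL_dec h, cocycleSL_dec hτ, coboundary_map_act]⟩

theorem exists_isNatPGL {n : ℕ} (hn : 0 < n) {D : Decoration (B n)} (hD : D ∈ genericPGL n) :
    ∃ p τ, decMk p = D ∧ IsNatPGL p τ := by
  obtain ⟨D, hD', rfl⟩ := exists_toFlags_eq hn hD
  obtain ⟨g, τ, x, rfl, -, -, -, h⟩ := exists_cochains hn hD'
  exact ⟨_, _, (toFlags_dec g).symm, h⟩

theorem exists_naturalPGLCochain {n : ℕ} (hn : 0 < n) {g : Fin 4 → GLn n}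
    (hg : IsGenericTuple fun i => (g i).1) : ∃ τ, IsNaturalPGLCochain (fun i => pcl (g i)) τ := by
  obtain ⟨h, hh, he⟩ := exists_sl_tuple hn hg
  obtain ⟨τ, hτ⟩ := exists_naturalSLCochain hh
  choose x hx using exists_isClassOf_tauMat (c := detCoords fun i => (h i).1) fun t => hh _ t.2.1
  rw [← he]
  exact ⟨_, isNaturalPGLCochain_of_SL hn hh hτ hx⟩

theorem cocyclePGL_pullback {n : ℕ} (hn : 0 < n) {D : Decoration (B n)} (hD : D ∈ genericPGL n)
    (ρ : Perm (Fin 4)) : cocyclePGL (D.pullback ρ) = (cocyclePGL D).pullback ρ := by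
  obtain ⟨p, τ, rfl, h⟩ := exists_isNatPGL hn hD
  exact (isNaturality_PGL n).natCocycle_pullback h ρ

theorem toDec_cocyclePGL {n : ℕ} (hn : 0 < n) {D : Decoration (B n)} (hD : D ∈ genericPGL n) :
    (cocyclePGL D).toDec (B n) = D := by
  obtain ⟨p, τ, rfl, h⟩ := exists_isNatPGL hn hD
  exact (isNaturality_PGL n).toDec_natCocycle h

/-! ### The explicit form of natural cocycles with values in the projective group -/

theorem middleShapeMat_pullback {n : ℕ} (z : ShapeFun n) (π : Perm (Fin 4)) :
    middleShapeMat (z.pullback π) 1 = middleShapeMat z π := by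
  simp only [middleShapeMat, xCoord, shapeProd_pullback, permPt_comb, Perm.coe_one, id,
    Perm.sign_one, Units.val_one, zpow_one]
  congr 3
  funext k
  congr 3
  funext i
  congr 1
  rcases Int.units_eq_one_or (Perm.sign π) with h | h
  · simp [h]
  · simp [h, inv_neg]

theorem shortShapeMat_pullback {n : ℕ} (z : ShapeFun n) (π : Perm (Fin 4)) :
    shortShapeMat (z.pullback π) 1 = shortShapeMat z π := by
  simp only [shortShapeMat, ShapeFun.val_pullback, permPt_comb, Perm.coe_one, id, Perm.sign_one,
    Units.val_one]
  congr 2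
  funext i
  congr 1
  rw [← _root_.zpow_mul, mul_neg_one]

/-- The label of a middle edge after conjugation by the diagonal matrices of diamond coordinates at its
two ends. The signs relating the two ends make up the last factor of the shape formula. -/
theorem tauMat_mul_middleShapeMat {n : ℕ} {c : PtolemyFun n} (hc : ∀ t, c t ≠ 0) :
    tauMat c 1 * middleShapeMat (mu c) 1 = middleMat c 1 * tauMat c sM := by
  have h := prod_xMat_factor n (diamondAt c 1) (fun k i _ _ _ => diamondAt_ne_zero hc 1 k i)
  rcases Nat.eq_zero_or_pos n with rfl | hn
  · exact Subsingleton.elim _ _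
  have h := h (n - 1) 1 le_rfl (by omega)
  have hM : middleShapeMat (mu c) 1 = ((List.range' 1 (n - 1)).map fun k =>
        ((List.range' 1 (n - k)).map fun i => xMat n i 1).prod *
        (diagonal fun r : Fin n => ∏ i ∈ Finset.Ioc (r : ℕ) (n - k - 1),
          diamondAt c 1 (k + 1) i / diamondAt c 1 k i)).prod * dSign n := by
    unfold middleShapeMat
    congr 2
    refine List.map_congr_left fun k hk => ?_
    rw [List.mem_range'_1] at hk
    rw [← prod_hMat]
    congr 2
    refine List.map_congr_left fun i hi => ?_
    rw [List.mem_range'_1] at hi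
    congr 1
    simp only [Perm.coe_one, id, Perm.sign_one, Units.val_one, zpow_one]
    exact xCoord_mu hc hk.1 hi.1 (by omega)
  have hE : tauMat c sM = (diagonal fun r : Fin n =>
      ∏ i ∈ Finset.Ioc (r : ℕ) (n - 1), diamondAt c 1 (n - i) i) * dSign n := by
    rw [tauMat_eq, dSign, Matrix.diagonal_mul_diagonal]
    congr 1
    funext r
    simp only [diamondAt_sM]
    rw [Finset.prod_neg, Nat.card_Ioc, mul_comm]
    congr 2
    omega
  rw [hM, tauMat_eq, ← Matrix.mul_assoc, ← h, hE, Matrix.mul_assoc]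
  rfl

/-- The first diamond coordinates of two faces with a common edge differ by a shape parameter of
that edge. -/
theorem diamondAt_sS {n : ℕ} {c : PtolemyFun n} (hc : ∀ t, c t ≠ 0) {i : ℕ} (hi : 1 ≤ i)
    (hin : i + 1 ≤ n) : diamondAt c 1 1 i *
      ((mu c).val (comb 0 1 2 (i - 1) (n - 1 - i) 0) (comb 0 1 2 1 1 0))⁻¹ =
      diamondAt c sS 1 i := by
  obtain ⟨a, rfl⟩ : ∃ a, i = a + 1 := ⟨i - 1, by omega⟩
  obtain ⟨b, hb⟩ : ∃ b, a + b + 2 = n := ⟨n - 2 - a, by omega⟩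
  have e1 : n - 1 - (a + 1) = b := by omega
  have e2 : n - (a + 1) - 1 = b := by omega
  have hf := val_ne_zero hc
  have o1 : orderSign 0 1 2 = 1 := by simp [orderSign]
  have o2 : orderSign 0 1 3 = 1 := by simp [orderSign]
  have hs : ∑ i, comb 0 1 2 a b 0 i + 2 = n := by
    rw [sum_comb]
    omega
  have k0 := val_mu c hs 0
  have hc3 : ∀ a b d, comb 0 1 3 a b d = ![a, b, 0, d] := by
    intro a b d
    funext i
    fin_cases i <;> simp [comb]
  have he : comb 0 1 2 1 1 0 = edgePt 0 := comb_std ..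
  rw [Nat.add_sub_cancel, e1, he, k0]
  simp only [edgePt, Matrix.cons_val]
  rw [muFun_1100]
  simp only [diamondAt, diamond, Perm.coe_one, id, e2, o1, o2, Nat.add_sub_cancel, comb_std,
    sS_zero, sS_one, sS_two, hc3, Nat.sub_self]
  simp only [Matrix.add_cons, Matrix.head_cons, Matrix.tail_cons, Matrix.empty_add_empty, add_zero,
    zero_add]
  field_simp
  rw [neg_inj, div_eq_div_iff (by simp [hf]) (by simp [hf])]
  ring

/-- Short edges have trivial labels in the upper row, so after conjugation their labels are quotients
of the diagonal matrices of two adjacent faces. -/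
theorem tauMat_mul_shortShapeMat {n : ℕ} {c : PtolemyFun n} (hc : ∀ t, c t ≠ 0) :
    tauMat c 1 * shortShapeMat (mu c) 1 = tauMat c sS := by
  rw [shortShapeMat, prod_hMat, tauMat_eq, tauMat_eq, Matrix.diagonal_mul_diagonal]
  congr 1
  funext r
  rw [← Finset.prod_mul_distrib]
  refine Finset.prod_congr rfl fun i hi => ?_
  rw [Finset.mem_Ioc] at hi
  have h := diamondAt_sS hc (i := i) (by omega) (by omega)
  rw [← h]
  simp only [Perm.coe_one, id, Perm.sign_one, Units.val_one, _root_.zpow_neg_one]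

/-- The change of basis between the two ends of a long edge becomes `q₁` after normalization by the
diamond coordinates. -/
theorem longMat_mul_tauMat {n : ℕ} (hn : 0 < n) {g : Fin 4 → SLn n}
    (hg : IsGenericTuple fun i => (g i).1) : ∃ k : ℂ, k ≠ 0 ∧
      longMat (detCoords fun i => (g i).1) 1 * tauMat (detCoords fun i => (g i).1) sL =
        k • (tauMat (detCoords fun i => (g i).1) 1 * (q₁ n).1) := by
  have hd : ∀ i, ((fun i => (g i).1) i).det = 1 := fun i => (g i).2
  have hd' : ∀ i, ((fun i => (g (sL i)).1) i).det = 1 := fun i => (g _).2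
  have hg' : IsGenericTuple fun i => (g (sL i)).1 := hg.comp sL
  obtain ⟨w, hw, hw0, hwv⟩ := tauMat_apply hg hd
  obtain ⟨w', hw', hw0', hwv'⟩ := tauMat_apply hg' hd'
  have e : detCoords (fun i => (g (sL i)).1) = (detCoords fun i => (g i).1).pullback sL :=
    detCoords_comp (fun i => (g i).1) sL
  rw [e, tauMat_pullback] at hw'
  have h1 := flagFun_last_ne_zero hn hg
  have h2 := flagFun_last_ne_zero hn hg'
  set v := flagFun (fun i => (g i).1) (n - 1) 0 0 (colv (g 2).1 0)
  set v' := flagFun (fun i => (g (sL i)).1) (n - 1) 0 0 (colv (g (sL 2)).1 0)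
  refine ⟨v / v', div_ne_zero h1 h2, ?_⟩
  have hq : IsCounterDiagonal (longMat (detCoords fun i => (g i).1) 1) := by
    intro i j hij
    rw [longMat, Matrix.of_apply, if_neg]
    rintro rfl
    exact hij (Fin.rev_rev j).symm
  have hl := edgeMat_eq_long hg hd
  rw [hw, hw']
  ext r s
  rw [Matrix.mul_diagonal, Matrix.smul_apply, Matrix.diagonal_mul, smul_eq_mul]
  by_cases hs : s = r.rev
  · subst hs
    rw [q₁_apply_rev, mul_one]
    have h3 : (edgeMat (fun i => (g i).1) * (g 2).1) r ⟨0, hn⟩ =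
        longMat (detCoords fun i => (g i).1) 1 r r.rev *
          (edgeMat (fun i => (g (sL i)).1) * (g (sL 2)).1) r.rev ⟨0, hn⟩ := by
      rw [hl, Matrix.mul_assoc, hq.mul_apply, sL_two]
    rw [edgeMat_mul, edgeMat_mul] at h3
    have h4 := hwv r
    have h5 := hwv' r.rev
    have h3 := h4.trans (h3.trans (congrArg (_ * ·) h5.symm))
    field_simp
    linear_combination -h3
  · rw [hq r s hs, q₁_counter n r s hs]
    ring

/-- By equivariance it is enough to compute the labels at the standard flag `0123`, for a lift of the
decoration to affine flags. -/
theorem isShapeFormula_PGL {n : ℕ} (hn : 0 < n) {D : Decoration (B n)} (hD : D ∈ genericPGL n) :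
    IsShapeFormula (shapeOf D) (cocyclePGL D) := by
  have key : ∀ D ∈ genericPGL n, (cocyclePGL D).α 1 = pcl (q₁ n) ∧
      IsClassOf ((cocyclePGL D).β 1) (middleShapeMat (shapeOf D) 1) ∧
      IsClassOf ((cocyclePGL D).γ 1) (shortShapeMat (shapeOf D) 1) := by
    intro D hD
    obtain ⟨D, hD', rfl⟩ := exists_toFlags_eq hn hD
    have hc := ((bijOn_ptolemyOf n).mapsTo hD').1
    have hF := isPtolemyFormula_SL hD' 1
    obtain ⟨g, τ, x, rfl, hg, hτ, hx, h⟩ := exists_cochains hn hD'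
    rw [shapeOf_toFlags, toFlags_dec, cocyclePGL_dec h]
    rw [cocycleSL_dec hτ, coboundary_α, coboundary_β, coboundary_γ] at hF
    rw [coboundary_α, coboundary_β, coboundary_γ]
    set c := ptolemyOf (dec (N n) g) with hcdef
    simp only [one_mul] at hF ⊢
    have hass : ∀ ρ : Perm (Fin 4), (slToPGL (τ 1) * x 1)⁻¹ * (slToPGL (τ ρ) * x ρ) =
        (x 1)⁻¹ * (slToPGL ((τ 1)⁻¹ * τ ρ) * x ρ) := by
      intro ρ
      rw [map_mul, map_inv]
      group
    rw [hass, hass, hass, hF.2.2, map_one, one_mul]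
    refine ⟨?_, ?_, ?_⟩
    · obtain ⟨k, hk, he⟩ := longMat_mul_tauMat hn hg
      rw [← ptolemyOf_dec, ← hcdef] at he
      have h1 := (isClassOf_slToPGL ((τ 1)⁻¹ * τ sL)).mul (hx sL)
      rw [hF.1 (by decide), he] at h1
      rw [← ((hx 1).mul (isClassOf_pcl (q₁ n))).eq h1 hk rfl, inv_mul_cancel_left]
    · have h1 := (isClassOf_slToPGL ((τ 1)⁻¹ * τ sM)).mul (hx sM)
      rw [hF.2.1] at h1
      exact (hx 1).inv_mul h1 (tauMat_mul_middleShapeMat hc)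
    · exact (hx 1).inv_mul (hx sS) (tauMat_mul_shortShapeMat hc)
  intro π
  have h := key _ (genericPGL_pullback hD π)
  rw [cocyclePGL_pullback hn hD, shapeOf_pullback hn hD, middleShapeMat_pullback,
    shortShapeMat_pullback] at h
  simpa [Cocycle.pullback] using h

theorem IsShapeFormula.unique {n : ℕ} {z : ShapeFun n} {σ σ' : Cocycle (PGLn n)}
    (h : IsShapeFormula z σ) (h' : IsShapeFormula z σ') : σ = σ' := by
  ext1 <;> funext π
  · rw [(h π).1, (h' π).1]
  · exact (h π).2.1.eq (h' π).2.1 one_ne_zero (one_smul ..).symm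
  · exact (h π).2.2.eq (h' π).2.2 one_ne_zero (one_smul ..).symm

/-! ### The lower row of the diagram -/

theorem cocyclePGL_mem {n : ℕ} (hn : 0 < n) {D : Decoration (B n)} (hD : D ∈ genericPGL n) :
    cocyclePGL D ∈ naturalPGL n := by
  have hF := isShapeFormula_PGL hn hD
  obtain ⟨g, hg, rfl⟩ := hD
  obtain ⟨τ, hτ⟩ := exists_naturalPGLCochain hn hg
  rw [cocyclePGL_dec hτ] at hF ⊢
  refine ⟨fun π => ⟨(isNaturality_PGL n).β_mem
    (p := fun i => (pcl (g i) : PGLn n ⧸ B n)) hτ π, ?_⟩, g, τ, hg, hτ, rfl⟩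
  have h := (hF π).2.2
  rw [shortShapeMat, prod_hMat] at h
  exact h.mem_H

theorem bijOn_cocyclePGL {n : ℕ} (hn : 0 < n) :
    Set.BijOn cocyclePGL (genericPGL n) (naturalPGL n) := by
  refine ⟨fun D hD => cocyclePGL_mem hn hD, fun D hD D' hD' h => ?_, ?_⟩
  · rw [← toDec_cocyclePGL hn hD, ← toDec_cocyclePGL hn hD', h]
  · rintro σ ⟨-, g, τ, hg, hτ, rfl⟩
    exact ⟨_, ⟨g, hg, rfl⟩, cocyclePGL_dec hτ⟩

theorem bijOn_shapeOf {n : ℕ} (hn : 0 < n) : Set.BijOn shapeOf (genericPGL n) (shapeSet n) := by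
  refine ⟨fun D hD => ?_, fun D hD D' hD' h => ?_, fun z hz => ?_⟩
  · obtain ⟨D, hD', rfl⟩ := exists_toFlags_eq hn hD
    rw [shapeOf_toFlags]
    exact mu_mem_shapeSet ((bijOn_ptolemyOf n).mapsTo hD')
  · have h1 := isShapeFormula_PGL hn hD
    rw [h] at h1
    rw [← toDec_cocyclePGL hn hD, ← toDec_cocyclePGL hn hD',
      h1.unique (isShapeFormula_PGL hn hD')]
  · obtain ⟨c, hc, rfl⟩ := exists_mu_eq hz
    obtain ⟨D, hD, rfl⟩ := (bijOn_ptolemyOf n).surjOn hc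
    exact ⟨toFlags D, toFlags_mem hD, shapeOf_toFlags D⟩

/-! ### Flags of a triangulation -/

theorem perm_eq_or_of_three {ρ : Perm (Fin 4)} (h : ρ 3 = 3) :
    ρ = 1 ∨ ρ = sL ∨ ρ = sM ∨ ρ = sL * sM ∨ ρ = sM * sL ∨ ρ = sL * sM * sL := by
  revert ρ
  decide

theorem exists_perm {v i : Fin 4} (h : v ≠ i) : ∃ π : Perm (Fin 4), π 0 = v ∧ π 3 = i := by
  revert v i
  decide

theorem add_one_ne (i : Fin 4) : i + 1 ≠ i := by
  revert i
  decide

namespace Triangulation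

variable (T : Triangulation)

/-- The inverse of `turn`. -/
def unturn (f : T.Simplex × Perm (Fin 4)) : T.Simplex × Perm (Fin 4) :=
  (T.nbr f.1 (f.2 3), T.perm f.1 (f.2 3) * f.2 * sS)

theorem turn_unturn (f : T.Simplex × Perm (Fin 4)) : T.turn (T.unturn f) = f := by
  obtain ⟨Δ, π⟩ := f
  have e : (T.perm Δ (π 3) * (π * sS)) 2 = T.perm Δ (π 3) (π 3) := by
    simp [Perm.mul_apply, sS_two]
  unfold turn unturn
  simp only [e, T.nbr_nbr, T.perm_nbr, mul_assoc, sS_sS, mul_one, inv_mul_cancel_left]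

theorem unturn_turn (f : T.Simplex × Perm (Fin 4)) : T.unturn (T.turn f) = f := by
  obtain ⟨Δ, π⟩ := f
  have e : (T.perm Δ (π 2) * (π * sS)) 3 = T.perm Δ (π 2) (π 2) := by
    simp [Perm.mul_apply, sS_three]
  unfold turn unturn
  simp only [e, T.nbr_nbr, T.perm_nbr, inv_mul_cancel_left, mul_assoc, sS_sS, mul_one]

theorem turn_injective : Function.Injective T.turn :=
  Function.LeftInverse.injective T.unturn_turn

theorem mem_periodicPts_turn (f : T.Simplex × Perm (Fin 4)) : f ∈ Function.periodicPts T.turn :=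
  T.turn_injective.mem_periodicPts f

variable {T}

/-- The product of the short edges around a polygonal face of a prism is conjugate to the inverse of
the product of the gluing elements around the edge. -/
theorem prod_short_edges {G : Type} [Group G] (F X γ : T.Simplex × Perm (Fin 4) → G)
    (h : ∀ f, γ f = (F f)⁻¹ * (X f)⁻¹ * F (T.turn f)) (f : T.Simplex × Perm (Fin 4)) :
    ((T.cycle f).map γ).prod = (F f)⁻¹ * (((T.cycle f).map X).reverse.prod)⁻¹ * F f := by
  have key : ∀ k, ((List.range k).map fun j => γ (T.turn^[j] f)).prod =
      (F f)⁻¹ * (((List.range k).map fun j => X (T.turn^[j] f)).reverse.prod)⁻¹ *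
        F (T.turn^[k] f) := by
    intro k
    induction k with
    | zero => simp
    | succ k ih =>
      rw [List.range_succ, List.map_append, List.prod_append, ih, List.map_append,
        List.reverse_append, List.prod_append, Function.iterate_succ_apply']
      simp only [List.map_singleton, List.prod_singleton, List.reverse_singleton, h]
      group
  have h1 := key (Function.minimalPeriod T.turn f)
  rw [Function.iterate_minimalPeriod] at h1
  rw [cycle, List.map_map, List.map_map]
  exact h1

theorem prod_short_edges_eq_one {G : Type} [Group G] {F X γ : T.Simplex × Perm (Fin 4) → G}
    (h : ∀ f, γ f = (F f)⁻¹ * (X f)⁻¹ * F (T.turn f)) (f : T.Simplex × Perm (Fin 4)) :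
    ((T.cycle f).map γ).prod = 1 ↔ ((T.cycle f).map X).reverse.prod = 1 := by
  rw [prod_short_edges F X γ h, mul_assoc, inv_mul_eq_one, right_eq_mul, inv_eq_one]

/-! ### Decorations and natural cocycles on a triangulation -/

section

variable {G : Type} [Group G] {H : Subgroup G}
  {P : (Fin 4 → G ⧸ H) → (Perm (Fin 4) → G) → Prop}

/-- The gluing element of a face relates the natural cochains at the vertices of the face. -/
theorem glue_cochain (hP : IsNaturality P) {p p' : Fin 4 → G ⧸ H} {τ τ' : Perm (Fin 4) → G}
    (h : P p τ) (h' : P p' τ') {ρ : Perm (Fin 4)} {i : Fin 4} {y : G}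
    (hy : ∀ v, v ≠ i → y • p v = p' (ρ v)) {π : Perm (Fin 4)} (hπ : π 3 = i) :
    y * τ π = τ' (ρ * π) :=
  hP.local_eq (hP.smul y h) (hP.comp ρ h') π fun v hv => hy v (hπ ▸ hv)

theorem sL_apply_three (π : Perm (Fin 4)) : (π * sL) 3 = π 3 := by
  rw [Perm.mul_apply, sL_three]

theorem sM_apply_three (π : Perm (Fin 4)) : (π * sM) 3 = π 3 := by
  rw [Perm.mul_apply, sM_three]

/-- Local form of a decoration: gluing elements exist and multiply to `1` around edges. Their
uniqueness is automatic when natural cochains exist. -/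
theorem isDecoration_of_glue (hP : IsNaturality P) {D : T.Simplex → Decoration H}
    {g : T.Simplex → Fin 4 → G ⧸ H} {x : T.Simplex → Fin 4 → G} (hg : ∀ Δ, decMk (g Δ) = D Δ)
    (hτ : ∀ Δ, ∃ τ, P (g Δ) τ)
    (hx : ∀ Δ i v, v ≠ i → x Δ i • g Δ v = g (T.nbr Δ i) (T.perm Δ i v))
    (he : ∀ f, (((T.cycle f).map fun f' => x f'.1 (f'.2 2)).reverse).prod = 1) :
    T.IsDecoration D := by
  refine ⟨g, x, hg, fun Δ i => ⟨hx Δ i, fun y hy => ?_⟩, he⟩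
  obtain ⟨τ, h⟩ := hτ Δ
  obtain ⟨τ', h'⟩ := hτ (T.nbr Δ i)
  obtain ⟨π, -, hπ⟩ := exists_perm (add_one_ne i)
  have h1 := glue_cochain hP h h' hy hπ
  rw [← glue_cochain hP h h' (hx Δ i) hπ] at h1
  exact mul_right_cancel h1

theorem exists_cochain_of_decMk (hP : IsNaturality P) {D : Decoration H}
    (hD : ∃ p τ, decMk p = D ∧ P p τ) {g : Fin 4 → G ⧸ H} (hg : decMk g = D) : ∃ τ, P g τ := by
  obtain ⟨p, τ, rfl, h⟩ := hD
  obtain ⟨x, rfl⟩ := decMk_eq_iff.1 hg.symm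
  exact ⟨_, hP.smul x h⟩

theorem short_edge_eq (x : T.Simplex → Fin 4 → G) (τ : T.Simplex → Perm (Fin 4) → G)
    (hx : ∀ Δ π, x Δ (π 3) * τ Δ π = τ (T.nbr Δ (π 3)) (T.perm Δ (π 3) * π))
    (f : T.Simplex × Perm (Fin 4)) : (coboundary (τ f.1)).γ f.2 =
      (τ f.1 f.2)⁻¹ * (x f.1 (f.2 2))⁻¹ * τ (T.turn f).1 (T.turn f).2 := by
  have h := hx f.1 (f.2 * sS)
  rw [Perm.mul_apply, sS_three] at h
  rw [coboundary_γ]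
  change _ = _ * τ (T.nbr f.1 (f.2 2)) (T.perm f.1 (f.2 2) * (f.2 * sS))
  rw [← h]
  group

/-- Decorations correspond to cocycles: a tuple of decorations of the simplices is a decoration of
the triangulation if and only if the natural cocycles fit together. -/
theorem isDecoration_iff_isCocycle (hP : IsNaturality P) {D : T.Simplex → Decoration H}
    (hD : ∀ Δ, ∃ p τ, decMk p = D Δ ∧ P p τ) :
    T.IsDecoration D ↔ T.IsCocycle fun Δ => natCocycle P (D Δ) := by
  constructor
  · rintro ⟨g, x, hg, hx, he⟩
    choose τ hτ using fun Δ => exists_cochain_of_decMk hP (hD Δ) (hg Δ)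
    have hc : (fun Δ => natCocycle P (D Δ)) = fun Δ => coboundary (τ Δ) := by
      funext Δ
      rw [← hg Δ, hP.natCocycle_eq (hτ Δ)]
    have hx' : ∀ Δ (π : Perm (Fin 4)),
        x Δ (π 3) * τ Δ π = τ (T.nbr Δ (π 3)) (T.perm Δ (π 3) * π) := fun Δ π =>
      glue_cochain hP (hτ Δ) (hτ _) (hx Δ (π 3)).1 rfl
    rw [hc]
    refine ⟨fun Δ π => ?_, fun f => ?_⟩
    · have h1 := hx' Δ (π * sL)
      have h2 := hx' Δ (π * sM)
      rw [sL_apply_three] at h1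
      rw [sM_apply_three] at h2
      simp only [coboundary_α, coboundary_β, mul_assoc]
      rw [← hx', ← h1, ← h2]
      constructor <;> group
    · rw [prod_short_edges_eq_one (F := fun f => τ f.1 f.2) (X := fun f => x f.1 (f.2 2))
        (short_edge_eq x τ hx')]
      exact he f
  · intro hC
    choose g τ hg hτ using hD
    have hc : (fun Δ => natCocycle P (D Δ)) = fun Δ => coboundary (τ Δ) := by
      funext Δ
      rw [← hg Δ, hP.natCocycle_eq (hτ Δ)]
    rw [hc] at hC
    obtain ⟨hC1, hC2⟩ := hC
    choose π₀ _ hπ₀ using fun i : Fin 4 => exists_perm (add_one_ne i)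
    -- The gluing element of a face read off from the cochains at a flag of the face. It does not
    -- depend on the flag because the labels of the long and middle edges of the face agree.
    let E : T.Simplex → Fin 4 → Perm (Fin 4) → G := fun Δ i π =>
      τ (T.nbr Δ i) (T.perm Δ i * π) * (τ Δ π)⁻¹
    have hEL : ∀ Δ (π : Perm (Fin 4)), E Δ (π 3) (π * sL) = E Δ (π 3) π := by
      intro Δ π
      have h := (hC1 Δ π).1
      simp only [coboundary_α, mul_assoc] at h
      simp only [E]
      rw [mul_inv_eq_iff_eq_mul, mul_assoc, h]
      group
    have hEM : ∀ Δ (π : Perm (Fin 4)), E Δ (π 3) (π * sM) = E Δ (π 3) π := by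
      intro Δ π
      have h := (hC1 Δ π).2
      simp only [coboundary_β, mul_assoc] at h
      simp only [E]
      rw [mul_inv_eq_iff_eq_mul, mul_assoc, h]
      group
    have hE : ∀ Δ (π π' : Perm (Fin 4)), π' 3 = π 3 → E Δ (π 3) π' = E Δ (π 3) π := by
      intro Δ π π' h
      have hρ : (π⁻¹ * π') 3 = 3 := by
        simp [Perm.mul_apply, h]
      have hπ' : π' = π * (π⁻¹ * π') := (mul_inv_cancel_left _ _).symm
      have aL : ∀ ρ : Perm (Fin 4), ρ 3 = π 3 → E Δ (π 3) (ρ * sL) = E Δ (π 3) ρ := by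
        intro ρ h
        rw [← h]
        exact hEL Δ ρ
      have aM : ∀ ρ : Perm (Fin 4), ρ 3 = π 3 → E Δ (π 3) (ρ * sM) = E Δ (π 3) ρ := by
        intro ρ h
        rw [← h]
        exact hEM Δ ρ
      rw [hπ']
      have b1 := sL_apply_three π
      have b2 := sM_apply_three π
      have b3 := (sM_apply_three (π * sL)).trans b1
      rcases perm_eq_or_of_three hρ with h | h | h | h | h | h <;>
        rw [h] <;> try simp only [← mul_assoc, mul_one]
      · exact aL _ rfl
      · exact aM _ rfl
      · rw [aM _ b1, aL _ rfl]
      · rw [aL _ b2, aM _ rfl]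
      · rw [aL _ b3, aM _ b1, aL _ rfl]
    let x : T.Simplex → Fin 4 → G := fun Δ i => E Δ i (π₀ i)
    have hx' : ∀ Δ (π : Perm (Fin 4)),
        x Δ (π 3) * τ Δ π = τ (T.nbr Δ (π 3)) (T.perm Δ (π 3) * π) := by
      intro Δ π
      have h := hE Δ π (π₀ (π 3)) (hπ₀ _)
      change E Δ (π 3) (π₀ (π 3)) * _ = _
      rw [h, inv_mul_cancel_right]
    refine isDecoration_of_glue hP (g := g) (x := x) hg (fun Δ => ⟨_, hτ Δ⟩) (fun Δ i v hv => ?_)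
      fun f => ?_
    · obtain ⟨π, rfl, rfl⟩ := exists_perm hv
      have h1 := hP.coset (hτ (T.nbr Δ (π 3))) (T.perm Δ (π 3) * π)
      rw [Perm.mul_apply] at h1
      rw [h1, ← hx', hP.coset (hτ Δ) π]
      rfl
    · have h := hC2 f
      rwa [prod_short_edges_eq_one (F := fun f => τ f.1 f.2) (X := fun f => x f.1 (f.2 2))
        (short_edge_eq x τ hx')] at h

/-- Reordering the simplices relabels the flags, compatibly with going around edges. -/
theorem cycle_reorder (ρ : T.Simplex → Perm (Fin 4)) (f : T.Simplex × Perm (Fin 4)) :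
    ((T.reorder ρ).cycle f).map (fun f' => ((f'.1, ρ f'.1 * f'.2) : T.Simplex × Perm (Fin 4))) =
      T.cycle (f.1, ρ f.1 * f.2) := by
  let Φ : T.Simplex × Perm (Fin 4) → T.Simplex × Perm (Fin 4) := fun f' => (f'.1, ρ f'.1 * f'.2)
  have hΦ : Function.Injective Φ := by
    rintro ⟨Δ, π⟩ ⟨Δ', π'⟩ h
    obtain ⟨h1, h2⟩ := Prod.mk.inj h
    dsimp only at h1 h2
    subst h1
    rw [mul_left_cancel h2]
  let t : T.Simplex × Perm (Fin 4) → T.Simplex × Perm (Fin 4) := (T.reorder ρ).turn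
  have hs : ∀ f', Φ (t f') = T.turn (Φ f') := by
    rintro ⟨Δ, π⟩
    refine Prod.ext rfl ?_
    change ρ _ * ((ρ (T.nbr Δ (ρ Δ (π 2))))⁻¹ * T.perm Δ (ρ Δ (π 2)) * ρ Δ * (π * sS)) =
      T.perm Δ ((ρ Δ * π) 2) * (ρ Δ * π * sS)
    rw [Perm.mul_apply]
    change ρ (T.nbr Δ (ρ Δ (π 2))) * _ = _
    group
  have hi : ∀ j f', Φ (t^[j] f') = T.turn^[j] (Φ f') := by
    intro j
    induction j with
    | zero => exact fun _ => rfl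
    | succ j ih =>
      intro f'
      rw [Function.iterate_succ_apply, Function.iterate_succ_apply, ih, hs]
  have hp : Function.minimalPeriod t f = Function.minimalPeriod T.turn (Φ f) := by
    refine Function.minimalPeriod_eq_minimalPeriod_iff.2 fun k => ?_
    rw [Function.IsPeriodicPt, Function.IsPeriodicPt, Function.IsFixedPt, Function.IsFixedPt, ← hi]
    exact hΦ.eq_iff.symm
  change ((List.range (Function.minimalPeriod t f)).map fun j => t^[j] f).map Φ =
    (List.range (Function.minimalPeriod T.turn (Φ f))).map fun j => T.turn^[j] (Φ f)
  rw [List.map_map, hp]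
  exact List.map_congr_left fun j _ => hi j f

theorem isDecoration_reorder {D : T.Simplex → Decoration H} (hD : T.IsDecoration D)
    (ρ : T.Simplex → Perm (Fin 4)) :
    (T.reorder ρ).IsDecoration fun Δ => (D Δ).pullback (ρ Δ) := by
  obtain ⟨g, x, hg, hx, he⟩ := hD
  refine ⟨fun Δ v => g Δ (ρ Δ v), fun Δ i => x Δ (ρ Δ i), fun Δ => ?_, fun Δ i => ⟨?_, ?_⟩,
    fun f => ?_⟩
  · exact (decMk_pullback (ρ Δ) (g Δ)).symm.trans
      (congrArg (Decoration.pullback (ρ Δ)) (hg Δ))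
  · intro v hv
    refine ((hx Δ (ρ Δ i)).1 _ ((ρ Δ).injective.ne hv)).trans ?_
    change _ = g (T.nbr Δ (ρ Δ i)) (ρ (T.nbr Δ (ρ Δ i)) (((ρ (T.nbr Δ (ρ Δ i)))⁻¹ *
      T.perm Δ (ρ Δ i) * ρ Δ) v))
    simp
  · intro y hy
    refine (hx Δ (ρ Δ i)).2 y fun v hv => ?_
    have h := hy ((ρ Δ)⁻¹ v) fun h => hv (by rw [← h]; simp)
    change y • g Δ (ρ Δ ((ρ Δ)⁻¹ v)) = g (T.nbr Δ (ρ Δ i)) (ρ (T.nbr Δ (ρ Δ i))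
      (((ρ (T.nbr Δ (ρ Δ i)))⁻¹ * T.perm Δ (ρ Δ i) * ρ Δ) ((ρ Δ)⁻¹ v))) at h
    simpa using h
  · have h := he (f.1, ρ f.1 * f.2)
    rw [← cycle_reorder ρ f, List.map_map] at h
    exact h

end

end Triangulation

/-! ### Agreement on faces -/

/-- A determinant of columns does not involve the matrices that contribute no columns. -/
theorem cdet_congr {n : ℕ} {g g' : Fin 4 → Matrix (Fin n) (Fin n) ℂ} {t : Fin 4 → ℕ}
    (h : ∀ v, t v ≠ 0 → g v = g' v) : cdet g t = cdet g' t := by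
  have key : ∀ v, cols (g v) (t v) = cols (g' v) (t v) := by
    intro v
    by_cases hv : t v = 0
    · rw [hv]
      rfl
    · rw [h v hv]
  simp only [cdet, colList, key]

theorem detCoords_congr {n : ℕ} {g g' : Fin 4 → Matrix (Fin n) (Fin n) ℂ} {t : IntPt n}
    (h : ∀ v, t.1 v ≠ 0 → g v = g' v) : detCoords g t = detCoords g' t :=
  (det_concat g t.1 t.2.1).trans ((cdet_congr h).trans (det_concat g' t.1 t.2.1).symm)

theorem val_eq_of_face {n : ℕ} {c c' : PtolemyFun n} {i : Fin 4}
    (h : ∀ t : IntPt n, t.1 i = 0 → c' t = c t) {t : Fin 4 → ℕ} (ht : t i = 0) :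
    c'.val t = c.val t := by
  unfold PtolemyFun.val
  split_ifs with h'
  · exact h ⟨t, h'⟩ ht
  · rfl

theorem comb_apply_three (π : Perm (Fin 4)) (a b c : ℕ) :
    comb (π 0) (π 1) (π 2) a b c (π 3) = 0 := by
  simp [comb]

theorem eq_comb (π : Perm (Fin 4)) {t : Fin 4 → ℕ} (h : t (π 3) = 0) :
    t = comb (π 0) (π 1) (π 2) (t (π 0)) (t (π 1)) (t (π 2)) := by
  funext v
  obtain ⟨j, rfl⟩ := π.surjective v
  fin_cases j <;> simp [comb, h]

theorem diamondAt_congr {n : ℕ} {c c' : PtolemyFun n} {π : Perm (Fin 4)}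
    (h : ∀ t, t (π 3) = 0 → c'.val t = c.val t) (k i : ℕ) :
    diamondAt c' π k i = diamondAt c π k i := by
  have e : ∀ a b d a' b' d' : ℕ, c'.val (comb (π 0) (π 1) (π 2) a b d +
      comb (π 0) (π 1) (π 2) a' b' d') = c.val (comb (π 0) (π 1) (π 2) a b d +
      comb (π 0) (π 1) (π 2) a' b' d') := fun a b d a' b' d' =>
    h _ (by rw [Pi.add_apply, comb_apply_three, comb_apply_three])
  simp only [diamondAt, diamond, e]

/-- The labels of the edges of a face are determined by the Ptolemy coordinates on that face. -/
theorem face_labels_eq {n : ℕ} {c c' : PtolemyFun n} {σ σ' : Cocycle (SLn n)}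
    (hσ : IsPtolemyFormula c σ) (hσ' : IsPtolemyFormula c' σ') {π : Perm (Fin 4)}
    (h : ∀ t, t (π 3) = 0 → c'.val t = c.val t) : σ.α π = σ'.α π ∧ σ.β π = σ'.β π := by
  have hα : ∀ ρ : Perm (Fin 4), ρ 3 = π 3 → ρ 0 < ρ 1 → σ.α ρ = σ'.α ρ := by
    intro ρ hρ hlt
    refine Subtype.ext (((hσ ρ).1 hlt).trans (Eq.trans ?_ ((hσ' ρ).1 hlt).symm))
    rw [← hρ] at h
    have e : ∀ a b : ℕ, c'.val (comb (ρ 0) (ρ 1) (ρ 2) a b 0) =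
      c.val (comb (ρ 0) (ρ 1) (ρ 2) a b 0) := fun a b => h _ (comb_apply_three ..)
    simp only [longMat, e]
  constructor
  · rcases lt_or_gt_of_ne (show π 0 ≠ π 1 by simp) with hlt | hlt
    · exact hα π rfl hlt
    · have h1 := hα (π * sL) (Triangulation.sL_apply_three π) (by
        rw [Perm.mul_apply, Perm.mul_apply, sL_zero, sL_one]
        exact hlt)
      rw [σ.α_rev, σ'.α_rev] at h1
      exact inv_injective h1
  · refine Subtype.ext ((hσ π).2.1.trans (Eq.trans ?_ (hσ' π).2.1.symm))
    simp only [middleMat, diamondAt_congr h]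

/-- Decorations whose restrictions to a face are related by an element of `SL(n, ℂ)` have the same
Ptolemy coordinates on that face. -/
theorem ptolemyOf_face {n : ℕ} {p p' : Fin 4 → SLn n ⧸ N n} {x : SLn n} {ρ : Perm (Fin 4)}
    {i : Fin 4} (hx : ∀ v, v ≠ i → x • p v = p' (ρ v)) {t : IntPt n} (ht : t.1 i = 0) :
    (ptolemyOf (decMk p')).pullback ρ t = ptolemyOf (decMk p) t := by
  obtain ⟨g, rfl⟩ := exists_lift p
  obtain ⟨g', rfl⟩ := exists_lift p'
  let k : Fin 4 → SLn n := Function.update (fun v => g' (ρ v)) i (x * g i)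
  have hk : dec (N n) g = dec (N n) k := by
    refine dec_eq_iff.2 ⟨x, fun v => ?_⟩
    by_cases hv : v = i
    · subst hv
      exact ⟨1, one_mem _, by simp [k]⟩
    · have h : ((x * g v : SLn n) : SLn n ⧸ N n) = g' (ρ v) := hx v hv
      refine ⟨_, QuotientGroup.eq.1 h, ?_⟩
      simp only [k]
      rw [Function.update_of_ne hv, mul_inv_cancel_left]
  have h1 : ptolemyOf (dec (N n) g) = detCoords fun v => (k v).1 := by rw [hk, ptolemyOf_dec]
  have h2 : (ptolemyOf (dec (N n) g')).pullback ρ = detCoords fun v => (g' (ρ v)).1 := by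
    rw [ptolemyOf_dec]
    exact (detCoords_comp (fun v => (g' v).1) ρ).symm
  refine (congrFun h2 t).trans (Eq.trans ?_ (congrFun h1 t).symm)
  refine detCoords_congr fun v hv => ?_
  have hv' : v ≠ i := by
    rintro rfl
    exact hv ht
  simp only [k]
  rw [Function.update_of_ne hv']

namespace Triangulation

variable {T : Triangulation} {n : ℕ}

theorem genericSL_iff {D : T.Simplex → Decoration (N n)}
    (hD : ∀ Δ, D Δ ∈ PtolemyShape.genericSL n) :
    T.IsDecoration D ↔ T.IsCocycle fun Δ => cocycleSL (D Δ) :=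
  isDecoration_iff_isCocycle (isNaturality_SL n) fun Δ => exists_isNatSL (hD Δ)

theorem bijOn_cocycleSL : Set.BijOn (fun (D : T.Simplex → Decoration (N n)) Δ => cocycleSL (D Δ))
    (T.genericSL n) (T.naturalSL n) := by
  have hb := PtolemyShape.bijOn_cocycleSL n
  refine ⟨fun D hD => ⟨(genericSL_iff hD.2).1 hD.1, fun Δ => hb.mapsTo (hD.2 Δ)⟩,
    fun D hD D' hD' h => funext fun Δ => hb.injOn (hD.2 Δ) (hD'.2 Δ) (congrFun h Δ), fun σ hσ => ?_⟩
  choose D hD h using fun Δ => hb.surjOn (hσ.2 Δ)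
  obtain rfl : (fun Δ => cocycleSL (D Δ)) = σ := funext h
  exact ⟨D, ⟨(genericSL_iff hD).2 hσ.1, hD⟩, rfl⟩

theorem bijOn_ptolemyOf : Set.BijOn (fun (D : T.Simplex → Decoration (N n)) Δ => ptolemyOf (D Δ))
    (T.genericSL n) (T.ptolemySet n) := by
  have hb := PtolemyShape.bijOn_ptolemyOf n
  refine ⟨fun D hD => ⟨fun Δ => hb.mapsTo (hD.2 Δ), fun Δ i t ht => ?_⟩,
    fun D hD D' hD' h => funext fun Δ => hb.injOn (hD.2 Δ) (hD'.2 Δ) (congrFun h Δ), fun c hc => ?_⟩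
  · obtain ⟨g, x, hg, hx, -⟩ := hD.1
    have h := ptolemyOf_face (hx Δ i).1 ht
    rwa [hg, hg] at h
  · choose D hD h using fun Δ => hb.surjOn (hc.1 Δ)
    obtain rfl : (fun Δ => ptolemyOf (D Δ)) = c := funext h
    refine ⟨D, ⟨(genericSL_iff hD).2 ⟨fun Δ π => ?_, fun f => ?_⟩, hD⟩, rfl⟩
    · have h1 := isPtolemyFormula_SL
        (genericSL_pullback (hD (T.nbr Δ (π 3))) (T.perm Δ (π 3)))
      rw [ptolemyOf_pullback, cocycleSL_pullback (hD _)] at h1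
      exact face_labels_eq (isPtolemyFormula_SL (hD Δ)) h1
        fun t ht => val_eq_of_face (hc.2 Δ (π 3)) ht
    · refine List.prod_eq_one fun y hy => ?_
      obtain ⟨f', -, rfl⟩ := List.mem_map.1 hy
      exact (isPtolemyFormula_SL (hD f'.1) f'.2).2.2

end Triangulation

/-! ### Lifting flags of adjacent simplices -/

theorem slToPGL_surjective {n : ℕ} (hn : 0 < n) : Function.Surjective (slToPGL (n := n)) := by
  intro y
  obtain ⟨g, rfl⟩ := Matrix.ProjGenLinGroup.mk_surjective y
  obtain ⟨h, c, hc, hh⟩ := exists_sl_multiple hn g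
  exact ⟨h, ((isClassOf_pcl g).eq (isClassOf_slToPGL h) hc hh).symm⟩

theorem exists_sl_lift {n : ℕ} (hn : 0 < n) (p : Fin 4 → PGLn n ⧸ B n) :
    ∃ g : Fin 4 → SLn n, ∀ i, p i = ((slToPGL (g i) : PGLn n) : PGLn n ⧸ B n) := by
  obtain ⟨k, rfl⟩ := exists_lift p
  choose g hg using fun i => slToPGL_surjective hn (k i)
  exact ⟨g, fun i => by rw [hg]⟩

/-- Genericity only depends on the underlying flags. -/
theorem mem_genericSL_of_toFlags {n : ℕ} {D : Decoration (N n)} (hD : toFlags D ∈ genericPGL n) :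
    D ∈ genericSL n := by
  obtain ⟨h, rfl⟩ := dec_surjective D
  obtain ⟨g, hg, he⟩ := hD
  refine ⟨h, ?_, rfl⟩
  obtain ⟨x, b, hb, hd, hh⟩ := exists_upper_of_dec_eq (g := g)
    (g' := fun i => Matrix.SpecialLinearGroup.toGL (h i)) (he.trans (toFlags_dec h))
  have e : (fun i => (h i).1) = fun i => x.1 * (g i).1 * b i := funext hh
  rw [e, isGenericTuple_iff]
  rw [isGenericTuple_iff] at hg
  intro t ht
  rw [cdet_mul x.1 _ b hb ht]
  refine mul_ne_zero (mul_ne_zero (isClassOf_pcl x).det_ne_zero ?_) (hg t ht)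
  exact Finset.prod_ne_zero_iff.2 fun i _ => Finset.prod_ne_zero_iff.2 fun j _ =>
    dg_ne_zero (hb i) (hd i) j

/-- Decorations by flags which are related along a face lift to decorations by affine flags with
the same Ptolemy coordinates on that face. -/
theorem exists_affine_lift {n : ℕ} (hn : 0 < n) {p p' : Fin 4 → PGLn n ⧸ B n} {x : PGLn n}
    {ρ : Perm (Fin 4)} {i : Fin 4} (hp : decMk p ∈ genericPGL n) (hp' : decMk p' ∈ genericPGL n)
    (hx : ∀ v, v ≠ i → x • p v = p' (ρ v)) :
    ∃ E ∈ genericSL n, ∃ E' ∈ genericSL n, toFlags E = decMk p ∧ toFlags E' = decMk p' ∧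
      ∀ t : IntPt n, t.1 i = 0 → (ptolemyOf E').pullback ρ t = ptolemyOf E t := by
  obtain ⟨g, hg⟩ := exists_sl_lift hn (x • p)
  obtain ⟨g', hg'⟩ := exists_sl_lift hn p'
  let k : Fin 4 → SLn n := Function.update g i (g' (ρ i))
  have hk : ∀ v, p' (ρ v) = ((slToPGL (k v) : PGLn n) : PGLn n ⧸ B n) := by
    intro v
    by_cases hv : v = i
    · subst hv
      simp only [k]
      rw [Function.update_self, hg']
    · simp only [k]
      rw [Function.update_of_ne hv, ← hg, ← hx v hv]
      rfl
  have e1 : toFlags (dec (N n) g) = decMk p := by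
    rw [toFlags_dec]
    exact (congrArg decMk (funext hg).symm).trans (decMk_eq_iff.2 ⟨x⁻¹, by simp⟩)
  have e2 : toFlags (dec (N n) fun w => k (ρ⁻¹ w)) = decMk p' := by
    rw [toFlags_dec]
    refine congrArg decMk (funext fun w => ?_)
    have h := hk (ρ⁻¹ w)
    rw [show ρ (ρ⁻¹ w) = w by simp] at h
    exact h.symm
  refine ⟨dec (N n) g, mem_genericSL_of_toFlags (by rwa [e1]), dec (N n) fun w => k (ρ⁻¹ w),
    mem_genericSL_of_toFlags (by rwa [e2]), e1, e2, fun t ht => ?_⟩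
  rw [ptolemyOf_dec, ptolemyOf_dec, ← detCoords_comp]
  refine detCoords_congr fun v hv => ?_
  have hv' : v ≠ i := by
    rintro rfl
    exact hv ht
  simp [k, hv']

/-! ### Generalized gluing equations -/

/-- The product of the shape parameters at a point in the interior of a face is an `X`-coordinate,
which only depends on the Ptolemy coordinates of the face. -/
theorem shapeProd_mu_congr {n : ℕ} {c c' : PtolemyFun n} (hc : c ∈ ptolemySet n)
    (hc' : c' ∈ ptolemySet n) {π : Perm (Fin 4)} (h : ∀ t, t (π 3) = 0 → c'.val t = c.val t)
    {i k : ℕ} (hi : 1 ≤ i) (hk : 1 ≤ k) (hik : i + k + 1 ≤ n) :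
    shapeProd (mu c') (comb (π 0) (π 1) (π 2) i (n - k - i) k) =
      shapeProd (mu c) (comb (π 0) (π 1) (π 2) i (n - k - i) k) := by
  have key : ∀ {c : PtolemyFun n}, c ∈ ptolemySet n →
      shapeProd (mu c) (comb (π 0) (π 1) (π 2) i (n - k - i) k) ^ ((Perm.sign π : ℤˣ) : ℤ) =
        -(diamondAt c π (k + 1) i / diamondAt c π k i) := by
    intro c hc
    have h1 := xCoord_mu (pullback_mem_ptolemySet hc π).1 hk hi hik
    rw [diamondAt_pullback π c (by omega) hi (by omega), diamondAt_pullback π c hk hi (by omega),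
      mu_pullback hc, xCoord, shapeProd_pullback, permPt_comb] at h1
    rw [← h1, neg_neg]
  have h2 := (key hc').trans (Eq.trans (by rw [diamondAt_congr h, diamondAt_congr h]) (key hc).symm)
  rcases Int.units_eq_one_or (Perm.sign π) with hs | hs
  · simpa [hs] using h2
  · simpa [hs] using h2

theorem shapeProd_edge_comb {n : ℕ} (z : ShapeFun n) (π : Perm (Fin 4)) {a b : ℕ}
    (h : a + b + 2 = n) : shapeProd z (comb (π 0) (π 1) (π 2) (a + 1) (b + 1) 0) =
      z.val (comb (π 0) (π 1) (π 2) a b 0) (comb (π 0) (π 1) (π 2) 1 1 0) := by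
  have h1 := shapeProd_edge (z.pullback π) (u := comb 0 1 2 a b 0) (by simp [comb])
    (by simp [comb]) (by rw [sum_comb]; omega)
  have e : (![1, 1, 0, 0] : Fin 4 → ℕ) = comb 0 1 2 1 1 0 := (comb_std 1 1 0).symm
  rw [e, comb_add, shapeProd_pullback, ShapeFun.val_pullback, permPt_comb, permPt_comb,
    permPt_comb] at h1
  rcases Int.units_eq_one_or (Perm.sign π) with hs | hs
  · simpa [hs] using h1
  · simpa [hs] using h1

theorem IntPt.act_mul {n : ℕ} (σ ρ : Perm (Fin 4)) (t : IntPt n) :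
    (t.act ρ).act σ = t.act (σ * ρ) := rfl

theorem IntPt.act_one {n : ℕ} (t : IntPt n) : t.act 1 = t := rfl

theorem IntPt.act_apply {n : ℕ} (σ : Perm (Fin 4)) (t : IntPt n) (i : Fin 4) :
    (t.act σ).1 (σ i) = t.1 i := by
  change t.1 (σ.symm (σ i)) = _
  rw [Equiv.symm_apply_apply]

namespace Triangulation

variable {T : Triangulation} {n : ℕ}

theorem glued_symm {x y : T.Simplex × IntPt n} (h : T.Glued n x y) : T.Glued n y x := by
  obtain ⟨i, hi, rfl⟩ := h
  refine ⟨T.perm x.1 i i, (IntPt.act_apply _ _ _).trans hi, ?_⟩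
  simp only [T.nbr_nbr, T.perm_nbr, IntPt.act_mul, inv_mul_cancel, IntPt.act_one]

open Classical in
/-- A criterion for a finite set to be an equivalence class of glued points. -/
theorem filter_eqvGen {p : T.Simplex × IntPt n} {S : Finset (T.Simplex × IntPt n)} (hp : p ∈ S)
    (hS : ∀ x ∈ S, ∀ y, T.Glued n x y → y ∈ S)
    (hr : ∀ x ∈ S, Relation.EqvGen (T.Glued n) p x) :
    Finset.univ.filter (fun x => Relation.EqvGen (T.Glued n) p x) = S := by
  ext x
  rw [Finset.mem_filter]
  refine ⟨fun h => ?_, fun h => ⟨Finset.mem_univ _, hr x h⟩⟩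
  have key : ∀ x y, Relation.EqvGen (T.Glued n) x y → (x ∈ S ↔ y ∈ S) := by
    intro x y h
    induction h with
    | rel x y h => exact ⟨fun hx => hS x hx y h, fun hy => hS y hy x (glued_symm h)⟩
    | refl => exact Iff.rfl
    | symm _ _ _ ih => exact ih.symm
    | trans _ _ _ _ _ ih1 ih2 => exact ih1.trans ih2
  exact (key p x h.2).1 hp

open Classical in
/-- The left hand side of the generalized gluing equation at an integral point. -/
noncomputable def gluingProd (z : T.Simplex → ShapeFun n) (p : T.Simplex × IntPt n) : ℂ :=
  ∏ x ∈ Finset.univ.filter (fun x => Relation.EqvGen (T.Glued n) p x),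
    shapeProd (z x.1) x.2.1 ^ ((T.orient x.1 : ℤˣ) : ℤ)

theorem zpow_unit_eq_one_iff (a : ℂ) (u : ℤˣ) : a ^ (u : ℤ) = 1 ↔ a = 1 := by
  rcases Int.units_eq_one_or u with rfl | rfl <;> simp

theorem gluingProd_interior (z : T.Simplex → ShapeFun n) (p : T.Simplex × IntPt n)
    (hp : ∀ i, p.2.1 i ≠ 0) : gluingProd z p = 1 ↔ shapeProd (z p.1) p.2.1 = 1 := by
  classical
  rw [gluingProd, filter_eqvGen (S := {p}) (Finset.mem_singleton_self p), Finset.prod_singleton,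
    zpow_unit_eq_one_iff]
  · intro x hx y ⟨i, hi, _⟩
    rw [Finset.mem_singleton.1 hx] at hi
    exact absurd hi (hp i)
  · intro x hx
    rw [Finset.mem_singleton.1 hx]
    exact Relation.EqvGen.refl _

/-- At a point in the interior of a face, the gluing equation says that the products of the shape
parameters on the two sides agree. -/
theorem gluingProd_face (z : T.Simplex → ShapeFun n) (p : T.Simplex × IntPt n) {i : Fin 4}
    (hi : p.2.1 i = 0) (hp : ∀ j, j ≠ i → p.2.1 j ≠ 0) (h0 : shapeProd (z p.1) p.2.1 ≠ 0) :
    gluingProd z p = 1 ↔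
      shapeProd ((z (T.nbr p.1 i)).pullback (T.perm p.1 i)) p.2.1 = shapeProd (z p.1) p.2.1 := by
  classical
  obtain ⟨Δ, t⟩ := p
  dsimp only at hi hp h0 ⊢
  let p' : T.Simplex × IntPt n := (T.nbr Δ i, t.act (T.perm Δ i))
  have hg : T.Glued n (Δ, t) p' := ⟨i, hi, rfl⟩
  have honly : ∀ y, T.Glued n (Δ, t) y → y = p' := by
    rintro y ⟨j, hj, rfl⟩
    obtain rfl : j = i := by
      by_contra hji
      exact hp j hji hj
    rfl
  have honly' : ∀ y, T.Glued n p' y → y = (Δ, t) := by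
    rintro y ⟨j, hj, rfl⟩
    obtain ⟨k, rfl⟩ := (T.perm Δ i).surjective j
    obtain rfl : k = i := by
      by_contra hki
      exact hp k hki ((IntPt.act_apply (T.perm Δ i) t k).symm.trans hj)
    simp only [p', T.nbr_nbr, T.perm_nbr, IntPt.act_mul, inv_mul_cancel, IntPt.act_one]
  have hne : (Δ, t) ≠ p' := by
    intro h
    obtain ⟨h1, h2⟩ := Prod.mk.inj h
    refine T.ne_self Δ i ⟨h1.symm, ?_⟩
    by_contra hji
    refine hp _ hji ?_
    rw [h2, IntPt.act_apply]
    exact hi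
  rw [gluingProd, filter_eqvGen (S := {(Δ, t), p'}) (Finset.mem_insert_self _ _),
    Finset.prod_pair hne]
  · simp only [p', T.orient_nbr, shapeProd_pullback]
    change _ * shapeProd (z (T.nbr Δ i)) (permPt (T.perm Δ i) t.1) ^ _ = 1 ↔ _
    set A := shapeProd (z Δ) t.1
    set A' := shapeProd (z (T.nbr Δ i)) (permPt (T.perm Δ i) t.1)
    rcases Int.units_eq_one_or (T.orient Δ) with ho | ho <;>
      rcases Int.units_eq_one_or (Perm.sign (T.perm Δ i)) with hs | hs <;>
      simp only [ho, hs, mul_one, mul_neg, neg_neg, Units.val_one, Units.val_neg, zpow_one,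
        _root_.zpow_neg]
    · exact ⟨fun h => eq_comm.1 ((mul_inv_eq_one₀ (by rintro h'; simp [h'] at h)).1 h),
        fun h => by rw [h, mul_inv_cancel₀ h0]⟩
    · rw [inv_eq_iff_eq_inv, mul_comm, mul_eq_one_iff_eq_inv₀ h0]
    · rw [inv_mul_eq_one₀ h0, eq_comm]
    · rw [← mul_inv, inv_eq_one, mul_comm, mul_eq_one_iff_eq_inv₀ h0, inv_eq_iff_eq_inv]
  · intro x hx y hy
    rcases Finset.mem_insert.1 hx with rfl | hx
    · rw [honly y hy]
      exact Finset.mem_insert_of_mem (Finset.mem_singleton_self _)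
    · rw [Finset.mem_singleton.1 hx] at hy
      rw [honly' y hy]
      exact Finset.mem_insert_self _ _
  · intro x hx
    rcases Finset.mem_insert.1 hx with rfl | hx
    · exact Relation.EqvGen.refl _
    · rw [Finset.mem_singleton.1 hx]
      exact Relation.EqvGen.rel _ _ hg

/-- The orientation of a flag in the manifold is preserved by `turn`. -/
theorem orient_turn (f : T.Simplex × Perm (Fin 4)) :
    T.orient (T.turn f).1 * Perm.sign (T.turn f).2 = T.orient f.1 * Perm.sign f.2 := by
  obtain ⟨Δ, π⟩ := f
  simp only [turn, T.orient_nbr, Perm.sign_mul]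
  have hs : Perm.sign sS = -1 := by decide
  rw [hs]
  rcases Int.units_eq_one_or (Perm.sign (T.perm Δ (π 2))) with h | h <;> simp [h]

theorem orient_iterate (f : T.Simplex × Perm (Fin 4)) (k : ℕ) :
    T.orient (T.turn^[k] f).1 * Perm.sign (T.turn^[k] f).2 = T.orient f.1 * Perm.sign f.2 := by
  induction k with
  | zero => rfl
  | succ k ih => rw [Function.iterate_succ_apply', orient_turn, ih]

/-- The same simplex, with the two pairs of vertices swapped. -/
def halfTurn (f : T.Simplex × Perm (Fin 4)) : T.Simplex × Perm (Fin 4) := (f.1, f.2 * (sL * sS))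

theorem turn_halfTurn (f : T.Simplex × Perm (Fin 4)) :
    T.turn (halfTurn f) = halfTurn (T.unturn f) := by
  obtain ⟨Δ, π⟩ := f
  have e : (π * (sL * sS)) 2 = π 3 := by
    rw [Perm.mul_apply]
    rfl
  have e' : sL * sS = sS * sL := by decide
  simp only [turn, halfTurn, unturn, e]
  rw [e']
  simp only [mul_assoc]
  rw [e']

theorem halfTurn_ne (f : T.Simplex × Perm (Fin 4)) : halfTurn f ≠ f := by
  intro h
  have h1 : sL * sS = 1 := mul_eq_left.1 (Prod.mk.inj h).2
  revert h1
  decide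

theorem halfTurn_ne_turn (f : T.Simplex × Perm (Fin 4)) : halfTurn f ≠ T.turn f := by
  obtain ⟨Δ, π⟩ := f
  intro h
  obtain ⟨h1, h2⟩ := Prod.mk.inj h
  refine T.ne_self Δ (π 2) ⟨h1.symm, ?_⟩
  dsimp only at h2
  rw [← mul_assoc, ← mul_assoc] at h2
  have h3 := congrArg (fun ρ => ρ 2) (mul_right_cancel h2)
  simp only [Perm.mul_apply] at h3
  exact h3.symm

/-- Going around an edge, it is not met again in the opposite direction. A half turn reverses the
sense of going around, so if it were an iterate, the flag halfway would be fixed by the half turn,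
for even `k`, or a face would be glued to itself, for odd `k`. -/
theorem halfTurn_ne_iterate (f : T.Simplex × Perm (Fin 4)) (k : ℕ) :
    T.turn^[k] f ≠ halfTurn f := by
  have hJ : ∀ i f', T.turn^[i] (halfTurn (T.turn^[i] f')) = halfTurn f' := by
    intro i
    induction i with
    | zero => exact fun _ => rfl
    | succ i ih =>
      intro f'
      rw [Function.iterate_succ_apply, Function.iterate_succ_apply', turn_halfTurn, unturn_turn, ih]
  intro h
  rcases Nat.even_or_odd' k with ⟨i, rfl | rfl⟩
  · rw [two_mul, Function.iterate_add_apply, ← hJ i f] at h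
    exact halfTurn_ne _ ((T.turn_injective.iterate i) h).symm
  · rw [two_mul, Nat.add_assoc, Function.iterate_add_apply, Function.iterate_succ_apply',
      ← hJ i f] at h
    exact halfTurn_ne_turn _ ((T.turn_injective.iterate i) h).symm

theorem mem_cycle_iff {f f' : T.Simplex × Perm (Fin 4)} :
    f' ∈ T.cycle f ↔ ∃ k, T.turn^[k] f = f' := by
  have hm := Function.minimalPeriod_pos_of_mem_periodicPts (T.mem_periodicPts_turn f)
  constructor
  · intro h
    obtain ⟨k, -, rfl⟩ := List.mem_map.1 h
    exact ⟨k, rfl⟩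
  · rintro ⟨k, rfl⟩
    refine List.mem_map.2 ⟨k % Function.minimalPeriod T.turn f,
      List.mem_range.2 (Nat.mod_lt _ hm), ?_⟩
    exact Function.iterate_mod_minimalPeriod_eq

theorem turn_mem_cycle {f f' : T.Simplex × Perm (Fin 4)} (h : f' ∈ T.cycle f) :
    T.turn f' ∈ T.cycle f := by
  obtain ⟨k, rfl⟩ := mem_cycle_iff.1 h
  exact mem_cycle_iff.2 ⟨k + 1, Function.iterate_succ_apply' ..⟩

theorem unturn_mem_cycle {f f' : T.Simplex × Perm (Fin 4)} (h : f' ∈ T.cycle f) :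
    T.unturn f' ∈ T.cycle f := by
  obtain ⟨k, rfl⟩ := mem_cycle_iff.1 h
  have hm := Function.minimalPeriod_pos_of_mem_periodicPts (T.mem_periodicPts_turn f)
  obtain ⟨m, hm'⟩ := Nat.exists_eq_succ_of_ne_zero hm.ne'
  refine mem_cycle_iff.2 ⟨k + m, T.turn_injective ?_⟩
  rw [turn_unturn, ← Function.iterate_succ_apply' T.turn, ← Nat.add_succ, ← hm',
    Function.iterate_add_minimalPeriod_eq]

/-- The point `a v₀ + b v₁` on the first edge of a flag. -/
def edgePoint {a b : ℕ} (ha : 0 < a) (hb : 0 < b) (h : a + b = n)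
    (f : T.Simplex × Perm (Fin 4)) : T.Simplex × IntPt n :=
  (f.1, ⟨comb (f.2 0) (f.2 1) (f.2 2) a b 0, by rw [sum_comb]; omega, fun i => by
    obtain ⟨j, rfl⟩ := f.2.surjective i
    fin_cases j <;> simp [comb] <;> omega⟩)

section

variable {a b : ℕ} (ha : 0 < a) (hb : 0 < b) (h : a + b = n)

/-- A point on an edge is glued to its two neighbours in the cycle around the edge. -/
theorem glued_edgePoint_iff (f : T.Simplex × Perm (Fin 4)) (y : T.Simplex × IntPt n) :
    T.Glued n (edgePoint ha hb h f) y ↔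
      y = edgePoint ha hb h (T.turn f) ∨ y = edgePoint ha hb h (T.unturn f) := by
  obtain ⟨Δ, π⟩ := f
  have e2 : ((T.nbr Δ (π 2), (edgePoint ha hb h (Δ, π)).2.act (T.perm Δ (π 2))) :
      T.Simplex × IntPt n) = edgePoint ha hb h (T.turn (Δ, π)) := by
    refine Prod.ext rfl (Subtype.ext ?_)
    change permPt _ (comb (π 0) (π 1) (π 2) a b 0) = _
    rw [permPt_comb]
    simp [edgePoint, turn, comb, sS_zero, sS_one]
  have e3 : ((T.nbr Δ (π 3), (edgePoint ha hb h (Δ, π)).2.act (T.perm Δ (π 3))) :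
      T.Simplex × IntPt n) = edgePoint ha hb h (T.unturn (Δ, π)) := by
    refine Prod.ext rfl (Subtype.ext ?_)
    change permPt _ (comb (π 0) (π 1) (π 2) a b 0) = _
    rw [permPt_comb]
    simp [edgePoint, unturn, comb, sS_zero, sS_one]
  rw [← e2, ← e3]
  constructor
  · rintro ⟨i, hi, rfl⟩
    obtain ⟨j, rfl⟩ := π.surjective i
    change comb (π 0) (π 1) (π 2) a b 0 (π j) = 0 at hi
    fin_cases j
    · simp [comb] at hi
      omega
    · simp [comb] at hi
      omega
    · exact Or.inl rfl
    · exact Or.inr rfl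
  · rintro (rfl | rfl)
    · refine ⟨π 2, ?_, rfl⟩
      change comb (π 0) (π 1) (π 2) a b 0 (π 2) = 0
      simp [comb]
    · exact ⟨π 3, comb_apply_three .., rfl⟩

/-- Flags met while going around an edge are determined by the points they mark on it. All of them have
the same orientation, so two flags marking the same point differ at most by a half turn. -/
theorem edgePoint_injOn {f f' : T.Simplex × Perm (Fin 4)} {k : ℕ} (hk : T.turn^[k] f = f')
    (he : edgePoint ha hb h f = edgePoint ha hb h f') : f = f' := by
  have ho := orient_iterate f k
  have hJ := halfTurn_ne_iterate f k
  rw [hk] at ho hJ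
  obtain ⟨Δ, π⟩ := f
  obtain ⟨Δ', π'⟩ := f'
  obtain ⟨rfl, h2⟩ := Prod.mk.inj he
  have h3 : comb (π 0) (π 1) (π 2) a b 0 = comb (π' 0) (π' 1) (π' 2) a b 0 :=
    congrArg Subtype.val h2
  obtain ⟨ρ, rfl⟩ : ∃ ρ, π' = π * ρ := ⟨π⁻¹ * π', (mul_inv_cancel_left _ _).symm⟩
  have hs : Perm.sign ρ = 1 := by
    simpa [Perm.sign_mul] using ho
  have h4 : ∀ j, comb (π 0) (π 1) (π 2) a b 0 (π j) =
      comb ((π * ρ) 0) ((π * ρ) 1) ((π * ρ) 2) a b 0 (π j) := fun j => by rw [h3]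
  have h50 := h4 0
  have h51 := h4 1
  simp only [comb, Pi.add_apply, Pi.single_apply, Perm.mul_apply, π.injective.eq_iff] at h50 h51
  have h6 : ρ = 1 ∨ ρ = sL * sS := by
    have hcases : ∀ ρ : Perm (Fin 4), Perm.sign ρ = 1 → (0 = ρ 0 ∨ 0 = ρ 1) →
        (1 = ρ 0 ∨ 1 = ρ 1) → ρ = 1 ∨ ρ = sL * sS := by decide
    refine hcases ρ hs ?_ ?_
    · by_contra hcon
      push Not at hcon
      simp [hcon.1, hcon.2] at h50
      omega
    · by_contra hcon
      push Not at hcon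
      simp [hcon.1, hcon.2] at h51
      omega
  rcases h6 with rfl | rfl
  · rw [mul_one]
  · exact absurd rfl hJ

/-- At a point on an edge, the left hand side of the gluing equation is a product over the flags
around the edge. -/
theorem gluingProd_edge (z : T.Simplex → ShapeFun n) (f : T.Simplex × Perm (Fin 4)) :
    gluingProd z (edgePoint ha hb h f) = ((T.cycle f).map fun f' =>
      shapeProd (z f'.1) (comb (f'.2 0) (f'.2 1) (f'.2 2) a b 0) ^
        ((T.orient f'.1 : ℤˣ) : ℤ)).prod := by
  classical
  let S : List (T.Simplex × IntPt n) := (T.cycle f).map (edgePoint ha hb h)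
  have hmem : ∀ x, x ∈ S.toFinset ↔ ∃ f' ∈ T.cycle f, edgePoint ha hb h f' = x := by
    intro x
    rw [List.mem_toFinset, List.mem_map]
  have hnd : S.Nodup := by
    have e : S = (List.range (Function.minimalPeriod T.turn f)).map
        fun j => edgePoint ha hb h (T.turn^[j] f) := List.map_map
    rw [e]
    refine List.Nodup.map_on (fun i hi j hj hij => ?_) List.nodup_range
    rw [List.mem_range] at hi hj
    have hinj : ∀ i j, i ≤ j → j < Function.minimalPeriod T.turn f →
        edgePoint ha hb h (T.turn^[i] f) = edgePoint ha hb h (T.turn^[j] f) → i = j := by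
      intro i j hij hj he
      have h1 : T.turn^[j - i] (T.turn^[i] f) = T.turn^[j] f := by
        rw [← Function.iterate_add_apply, Nat.sub_add_cancel hij]
      exact Function.iterate_injOn_Iio_minimalPeriod (Set.mem_Iio.2 (hij.trans_lt hj))
        (Set.mem_Iio.2 hj) (edgePoint_injOn ha hb h h1 he)
    rcases le_total i j with hle | hle
    · exact hinj i j hle hj hij
    · exact (hinj j i hle hi hij.symm).symm
  rw [gluingProd, filter_eqvGen (S := S.toFinset), List.prod_toFinset _ hnd, List.map_map]
  · rfl
  · exact (hmem _).2 ⟨f, mem_cycle_iff.2 ⟨0, rfl⟩, rfl⟩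
  · intro x hx y hy
    obtain ⟨f', hf', rfl⟩ := (hmem x).1 hx
    rcases (glued_edgePoint_iff ha hb h f' y).1 hy with rfl | rfl
    · exact (hmem _).2 ⟨_, turn_mem_cycle hf', rfl⟩
    · exact (hmem _).2 ⟨_, unturn_mem_cycle hf', rfl⟩
  · intro x hx
    obtain ⟨f', hf', rfl⟩ := (hmem x).1 hx
    obtain ⟨k, rfl⟩ := mem_cycle_iff.1 hf'
    clear hx hf'
    induction k with
    | zero => exact Relation.EqvGen.refl _
    | succ k ih =>
      refine ih.trans _ _ _ (Relation.EqvGen.rel _ _ ?_)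
      rw [Function.iterate_succ_apply']
      exact (glued_edgePoint_iff ha hb h _ _).2 (Or.inl rfl)

end

end Triangulation

/-! ### Shape assignments on a triangulation -/

theorem shapeProd_ne_zero {n : ℕ} {z : ShapeFun n} (hz : IsShapeAssignment z) (t : Fin 4 → ℕ) :
    shapeProd z t ≠ 0 :=
  Finset.prod_ne_zero_iff.2 fun x _ => (hz.1 x.1 x.2).1

namespace Triangulation

variable {T : Triangulation} {n : ℕ}

/-- The parameters of the short edge at a flag. -/
noncomputable def shortParam (z : T.Simplex → ShapeFun n) (i : ℕ)
    (f : T.Simplex × Perm (Fin 4)) : ℂ :=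
  (z f.1).val (comb (f.2 0) (f.2 1) (f.2 2) (i - 1) (n - 1 - i) 0)
    (comb (f.2 0) (f.2 1) (f.2 2) 1 1 0) ^ (-((Perm.sign f.2 : ℤˣ) : ℤ))

/-- The gluing equation at a point on an edge says that the parameters of the short edges around it
multiply to `1`. -/
theorem gluingProd_edge_eq_one_iff (z : T.Simplex → ShapeFun n) (f : T.Simplex × Perm (Fin 4))
    {i : ℕ} (hi : 0 < i) (hi' : 0 < n - i) (h : i + (n - i) = n) :
    gluingProd z (edgePoint hi hi' h f) = 1 ↔ ((T.cycle f).map (shortParam z i)).prod = 1 := by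
  -- the orientation of the flags is constant along the cycle
  have key : ∀ f' ∈ T.cycle f, shapeProd (z f'.1) (comb (f'.2 0) (f'.2 1) (f'.2 2) i (n - i) 0) ^
      ((T.orient f'.1 : ℤˣ) : ℤ) =
        shortParam z i f' ^ (-((T.orient f.1 * Perm.sign f.2 : ℤˣ) : ℤ)) := by
    intro f' hf'
    obtain ⟨k, rfl⟩ := mem_cycle_iff.1 hf'
    rw [← orient_iterate f k]
    set f' := T.turn^[k] f
    have e := shapeProd_edge_comb (z f'.1) f'.2 (a := i - 1) (b := n - 1 - i) (by omega)
    rw [Nat.sub_add_cancel hi, show n - 1 - i + 1 = n - i by omega] at e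
    rw [e, shortParam, ← _root_.zpow_mul]
    congr 1
    rcases Int.units_eq_one_or (Perm.sign f'.2) with hs | hs <;> simp [hs]
  have hprod : ∀ (m : ℤ) (l : List ℂ), (l.map (· ^ m)).prod = l.prod ^ m := by
    intro m l
    induction l with
    | nil => simp
    | cons a l ih => rw [List.map_cons, List.prod_cons, List.prod_cons, ih, _root_.mul_zpow]
  have e : (fun f' => shortParam z i f' ^ (-((T.orient f.1 * Perm.sign f.2 : ℤˣ) : ℤ))) =
      (· ^ (-((T.orient f.1 * Perm.sign f.2 : ℤˣ) : ℤ))) ∘ shortParam z i := rfl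
  rw [gluingProd_edge, List.map_congr_left key, e, ← List.map_map, hprod, _root_.zpow_neg, inv_eq_one,
    zpow_unit_eq_one_iff]

/-- The generalized gluing equations at interior points, at points in the interior of a face, and
at points on an edge. -/
theorem gluing_iff {z : T.Simplex → ShapeFun n} (hz : ∀ Δ, IsShapeAssignment (z Δ)) :
    (∀ p : T.Simplex × IntPt n, gluingProd z p = 1) ↔
      (∀ Δ, z Δ ∈ PtolemyShape.shapeSet n) ∧
      (∀ Δ (π : Perm (Fin 4)) i k, 1 ≤ i → 1 ≤ k → i + k + 1 ≤ n →
        shapeProd ((z (T.nbr Δ (π 3))).pullback (T.perm Δ (π 3)))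
            (comb (π 0) (π 1) (π 2) i (n - k - i) k) =
          shapeProd (z Δ) (comb (π 0) (π 1) (π 2) i (n - k - i) k)) ∧
      ∀ f i, 1 ≤ i → i + 1 ≤ n → ((T.cycle f).map (shortParam z i)).prod = 1 := by
  constructor
  · intro h
    refine ⟨fun Δ => ⟨hz Δ, fun t ht => ?_⟩, fun Δ π i k hi hk hik => ?_, fun f i hi hi' => ?_⟩
    · exact (gluingProd_interior z (Δ, t) ht).1 (h _)
    · have hne : ∀ j, j ≠ π 3 → comb (π 0) (π 1) (π 2) i (n - k - i) k j ≠ 0 := by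
        intro j hj
        obtain ⟨m, rfl⟩ := π.surjective j
        fin_cases m <;> simp [comb] at hj ⊢ <;> omega
      have hlt : ∀ j, comb (π 0) (π 1) (π 2) i (n - k - i) k j ≠ n := by
        intro j
        obtain ⟨m, rfl⟩ := π.surjective j
        fin_cases m <;> simp [comb] <;> omega
      let t : IntPt n := ⟨comb (π 0) (π 1) (π 2) i (n - k - i) k, by rw [sum_comb]; omega, hlt⟩
      exact (gluingProd_face z (Δ, t) (comb_apply_three π _ _ _) hne
        (shapeProd_ne_zero (hz Δ) _)).1 (h _)
    · exact (gluingProd_edge_eq_one_iff z f (by omega) (by omega) (by omega)).1 (h _)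
  · rintro ⟨h1, h2, h3⟩ ⟨Δ, t⟩
    by_cases ht : ∀ i, t.1 i ≠ 0
    · exact (gluingProd_interior z (Δ, t) ht).2 ((h1 Δ).2 t ht)
    push Not at ht
    obtain ⟨i, hi⟩ := ht
    have hsum : ∀ π : Perm (Fin 4), t.1 (π 0) + t.1 (π 1) + t.1 (π 2) + t.1 (π 3) = n := by
      intro π
      rw [← Fin.sum_univ_four fun j => t.1 (π j), Equiv.sum_comp π t.1]
      exact t.2.1
    by_cases hj : ∀ j, j ≠ i → t.1 j ≠ 0
    · refine (gluingProd_face z (Δ, t) hi hj (shapeProd_ne_zero (hz Δ) _)).2 ?_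
      obtain ⟨π, -, rfl⟩ := exists_perm (add_one_ne i)
      have hs := hsum π
      have n0 := hj (π 0) (by simp)
      have n1 := hj (π 1) (by simp)
      have n2 := hj (π 2) (by simp)
      have h := h2 Δ π (t.1 (π 0)) (t.1 (π 2)) (by omega) (by omega) (by omega)
      rw [show n - t.1 (π 2) - t.1 (π 0) = t.1 (π 1) by omega, ← eq_comb π hi] at h
      exact h
    · push Not at hj
      obtain ⟨j, hji, hj⟩ := hj
      obtain ⟨π', rfl, rfl⟩ := exists_perm hji
      let π : Perm (Fin 4) := π' * swap 0 2
      have e2 : π 2 = π' 0 := congrArg π' (swap_apply_right 0 2)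
      have e3 : π 3 = π' 3 := congrArg π' (by decide)
      rw [← e2] at hj
      rw [← e3] at hi
      have hs := hsum π
      have hl0 := t.2.2 (π 0)
      have hl1 := t.2.2 (π 1)
      have e : ((Δ, t) : T.Simplex × IntPt n) = edgePoint (n := n) (a := t.1 (π 0))
          (b := n - t.1 (π 0)) (by omega) (by omega) (by omega) (Δ, π) := by
        refine Prod.ext rfl (Subtype.ext ((eq_comb π hi).trans ?_))
        rw [hj, show t.1 (π 1) = n - t.1 (π 0) by omega]
        rfl
      rw [e, gluingProd_edge_eq_one_iff]
      exact h3 _ _ (by omega) (by omega)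

/-- A product of diagonal matrices `∏ H_i` is scalar if and only if all parameters are `1`. -/
theorem prod_short_eq_one_iff {G : T.Simplex × Perm (Fin 4) → PGLn n} (z : T.Simplex → ShapeFun n)
    (hn : 0 < n) (hG : ∀ f, IsClassOf (G f) (shortShapeMat (z f.1) f.2))
    (l : List (T.Simplex × Perm (Fin 4))) :
    (l.map G).prod = 1 ↔ ∀ i, 1 ≤ i → i + 1 ≤ n → (l.map (shortParam z i)).prod = 1 := by
  have key : IsClassOf (l.map G).prod (diagonal fun r : Fin n =>
      ∏ i ∈ Finset.Ioc (r : ℕ) (n - 1), (l.map (shortParam z i)).prod) := by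
    induction l with
    | nil => exact ⟨1, by simp, map_one _⟩
    | cons f l ih =>
      have h := (hG f).mul ih
      rw [shortShapeMat, prod_hMat, diagonal_mul_diagonal] at h
      simp only [List.map_cons, List.prod_cons, Finset.prod_mul_distrib]
      exact h
  have h1 : IsClassOf (1 : PGLn n) (1 : Matrix (Fin n) (Fin n) ℂ) := ⟨1, rfl, map_one _⟩
  constructor
  · intro h
    rw [h] at key
    obtain ⟨c, hc, he⟩ := h1.exists_smul key
    have hd : ∀ r : Fin n,
        ∏ i ∈ Finset.Ioc (r : ℕ) (n - 1), (l.map (shortParam z i)).prod = c := by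
      intro r
      have h := congrFun (congrFun he r) r
      simpa using h
    have hc1 : c = 1 := by
      rw [← hd ⟨n - 1, by omega⟩]
      simp
    intro i hi hi'
    have ha := hd ⟨i - 1, by omega⟩
    have hb := hd ⟨i, by omega⟩
    dsimp only at ha hb
    have e : Finset.Ioc (i - 1) (n - 1) = insert i (Finset.Ioc i (n - 1)) := by
      ext j
      simp only [Finset.mem_Ioc, Finset.mem_insert]
      omega
    rw [e, Finset.prod_insert (by simp), hb, hc1, mul_one] at ha
    exact ha
  · intro h
    refine key.eq h1 one_ne_zero ?_
    rw [one_smul, ← diagonal_one]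
    congr 1
    funext r
    refine (Finset.prod_eq_one fun i hi => ?_).symm
    rw [Finset.mem_Ioc] at hi
    exact h i (by omega) (by omega)

/-! ### The lower row of the diagram on a triangulation -/

theorem genericPGL_iff (hn : 0 < n) {D : T.Simplex → Decoration (B n)}
    (hD : ∀ Δ, D Δ ∈ PtolemyShape.genericPGL n) :
    T.IsDecoration D ↔ T.IsCocycle fun Δ => cocyclePGL (D Δ) :=
  isDecoration_iff_isCocycle (isNaturality_PGL n) fun Δ => exists_isNatPGL hn (hD Δ)

theorem bijOn_cocyclePGL (hn : 0 < n) :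
    Set.BijOn (fun (D : T.Simplex → Decoration (B n)) Δ => cocyclePGL (D Δ))
      (T.genericPGL n) (T.naturalPGL n) := by
  have hb := PtolemyShape.bijOn_cocyclePGL hn
  refine ⟨fun D hD => ⟨(genericPGL_iff hn hD.2).1 hD.1, fun Δ => hb.mapsTo (hD.2 Δ)⟩,
    fun D hD D' hD' h => funext fun Δ => hb.injOn (hD.2 Δ) (hD'.2 Δ) (congrFun h Δ), fun σ hσ => ?_⟩
  choose D hD h using fun Δ => hb.surjOn (hσ.2 Δ)
  obtain rfl : (fun Δ => cocyclePGL (D Δ)) = σ := funext h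
  exact ⟨D, ⟨(genericPGL_iff hn hD).2 hσ.1, hD⟩, rfl⟩

/-- Tuples of generic decorations are decorations of the triangulation if and only if the shape
parameters satisfy the gluing equations. -/
theorem isDecoration_iff_gluing (hn : 0 < n) {D : T.Simplex → Decoration (B n)}
    (hD : ∀ Δ, D Δ ∈ PtolemyShape.genericPGL n) :
    T.IsDecoration D ↔ ∀ p : T.Simplex × IntPt n, gluingProd (fun Δ => shapeOf (D Δ)) p = 1 := by
  have hb := PtolemyShape.bijOn_shapeOf hn
  have hz : ∀ Δ, shapeOf (D Δ) ∈ PtolemyShape.shapeSet n := fun Δ => hb.mapsTo (hD Δ)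
  have hF := fun Δ => isShapeFormula_PGL hn (hD Δ)
  have hshort : ∀ f, ((T.cycle f).map fun f' => (cocyclePGL (D f'.1)).γ f'.2).prod = 1 ↔
      ∀ i, 1 ≤ i → i + 1 ≤ n →
        ((T.cycle f).map (shortParam (fun Δ => shapeOf (D Δ)) i)).prod = 1 := fun f =>
    prod_short_eq_one_iff (G := fun f' => (cocyclePGL (D f'.1)).γ f'.2)
      (fun Δ => shapeOf (D Δ)) hn (fun f' => (hF f'.1 f'.2).2.2) (T.cycle f)
  rw [gluing_iff fun Δ => (hz Δ).1]
  constructor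
  · intro hdec
    have hc := (genericPGL_iff hn hD).1 hdec
    refine ⟨hz, fun Δ π i k hi hk hik => ?_, fun f => (hshort f).1 (hc.2 f)⟩
    obtain ⟨g, x, hg, hx, -⟩ := hdec
    obtain ⟨E, hE, E', hE', h1, h2, h3⟩ := exists_affine_lift hn (by rw [hg]; exact hD Δ)
      (by rw [hg]; exact hD _) (hx Δ (π 3)).1
    rw [hg] at h1 h2
    have hc := (PtolemyShape.bijOn_ptolemyOf n).mapsTo hE
    have hc' := (PtolemyShape.bijOn_ptolemyOf n).mapsTo hE'
    rw [← h1, ← h2, shapeOf_toFlags, shapeOf_toFlags, ← mu_pullback hc']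
    exact shapeProd_mu_congr hc (pullback_mem_ptolemySet hc' _) (fun t ht => val_eq_of_face h3 ht)
      hi hk hik
  · rintro ⟨-, h2, h3⟩
    refine (genericPGL_iff hn hD).2 ⟨fun Δ π => ?_, fun f => (hshort f).2 (h3 f)⟩
    have h := isShapeFormula_PGL hn
      (genericPGL_pullback (hD (T.nbr Δ (π 3))) (T.perm Δ (π 3))) π
    rw [shapeOf_pullback hn (hD _), cocyclePGL_pullback hn (hD _)] at h
    refine ⟨(hF Δ π).1.trans h.1.symm, (hF Δ π).2.1.eq h.2.1 one_ne_zero ?_⟩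
    rw [one_smul, middleShapeMat, middleShapeMat]
    congr 2
    refine List.map_congr_left fun k hk => ?_
    rw [List.mem_range'_1] at hk
    congr 2
    refine List.map_congr_left fun i hi => ?_
    rw [List.mem_range'_1] at hi
    rw [xCoord, xCoord, h2 Δ π i k (by omega) (by omega) (by omega)]

theorem bijOn_shapeOf (hn : 0 < n) :
    Set.BijOn (fun (D : T.Simplex → Decoration (B n)) Δ => shapeOf (D Δ))
      (T.genericPGL n) (T.shapeSet n) := by
  have hb := PtolemyShape.bijOn_shapeOf hn
  refine ⟨fun D hD => ⟨fun Δ => (hb.mapsTo (hD.2 Δ)).1, (isDecoration_iff_gluing hn hD.2).1 hD.1⟩,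
    fun D hD D' hD' h => funext fun Δ => hb.injOn (hD.2 Δ) (hD'.2 Δ) (congrFun h Δ), fun z hz => ?_⟩
  choose D hD h using fun Δ => hb.surjOn (((gluing_iff hz.1).1 hz.2).1 Δ)
  obtain rfl : (fun Δ => shapeOf (D Δ)) = z := funext h
  exact ⟨D, ⟨(isDecoration_iff_gluing hn hD).2 hz.2, hD⟩, rfl⟩

/-- Passing from affine flags to flags on a triangulation. -/
theorem toFlags_mem {D : T.Simplex → Decoration (N n)} (hn : 0 < n) (hD : D ∈ T.genericSL n) :
    (fun Δ => toFlags (D Δ)) ∈ T.genericPGL n := by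
  have hG : ∀ Δ, toFlags (D Δ) ∈ PtolemyShape.genericPGL n := fun Δ =>
    PtolemyShape.toFlags_mem (hD.2 Δ)
  refine ⟨?_, hG⟩
  obtain ⟨g, x, hg, hx, he⟩ := hD.1
  choose h hh using fun Δ => exists_lift (g Δ)
  have hF : ∀ Δ, decMk (fun v => ((slToPGL (h Δ v) : PGLn n) : PGLn n ⧸ B n)) =
      toFlags (D Δ) := by
    intro Δ
    rw [← hg, ← hh]
    exact (toFlags_dec (h Δ)).symm
  refine isDecoration_of_glue (isNaturality_PGL n)
    (g := fun Δ v => ((slToPGL (h Δ v) : PGLn n) : PGLn n ⧸ B n))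
    (x := fun Δ i => slToPGL (x Δ i)) hF
    (fun Δ => exists_cochain_of_decMk (isNaturality_PGL n) (exists_isNatPGL hn (hG Δ)) (hF Δ))
    (fun Δ i v hv => ?_) fun f => ?_
  · have h1 := (hx Δ i).1 v hv
    rw [← hh, ← hh] at h1
    have h2 := slToPGL_mem_B (QuotientGroup.eq.1
      (show ((x Δ i * h Δ v : SLn n) : SLn n ⧸ N n) = _ from h1))
    rw [map_mul, map_inv, map_mul] at h2
    exact QuotientGroup.eq.2 h2
  · have h1 := congrArg slToPGL (he f)
    rw [map_one, map_list_prod, List.map_reverse, List.map_map] at h1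
    exact h1

end Triangulation

/-! ### The right hand vertical map and the symmetries of a triangulation -/

/-- The diagonal coboundary action `τ`, expressed through the decoration that a natural cocycle
determines. -/
noncomputable def cocycleMap {n : ℕ} (σ : Cocycle (SLn n)) : Cocycle (PGLn n) :=
  cocyclePGL (toFlags (σ.toDec (N n)))

theorem cocycleMap_cocycleSL {n : ℕ} {D : Decoration (N n)} (hD : D ∈ genericSL n) :
    cocycleMap (cocycleSL D) = cocyclePGL (toFlags D) := by
  rw [cocycleMap, toDec_cocycleSL hD]

theorem mu_ptolemyOf {n : ℕ} (D : Decoration (N n)) :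
    mu (ptolemyOf D) = shapeOf (toFlags D) := (shapeOf_toFlags D).symm

namespace Triangulation

variable {T : Triangulation} {n : ℕ}

theorem mapsTo_mu (hn : 0 < n) : Set.MapsTo (fun (c : T.Simplex → PtolemyFun n) Δ => mu (c Δ))
    (T.ptolemySet n) (T.shapeSet n) := by
  intro c hc
  obtain ⟨D, hD, rfl⟩ := bijOn_ptolemyOf.surjOn hc
  have h := (bijOn_shapeOf hn).mapsTo (toFlags_mem hn hD)
  simpa only [shapeOf_toFlags] using h

theorem mapsTo_cocycleMap (hn : 0 < n) :
    Set.MapsTo (fun (σ : T.Simplex → Cocycle (SLn n)) Δ => cocycleMap (σ Δ))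
      (T.naturalSL n) (T.naturalPGL n) := by
  intro σ hσ
  obtain ⟨D, hD, rfl⟩ := bijOn_cocycleSL.surjOn hσ
  have h := (bijOn_cocyclePGL hn).mapsTo (toFlags_mem hn hD)
  have e : (fun Δ => cocycleMap (cocycleSL (D Δ))) = fun Δ => cocyclePGL (toFlags (D Δ)) :=
    funext fun Δ => cocycleMap_cocycleSL (hD.2 Δ)
  change (fun Δ => cocycleMap (cocycleSL (D Δ))) ∈ _
  rw [e]
  exact h

variable (ρ : T.Simplex → Perm (Fin 4))

theorem genericSL_reorder {D : T.Simplex → Decoration (N n)} (hD : D ∈ T.genericSL n) :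
    (fun Δ => (D Δ).pullback (ρ Δ)) ∈ (T.reorder ρ).genericSL n :=
  ⟨isDecoration_reorder hD.1 ρ, fun Δ => genericSL_pullback (hD.2 Δ) (ρ Δ)⟩

theorem genericPGL_reorder {D : T.Simplex → Decoration (B n)} (hD : D ∈ T.genericPGL n) :
    (fun Δ => (D Δ).pullback (ρ Δ)) ∈ (T.reorder ρ).genericPGL n :=
  ⟨isDecoration_reorder hD.1 ρ, fun Δ => genericPGL_pullback (hD.2 Δ) (ρ Δ)⟩

theorem ptolemySet_reorder {c : T.Simplex → PtolemyFun n} (hc : c ∈ T.ptolemySet n) :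
    (fun Δ => (c Δ).pullback (ρ Δ)) ∈ (T.reorder ρ).ptolemySet n := by
  obtain ⟨D, hD, rfl⟩ := bijOn_ptolemyOf.surjOn hc
  have h := bijOn_ptolemyOf.mapsTo (genericSL_reorder ρ hD)
  have e : (fun Δ => (ptolemyOf (D Δ)).pullback (ρ Δ)) =
      fun Δ => ptolemyOf ((D Δ).pullback (ρ Δ)) :=
    funext fun Δ => (ptolemyOf_pullback _ _).symm
  exact e ▸ h

theorem shapeSet_reorder (hn : 0 < n) {z : T.Simplex → ShapeFun n} (hz : z ∈ T.shapeSet n) :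
    (fun Δ => (z Δ).pullback (ρ Δ)) ∈ (T.reorder ρ).shapeSet n := by
  obtain ⟨D, hD, rfl⟩ := (bijOn_shapeOf hn).surjOn hz
  have h := (bijOn_shapeOf hn).mapsTo (genericPGL_reorder ρ hD)
  have e : (fun Δ => (shapeOf (D Δ)).pullback (ρ Δ)) =
      fun Δ => shapeOf ((D Δ).pullback (ρ Δ)) :=
    funext fun Δ => (shapeOf_pullback hn (hD.2 Δ) _).symm
  exact e ▸ h

theorem naturalSL_reorder {σ : T.Simplex → Cocycle (SLn n)} (hσ : σ ∈ T.naturalSL n) :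
    (fun Δ => (σ Δ).pullback (ρ Δ)) ∈ (T.reorder ρ).naturalSL n := by
  obtain ⟨D, hD, rfl⟩ := bijOn_cocycleSL.surjOn hσ
  have h := bijOn_cocycleSL.mapsTo (genericSL_reorder ρ hD)
  have e : (fun Δ => (cocycleSL (D Δ)).pullback (ρ Δ)) =
      fun Δ => cocycleSL ((D Δ).pullback (ρ Δ)) :=
    funext fun Δ => (cocycleSL_pullback (hD.2 Δ) _).symm
  exact e ▸ h

theorem naturalPGL_reorder (hn : 0 < n) {σ : T.Simplex → Cocycle (PGLn n)}
    (hσ : σ ∈ T.naturalPGL n) :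
    (fun Δ => (σ Δ).pullback (ρ Δ)) ∈ (T.reorder ρ).naturalPGL n := by
  obtain ⟨D, hD, rfl⟩ := (bijOn_cocyclePGL hn).surjOn hσ
  have h := (bijOn_cocyclePGL hn).mapsTo (genericPGL_reorder ρ hD)
  have e : (fun Δ => (cocyclePGL (D Δ)).pullback (ρ Δ)) =
      fun Δ => cocyclePGL ((D Δ).pullback (ρ Δ)) :=
    funext fun Δ => (cocyclePGL_pullback hn (hD.2 Δ) _).symm
  exact e ▸ h

end Triangulation

end PtolemyShape

theorem theorem1p3 (n : ℕ) (hn : 2 ≤ n) :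
    ∃ (C : Decoration (N n) → PtolemyFun n)
      (Lab : Decoration (N n) → Cocycle (SLn n))
      (Z : Decoration (B n) → ShapeFun n)
      (Labc : Decoration (B n) → Cocycle (PGLn n))
      (pr : Decoration (N n) → Decoration (B n))
      (tau : Cocycle (SLn n) → Cocycle (PGLn n)),
      -- definitions of the maps
      (∀ g : Fin 4 → SLn n, IsGenericTuple (fun i => (g i).1) →
        C (dec (N n) g) = detCoords (fun i => (g i).1)) ∧
      (∀ g : Fin 4 → GLn n, IsGenericTuple (fun i => (g i).1) →
        Z (dec (B n) (fun i => pcl (g i))) = mu (detCoords (fun i => (g i).1))) ∧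
      (∀ g : Fin 4 → SLn n, IsGenericTuple (fun i => (g i).1) →
        (∃! τ, IsNaturalSLCochain g τ) ∧
        ∀ τ, IsNaturalSLCochain g τ → Lab (dec (N n) g) = coboundary τ) ∧
      (∀ g : Fin 4 → GLn n, IsGenericTuple (fun i => (g i).1) →
        (∃! τ, IsNaturalPGLCochain (fun i => pcl (g i)) τ) ∧
        ∀ τ, IsNaturalPGLCochain (fun i => pcl (g i)) τ →
          Labc (dec (B n) (fun i => pcl (g i))) = coboundary τ) ∧
      (∀ g : Fin 4 → SLn n, pr (dec (N n) g) = dec (B n) (fun i => slToPGL (g i))) ∧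
      (∀ D ∈ genericSL n, IsTauOf (C D) (Lab D) (tau (Lab D))) ∧
      -- the diagram for a simplex
      Set.BijOn C (genericSL n) (ptolemySet n) ∧
      Set.BijOn Lab (genericSL n) (naturalSL n) ∧
      Set.BijOn Z (genericPGL n) (shapeSet n) ∧
      Set.BijOn Labc (genericPGL n) (naturalPGL n) ∧
      Set.MapsTo mu (ptolemySet n) (shapeSet n) ∧
      Set.MapsTo pr (genericSL n) (genericPGL n) ∧
      Set.MapsTo tau (naturalSL n) (naturalPGL n) ∧
      (∀ D ∈ genericSL n, mu (C D) = Z (pr D) ∧ tau (Lab D) = Labc (pr D)) ∧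
      -- the inverses of the horizontal maps
      Set.InvOn (Cocycle.toDec (N n)) Lab (genericSL n) (naturalSL n) ∧
      Set.InvOn (Cocycle.toDec (B n)) Labc (genericPGL n) (naturalPGL n) ∧
      (∀ D ∈ genericSL n, IsPtolemyFormula (C D) (Lab D)) ∧
      (∀ D ∈ genericPGL n, IsShapeFormula (Z D) (Labc D)) ∧
      (∀ c ∈ ptolemySet n, (∃! σ, IsPtolemyFormula c σ) ∧
        ∀ σ, IsPtolemyFormula c σ → σ.toDec (N n) ∈ genericSL n ∧ C (σ.toDec (N n)) = c) ∧
      (∀ z ∈ shapeSet n, (∃! σ, IsShapeFormula z σ) ∧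
        ∀ σ, IsShapeFormula z σ → σ.toDec (B n) ∈ genericPGL n ∧ Z (σ.toDec (B n)) = z) ∧
      -- compatibility with the symmetries of a simplex
      (∀ ρ : Equiv.Perm (Fin 4),
        Set.MapsTo (PtolemyFun.pullback ρ) (ptolemySet n) (ptolemySet n) ∧
        Set.MapsTo (ShapeFun.pullback ρ) (shapeSet n) (shapeSet n) ∧
        Set.MapsTo (Decoration.pullback ρ) (genericSL n) (genericSL n) ∧
        Set.MapsTo (Decoration.pullback ρ) (genericPGL n) (genericPGL n) ∧
        Set.MapsTo (Cocycle.pullback ρ) (naturalSL n) (naturalSL n) ∧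
        Set.MapsTo (Cocycle.pullback ρ) (naturalPGL n) (naturalPGL n) ∧
        (∀ c ∈ ptolemySet n, mu (c.pullback ρ) = (mu c).pullback ρ) ∧
        (∀ D ∈ genericSL n, C (D.pullback ρ) = (C D).pullback ρ ∧
          Lab (D.pullback ρ) = (Lab D).pullback ρ ∧ pr (D.pullback ρ) = (pr D).pullback ρ) ∧
        (∀ D ∈ genericPGL n, Z (D.pullback ρ) = (Z D).pullback ρ ∧
          Labc (D.pullback ρ) = (Labc D).pullback ρ) ∧
        ∀ σ ∈ naturalSL n, tau (σ.pullback ρ) = (tau σ).pullback ρ) ∧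
      -- the diagram for a triangulation, and compatibility with reordering its simplices
      ∀ T : Triangulation,
        Set.BijOn (fun D Δ => C (D Δ)) (T.genericSL n) (T.ptolemySet n) ∧
        Set.BijOn (fun D Δ => Lab (D Δ)) (T.genericSL n) (T.naturalSL n) ∧
        Set.BijOn (fun D Δ => Z (D Δ)) (T.genericPGL n) (T.shapeSet n) ∧
        Set.BijOn (fun D Δ => Labc (D Δ)) (T.genericPGL n) (T.naturalPGL n) ∧
        Set.MapsTo (fun c Δ => mu (c Δ)) (T.ptolemySet n) (T.shapeSet n) ∧
        Set.MapsTo (fun D Δ => pr (D Δ)) (T.genericSL n) (T.genericPGL n) ∧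
        Set.MapsTo (fun σ Δ => tau (σ Δ)) (T.naturalSL n) (T.naturalPGL n) ∧
        ∀ ρ : T.Simplex → Equiv.Perm (Fin 4),
          (∀ c ∈ T.ptolemySet n,
            (fun Δ => (c Δ).pullback (ρ Δ)) ∈ (T.reorder ρ).ptolemySet n) ∧
          (∀ z ∈ T.shapeSet n,
            (fun Δ => (z Δ).pullback (ρ Δ)) ∈ (T.reorder ρ).shapeSet n) ∧
          (∀ D ∈ T.genericSL n,
            (fun Δ => (D Δ).pullback (ρ Δ)) ∈ (T.reorder ρ).genericSL n) ∧
          (∀ D ∈ T.genericPGL n,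
            (fun Δ => (D Δ).pullback (ρ Δ)) ∈ (T.reorder ρ).genericPGL n) ∧
          (∀ σ ∈ T.naturalSL n,
            (fun Δ => (σ Δ).pullback (ρ Δ)) ∈ (T.reorder ρ).naturalSL n) ∧
          ∀ σ ∈ T.naturalPGL n,
            (fun Δ => (σ Δ).pullback (ρ Δ)) ∈ (T.reorder ρ).naturalPGL n := by
  have hn' : 0 < n := by omega
  have bC := bijOn_ptolemyOf n
  have bL := bijOn_cocycleSL n
  have bZ := bijOn_shapeOf hn'
  have bM := bijOn_cocyclePGL hn'
  refine ⟨ptolemyOf, cocycleSL, shapeOf, cocyclePGL, toFlags, cocycleMap,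
    fun g _ => ptolemyOf_dec g, fun g _ => shapeOf_dec g, fun g hg => ?_, fun g hg => ?_,
    toFlags_dec, fun D hD => ?_, bC, bL, bZ, bM, fun c hc => mu_mem_shapeSet hc,
    fun D hD => toFlags_mem hD, fun σ hσ => ?_,
    fun D hD => ⟨mu_ptolemyOf D, cocycleMap_cocycleSL hD⟩, ⟨fun D hD => toDec_cocycleSL hD, ?_⟩,
    ⟨fun D hD => toDec_cocyclePGL hn' hD, ?_⟩, fun D hD => isPtolemyFormula_SL hD,
    fun D hD => isShapeFormula_PGL hn' hD, fun c hc => ?_, fun z hz => ?_, fun ρ => ?_, fun T =>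
    ⟨Triangulation.bijOn_ptolemyOf, Triangulation.bijOn_cocycleSL,
      Triangulation.bijOn_shapeOf hn', Triangulation.bijOn_cocyclePGL hn',
      Triangulation.mapsTo_mu hn', fun D hD => Triangulation.toFlags_mem hn' hD,
      Triangulation.mapsTo_cocycleMap hn', fun ρ =>
      ⟨fun c hc => Triangulation.ptolemySet_reorder ρ hc,
        fun z hz => Triangulation.shapeSet_reorder ρ hn' hz,
        fun D hD => Triangulation.genericSL_reorder ρ hD,
        fun D hD => Triangulation.genericPGL_reorder ρ hD,
        fun σ hσ => Triangulation.naturalSL_reorder ρ hσ,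
        fun σ hσ => Triangulation.naturalPGL_reorder ρ hn' hσ⟩⟩⟩
  · obtain ⟨τ, hτ⟩ := exists_naturalSLCochain hg
    exact ⟨⟨τ, hτ, fun τ' h => h.unique hτ⟩, fun τ' h => cocycleSL_dec h⟩
  · obtain ⟨τ, hτ⟩ := exists_naturalPGLCochain hn' hg
    exact ⟨⟨τ, hτ, fun τ' h => h.unique hτ⟩, fun τ' h => cocyclePGL_dec h⟩
  · rw [cocycleMap_cocycleSL hD]
    exact isTauOf_toFlags hn' hD
  · obtain ⟨D, hD, rfl⟩ := bL.surjOn hσ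
    rw [cocycleMap_cocycleSL hD]
    exact bM.mapsTo (toFlags_mem hD)
  · intro σ hσ
    obtain ⟨D, hD, rfl⟩ := bL.surjOn hσ
    rw [toDec_cocycleSL hD]
  · intro σ hσ
    obtain ⟨D, hD, rfl⟩ := bM.surjOn hσ
    rw [toDec_cocyclePGL hn' hD]
  · obtain ⟨D, hD, rfl⟩ := bC.surjOn hc
    have h := isPtolemyFormula_SL hD
    refine ⟨⟨_, h, fun σ hσ => hσ.unique h⟩, fun σ hσ => ?_⟩
    rw [hσ.unique h, toDec_cocycleSL hD]
    exact ⟨hD, rfl⟩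
  · obtain ⟨D, hD, rfl⟩ := bZ.surjOn hz
    have h := isShapeFormula_PGL hn' hD
    refine ⟨⟨_, h, fun σ hσ => hσ.unique h⟩, fun σ hσ => ?_⟩
    rw [hσ.unique h, toDec_cocyclePGL hn' hD]
    exact ⟨hD, rfl⟩
  · refine ⟨fun c hc => pullback_mem_ptolemySet hc ρ, fun z hz => ?_,
      fun D hD => genericSL_pullback hD ρ, fun D hD => genericPGL_pullback hD ρ, fun σ hσ => ?_,
      fun σ hσ => ?_, fun c hc => mu_pullback hc ρ,
      fun D hD => ⟨ptolemyOf_pullback D ρ, cocycleSL_pullback hD ρ, toFlags_pullback D ρ⟩,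
      fun D hD => ⟨shapeOf_pullback hn' hD ρ, cocyclePGL_pullback hn' hD ρ⟩, fun σ hσ => ?_⟩
    · obtain ⟨D, hD, rfl⟩ := bZ.surjOn hz
      rw [← shapeOf_pullback hn' hD]
      exact bZ.mapsTo (genericPGL_pullback hD ρ)
    · obtain ⟨D, hD, rfl⟩ := bL.surjOn hσ
      rw [← cocycleSL_pullback hD]
      exact bL.mapsTo (genericSL_pullback hD ρ)
    · obtain ⟨D, hD, rfl⟩ := bM.surjOn hσ
      rw [← cocyclePGL_pullback hn' hD]
      exact bM.mapsTo (genericPGL_pullback hD ρ)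
    · obtain ⟨D, hD, rfl⟩ := bL.surjOn hσ
      rw [← cocycleSL_pullback hD, cocycleMap_cocycleSL (genericSL_pullback hD ρ),
        cocycleMap_cocycleSL hD, toFlags_pullback, cocyclePGL_pullback hn' (toFlags_mem hD)]
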